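/- Let $\zeta$ be a primitive $7$-th root of unity, $\alpha=\zeta+\zeta^{-1}$ and $K=\mathbb{Q}(\alpha)$, the maximal real subfield of $\mathbb{Q}(\zeta)$, with its automorphism $\sigma:\alpha\mapsto-\alpha^2-\alpha+1$. Put $\pi=\alpha^2-\alpha-2$. Let $L=K(\theta)$, where $\theta$ is a root of $$f(x)=x^3+(\alpha-2)x^2-(\alpha+1)x+1,$$ let $\varphi$ be the automorphism of $L/K$ with $\varphi(\theta)=-\theta^2+(-\alpha+1)\theta+2$, and let $D=(L/K,\varphi,2\pi)=L\oplus Lu\oplus Lu^2$ be the cyclic algebra with $u^3=2\pi$ and $ul=\varphi(l)u$ for $l\in L$. There is exactly one ring automorphism $\tilde\sigma$ of $D$ that extends $\sigma$ and satisfies $$\tilde\sigma(\theta)=\frac1{673}\sum_{i,j=0}^{2}c_{ij}\theta^iu^j,\qquad \tilde\sigma(u)=\bigl((\alpha^2+\alpha)+(-\alpha+1)\theta-\theta^2\bigr)u,$$ where $$(c_{ij})=\begin{bmatrix}303\alpha^2-154\alpha-276&314\alpha^2+218\alpha-326&-48\alpha^2+151\alpha+157\\390\alpha^2+708\alpha-855&40\alpha^2-238\alpha+430&-397\alpha^2-27\alpha+275\\-106\alpha^2+25\alpha+543&-128\alpha^2-46\alpha-30&135\alpha^2+38\alpha-63\end{bmatrix}.$$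 Let $D[x,\tilde\sigma]$ be the twisted polynomial ring ($xa=\tilde\sigma(a)x$ for $a\in D$), and let $D((x,\tilde\sigma))$ be the twisted Laurent series ring of formal series $\sum_{i\ge k}a_ix^i$ ($k\in\mathbb{Z}$, $a_i\in D$) with the same multiplication rule. Then the non-zero-divisors of $D[x,\tilde\sigma]$ satisfy the Ore condition, so that the twisted function field $D(x,\tilde\sigma)$, the ring of fractions of $D[x,\tilde\sigma]$, is defined, and the following hold. 1. There is $d\in D^\times$ with $\tilde\sigma^3(a)=dad^{-1}$ for all $a\in D$ and $\tilde\sigma(d)=d$. For every such $d$, with $t=d^{-1}x^3$, the ring $D(x,\tilde\sigma)$ is a division algebra whose centre is the rational function field $\mathbb{Q}(t)$ in the indeterminate $t$, it has degree $9$ (dimension $81$) over $\mathbb{Q}(t)$, and it is a noncrossed product: no maximal subfield of $D(x,\tilde\sigma)$ is Galois over $\mathbb{Q}(t)$. 2. Let $0<\delta<1$. The map $\sum_i a_ix^i\mapsto\delta^{\min\{i\,:\,a_i\ne0\}}$, $0\mapsto 0$, is a valuation on $D((x,\tilde\sigma))$ (the $x$-adic valuation), the valuation on $D(x,\tilde\sigma)$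 given by the same rule on $D[x,\tilde\sigma]$ exists, and the inclusion $D[x,\tilde\sigma]\subset D((x,\tilde\sigma))$ extends to a ring homomorphism $D(x,\tilde\sigma)\to D((x,\tilde\sigma))$ by which $D((x,\tilde\sigma))$ is the completion of $D(x,\tilde\sigma)$ with respect to the $x$-adic valuation. -/

import Mathlib

open scoped NNReal Polynomial nonZeroDivisors

noncomputable section

/-! ### Twisted polynomials, twisted rational functions, twisted Laurent series -/

section Twisted

variable {R : Type*} [Ring R]

/-- The action of the monoid `ℕ` on `R` by the powers of the automorphism `σ`. -/
@[reducible] def twistAction (σ : RingAut R) : MulSemiringAction (Multiplicative ℕ) R :=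
  MulSemiringAction.compHom R (powersHom (RingAut R) σ)

/-- The twisted polynomial ring `R[x, σ]`, with `x a = σ(a) x`: Mathlib's skew polynomials
`∑ aᵢ xⁱ` for the action of `ℕ` on `R` generated by `σ`. -/
def TwistedPolynomial (_σ : RingAut R) : Type _ := SkewPolynomial R

namespace TwistedPolynomial

variable (σ : RingAut R)

instance : Ring (TwistedPolynomial σ) :=
  letI := twistAction σ
  inferInstanceAs (Ring (SkewMonoidAlgebra R (Multiplicative ℕ)))

/-- Constant twisted polynomials. -/
def C : R →+* TwistedPolynomial σ :=
  letI := twistAction σ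
  SkewPolynomial.CRingHom

/-- The indeterminate `x`. -/
def X : TwistedPolynomial σ := (SkewPolynomial.X : SkewPolynomial R)

/-- The coefficient `aₙ` of `∑ aᵢ xⁱ`. -/
def coeff {σ : RingAut R} (p : TwistedPolynomial σ) (n : ℕ) : R :=
  SkewPolynomial.coeff (R := R) p n

theorem X_mul_C (a : R) : X σ * C σ a = C σ (σ a) * X σ := by
  let _ := twistAction σ
  have h : (SkewPolynomial.φ : R →+* R) a = σ a := by
    change (powersHom (RingAut R) σ (Multiplicative.ofAdd 1)) • a = σ a
    simp [powersHom_apply]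
  have h1 : (SkewPolynomial.X : SkewPolynomial R) * SkewPolynomial.C a
      = SkewPolynomial.C (σ a) * SkewPolynomial.X := by
    rw [← SkewPolynomial.monomial_zero_left, SkewPolynomial.X_mul_monomial, h]
    simp [SkewPolynomial.X]
  exact h1

end TwistedPolynomial

/-- The twisted function field `R(x, σ)`: the ring of fractions `q⁻¹ p` of the twisted polynomial
ring `R[x, σ]` with respect to all its non-zero-divisors, which is defined as soon as these satisfy
the Ore condition. -/
abbrev TwistedFunctionField (σ : RingAut R)
    [OreLocalization.OreSet (nonZeroDivisors (TwistedPolynomial σ))] : Type _ :=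
  OreLocalization (nonZeroDivisors (TwistedPolynomial σ)) (TwistedPolynomial σ)

namespace TwistedFunctionField

variable (σ : RingAut R) [OreLocalization.OreSet (nonZeroDivisors (TwistedPolynomial σ))]

/-- The map `R[x, σ] → R(x, σ)`. -/
def ofPoly (p : TwistedPolynomial σ) : TwistedFunctionField σ :=
  OreLocalization.numeratorHom p

/-- The constant `a` in `R(x, σ)`. -/
def C (a : R) : TwistedFunctionField σ := ofPoly σ (TwistedPolynomial.C σ a)

/-- The indeterminate `x` in `R(x, σ)`. -/
def X : TwistedFunctionField σ := ofPoly σ (TwistedPolynomial.X σ)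

end TwistedFunctionField

/-- The twisted Laurent series ring `R((x, σ))`: formal series `∑_{i ≥ k} aᵢ xⁱ` with `k ∈ ℤ` and
`aᵢ ∈ R`. The underlying additive group is that of the functions `ℤ → R` whose support is
well-ordered, i.e. bounded below. -/
def TwistedLaurentSeries (_σ : RingAut R) : Type _ := HahnSeries ℤ R

namespace TwistedLaurentSeries

variable {σ : RingAut R}

instance : AddCommGroup (TwistedLaurentSeries σ) := inferInstanceAs (AddCommGroup (HahnSeries ℤ R))

/-- The coefficient `aₙ` of `∑ aᵢ xⁱ`. -/
def coeff (f : TwistedLaurentSeries σ) (n : ℤ) : R := HahnSeries.coeff (Γ := ℤ) (R := R) f n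

/-- The series `a xⁿ`. -/
def monomial (σ : RingAut R) (n : ℤ) (a : R) : TwistedLaurentSeries σ :=
  (HahnSeries.single n a : HahnSeries ℤ R)

/-- The product determined by `x a = σ(a) x`: the `n`-th coefficient of `(∑ aᵢ xⁱ) (∑ bⱼ xʲ)` is
`∑_{i + j = n} aᵢ σⁱ(bⱼ)`; the sum is over the finitely many `(i, j)` in the two supports. -/
def mulSeries (σ : RingAut R) (f g : HahnSeries ℤ R) : HahnSeries ℤ R where
  coeff n := ∑ ij ∈ Finset.antidiagonal f.isPWO_support g.isPWO_support n,
    f.coeff ij.1 * (σ ^ ij.1) (g.coeff ij.2)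
  isPWO_support' := by
    refine (f.isPWO_support.add g.isPWO_support).mono fun n hn ↦ ?_
    rw [Function.mem_support] at hn
    obtain ⟨ij, hij, -⟩ := Finset.exists_ne_zero_of_sum_ne_zero hn
    obtain ⟨h1, h2, h3⟩ := Finset.mem_antidiagonal.1 hij
    exact ⟨ij.1, h1, ij.2, h2, h3⟩

instance : Mul (TwistedLaurentSeries σ) := ⟨mulSeries σ⟩

instance : One (TwistedLaurentSeries σ) := ⟨monomial σ 0 1⟩

theorem ext {f g : TwistedLaurentSeries σ} (h : ∀ n, coeff f n = coeff g n) : f = g :=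
  HahnSeries.ext (funext h)

theorem coeff_add (f g : TwistedLaurentSeries σ) (n : ℤ) :
    coeff (f + g) n = coeff f n + coeff g n := rfl

theorem coeff_zero (n : ℤ) : coeff (0 : TwistedLaurentSeries σ) n = 0 := rfl

theorem coeff_monomial (n m : ℤ) (a : R) :
    coeff (monomial σ n a) m = if m = n then a else 0 := by
  simp only [coeff, monomial, HahnSeries.coeff_single]
  split_ifs <;> rfl

theorem coeff_mul (f g : TwistedLaurentSeries σ) (n : ℤ) :
    coeff (f * g) n = ∑ ij ∈ Finset.antidiagonal
      (HahnSeries.isPWO_support (Γ := ℤ) (R := R) f)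
      (HahnSeries.isPWO_support (Γ := ℤ) (R := R) g) n,
        coeff f ij.1 * (σ ^ ij.1) (coeff g ij.2) := rfl

/-- The operator `b ↦ a σⁿ(b)` on `R`. -/
def twistOp (σ : RingAut R) (a : R) (n : ℤ) : AddMonoid.End R :=
  (AddMonoidHom.mulLeft a).comp (σ ^ n : RingAut R).toRingHom.toAddMonoidHom

/-- Evaluation of operators at `b`. -/
def evalAt (b : R) : AddMonoid.End R →+ R := AddMonoidHom.eval b

theorem evalAt_twistOp (a b : R) (n : ℤ) : evalAt b (twistOp σ a n) = a * (σ ^ n) b := rfl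

theorem evalAt_mul (b : R) (F G : AddMonoid.End R) :
    evalAt b (F * G) = evalAt (evalAt b G) F := rfl

theorem end_ext {F G : AddMonoid.End R} (h : ∀ b, evalAt b F = evalAt b G) : F = G :=
  AddMonoidHom.ext h

/-- Auxiliary embedding into ordinary Laurent series with coefficients in `End R`, sending
`∑ aᵢ xⁱ` to `∑ (aᵢ σⁱ) yⁱ`; it serves to derive the ring axioms. -/
def toEnd (f : TwistedLaurentSeries σ) : HahnSeries ℤ (AddMonoid.End R) where
  coeff n := twistOp σ (coeff f n) n
  isPWO_support' := by
    refine (HahnSeries.isPWO_support (Γ := ℤ) (R := R) f).mono fun n hn h ↦ hn ?_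
    refine end_ext fun b ↦ ?_
    rw [evalAt_twistOp, map_zero, show coeff f n = 0 from h, zero_mul]

theorem evalAt_toEnd (f : TwistedLaurentSeries σ) (n : ℤ) (b : R) :
    evalAt b ((toEnd f).coeff n) = coeff f n * (σ ^ n) b := rfl

theorem hahn_ext {F G : HahnSeries ℤ (AddMonoid.End R)}
    (h : ∀ n b, evalAt b (F.coeff n) = evalAt b (G.coeff n)) : F = G :=
  HahnSeries.ext (funext fun n ↦ end_ext (h n))

theorem toEnd_injective : Function.Injective (toEnd (σ := σ)) := by
  intro f g h
  refine ext fun n ↦ ?_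
  have h1 := congrArg (fun F ↦ evalAt (1 : R) (HahnSeries.coeff F n)) h
  simpa only [evalAt_toEnd, map_one, mul_one] using h1

theorem toEnd_add (f g : TwistedLaurentSeries σ) : toEnd (f + g) = toEnd f + toEnd g := by
  refine hahn_ext fun n b ↦ ?_
  rw [HahnSeries.coeff_add, map_add]
  simp only [evalAt_toEnd, coeff_add, add_mul]

theorem toEnd_zero : toEnd (0 : TwistedLaurentSeries σ) = 0 := by
  refine hahn_ext fun n b ↦ ?_
  rw [HahnSeries.coeff_zero, map_zero, evalAt_toEnd, coeff_zero, zero_mul]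

theorem toEnd_one : toEnd (1 : TwistedLaurentSeries σ) = 1 := by
  refine hahn_ext fun n b ↦ ?_
  rw [HahnSeries.coeff_one, evalAt_toEnd]
  change coeff (monomial σ 0 1) n * (σ ^ n) b = _
  rw [coeff_monomial]
  split_ifs with h
  · subst h
    rw [zpow_zero, one_mul]
    rfl
  · rw [zero_mul, map_zero]

theorem support_toEnd (h : TwistedLaurentSeries σ) :
    (toEnd h).support ⊆ HahnSeries.support (Γ := ℤ) (R := R) h := by
  intro m hm h0
  refine hm (end_ext fun b ↦ ?_)
  rw [evalAt_toEnd, show coeff h m = 0 from h0, zero_mul, map_zero]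

theorem toEnd_mul (f g : TwistedLaurentSeries σ) : toEnd (f * g) = toEnd f * toEnd g := by
  refine hahn_ext fun n b ↦ ?_
  rw [HahnSeries.coeff_mul_left' (HahnSeries.isPWO_support (Γ := ℤ) (R := R) f) (support_toEnd f),
    map_sum, evalAt_toEnd, coeff_mul, Finset.sum_mul]
  have hsub : Finset.antidiagonal (HahnSeries.isPWO_support (Γ := ℤ) (R := R) f)
      (toEnd g).isPWO_support n ⊆ Finset.antidiagonal
        (HahnSeries.isPWO_support (Γ := ℤ) (R := R) f)
        (HahnSeries.isPWO_support (Γ := ℤ) (R := R) g) n := by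
    intro ij hij
    rw [Finset.mem_antidiagonal] at hij ⊢
    exact ⟨hij.1, support_toEnd g hij.2.1, hij.2.2⟩
  symm
  refine (Finset.sum_subset hsub fun ij h1 h2 ↦ ?_).trans (Finset.sum_congr rfl fun ij hij ↦ ?_)
  · rw [Finset.mem_antidiagonal] at h1 h2
    have h3 : (toEnd g).coeff ij.2 = 0 := by
      by_contra h
      exact h2 ⟨h1.1, h, h1.2.2⟩
    rw [h3, mul_zero, map_zero]
  · obtain ⟨-, -, h⟩ := Finset.mem_antidiagonal.1 hij
    rw [← h, evalAt_mul, evalAt_toEnd, evalAt_toEnd, map_mul, mul_assoc, zpow_add]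
    rfl

instance : Ring (TwistedLaurentSeries σ) where
  left_distrib a b c := toEnd_injective (by simp only [toEnd_mul, toEnd_add, mul_add])
  right_distrib a b c := toEnd_injective (by simp only [toEnd_mul, toEnd_add, add_mul])
  zero_mul a := toEnd_injective (by simp only [toEnd_mul, toEnd_zero, zero_mul])
  mul_zero a := toEnd_injective (by simp only [toEnd_mul, toEnd_zero, mul_zero])
  mul_assoc a b c := toEnd_injective (by simp only [toEnd_mul, mul_assoc])
  one_mul a := toEnd_injective (by simp only [toEnd_mul, toEnd_one, one_mul])
  mul_one a := toEnd_injective (by simp only [toEnd_mul, toEnd_one, mul_one])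
  neg_add_cancel a := neg_add_cancel a
  sub_eq_add_neg a b := sub_eq_add_neg a b
  zsmul := zsmulRec

theorem monomial_one_mul (a : R) :
    monomial σ 1 1 * monomial σ 0 a = monomial σ 0 (σ a) * monomial σ 1 1 := by
  have key : ∀ (i j : ℤ) (a b : R), toEnd (monomial σ i a * monomial σ j b)
      = HahnSeries.single (i + j) (twistOp σ a i * twistOp σ b j) := by
    intro i j a b
    have hm : ∀ (i : ℤ) (a : R), toEnd (monomial σ i a) = HahnSeries.single i (twistOp σ a i) := by
      intro i a
      refine hahn_ext fun n b ↦ ?_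
      rw [evalAt_toEnd, coeff_monomial]
      by_cases h : n = i
      · subst h
        rw [if_pos rfl, HahnSeries.coeff_single_same, evalAt_twistOp]
      · rw [if_neg h, HahnSeries.coeff_single_of_ne h, map_zero, zero_mul]
    rw [toEnd_mul, hm, hm, HahnSeries.single_mul_single]
  refine toEnd_injective ?_
  rw [key, key]
  congr 1
  refine end_ext fun b ↦ ?_
  rw [evalAt_mul, evalAt_mul]
  simp only [evalAt_twistOp, map_mul, zpow_one, zpow_zero, one_mul]
  rfl

open scoped Classical in
/-- The `x`-adic absolute value with parameter `δ`: `0 ↦ 0`, and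
`∑ aᵢ xⁱ ↦ δ ^ min {i | aᵢ ≠ 0}` for nonzero series. -/
def xAdic (δ : ℝ≥0) (f : TwistedLaurentSeries σ) : ℝ≥0 :=
  if f = 0 then 0 else δ ^ (HahnSeries.order (Γ := ℤ) (R := R) f)

end TwistedLaurentSeries

end Twisted

/-! ### Completions, division algebras and crossed products -/

/-- `ι : A → B` exhibits `(B, w)` as the completion of `(A, v)`: it preserves the valuations, its
image is dense, and `B` is Hausdorff and complete for `w`. -/
structure IsValuedCompletion {A B : Type*} [Ring A] [Ring B] (v : Valuation A ℝ≥0)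
    (w : Valuation B ℝ≥0) (ι : A →+* B) : Prop where
  isometry : ∀ a, w (ι a) = v a
  dense : ∀ b : B, ∀ ε : ℝ≥0, 0 < ε → ∃ a : A, w (b - ι a) < ε
  separated : ∀ b : B, w b = 0 → b = 0
  complete : ∀ s : ℕ → B,
    (∀ ε : ℝ≥0, 0 < ε → ∃ N : ℕ, ∀ m ≥ N, ∀ n ≥ N, w (s m - s n) < ε) →
    ∃ b : B, ∀ ε : ℝ≥0, 0 < ε → ∃ N : ℕ, ∀ n ≥ N, w (s n - b) < ε

/-- `A` is a division algebra of degree `n` over `F`: a division ring with centre `F` and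
`dim_F A = n²` finite. -/
structure IsDivisionAlgebraOfDegree (F A : Type*) [Field F] [Ring A] [Algebra F A] (n : ℕ) :
    Prop where
  nontrivial : Nontrivial A
  isUnit : ∀ a : A, a ≠ 0 → IsUnit a
  central : Algebra.IsCentral F A
  finite : Module.Finite F A
  finrank_eq : Module.finrank F A = n ^ 2

/-- A division algebra `A` with centre `F` is a crossed product if it has a maximal subfield that
is Galois over `F` (a maximal subfield automatically contains the centre). -/
def IsCrossedProduct.{v, w} (F : Type v) {A : Type w} [Field F] [Ring A] [Algebra F A] : Prop :=
  ∃ M : Subalgebra F A, Maximal (fun S : Subalgebra F A ↦ IsField S) M ∧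
    ∃ (E : Type w) (_ : Field E) (_ : Algebra F E), IsGalois F E ∧ Nonempty (E ≃ₐ[F] M)

/-! ### Cyclic algebras of degree three -/

/-- The cyclic cubic algebra `(L/K, φ, a) = L ⊕ L u ⊕ L u²`, where `φ³ = 1`, `a ∈ K`, `u³ = a` and
`u l = φ(l) u`. The element `c₀ + c₁ u + c₂ u²` has the coordinates `c₀, c₁, c₂`. -/
@[ext] structure CubicCyclicAlgebra {K L : Type*} [CommRing K] [CommRing L] [Algebra K L]
    (φ : L →ₐ[K] L) (hφ : ∀ l, φ (φ (φ l)) = l) (a : K) where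
  c₀ : L
  c₁ : L
  c₂ : L

namespace CubicCyclicAlgebra

variable {K L : Type*} [CommRing K] [CommRing L] [Algebra K L]
  {φ : L →ₐ[K] L} {hφ : ∀ l, φ (φ (φ l)) = l} {a : K}

instance : Zero (CubicCyclicAlgebra φ hφ a) := ⟨⟨0, 0, 0⟩⟩
instance : One (CubicCyclicAlgebra φ hφ a) := ⟨⟨1, 0, 0⟩⟩
instance : Add (CubicCyclicAlgebra φ hφ a) :=
  ⟨fun x y ↦ ⟨x.c₀ + y.c₀, x.c₁ + y.c₁, x.c₂ + y.c₂⟩⟩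
instance : Neg (CubicCyclicAlgebra φ hφ a) := ⟨fun x ↦ ⟨-x.c₀, -x.c₁, -x.c₂⟩⟩
instance : Mul (CubicCyclicAlgebra φ hφ a) :=
  ⟨fun x y ↦
    ⟨x.c₀ * y.c₀ + algebraMap K L a * (x.c₁ * φ y.c₂ + x.c₂ * φ (φ y.c₁)),
      x.c₀ * y.c₁ + x.c₁ * φ y.c₀ + algebraMap K L a * (x.c₂ * φ (φ y.c₂)),
      x.c₀ * y.c₂ + x.c₁ * φ y.c₁ + x.c₂ * φ (φ y.c₀)⟩⟩

@[simp] theorem zero_c₀ : (0 : CubicCyclicAlgebra φ hφ a).c₀ = 0 := rfl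
@[simp] theorem zero_c₁ : (0 : CubicCyclicAlgebra φ hφ a).c₁ = 0 := rfl
@[simp] theorem zero_c₂ : (0 : CubicCyclicAlgebra φ hφ a).c₂ = 0 := rfl
@[simp] theorem one_c₀ : (1 : CubicCyclicAlgebra φ hφ a).c₀ = 1 := rfl
@[simp] theorem one_c₁ : (1 : CubicCyclicAlgebra φ hφ a).c₁ = 0 := rfl
@[simp] theorem one_c₂ : (1 : CubicCyclicAlgebra φ hφ a).c₂ = 0 := rfl
@[simp] theorem add_c₀ (x y : CubicCyclicAlgebra φ hφ a) : (x + y).c₀ = x.c₀ + y.c₀ := rfl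
@[simp] theorem add_c₁ (x y : CubicCyclicAlgebra φ hφ a) : (x + y).c₁ = x.c₁ + y.c₁ := rfl
@[simp] theorem add_c₂ (x y : CubicCyclicAlgebra φ hφ a) : (x + y).c₂ = x.c₂ + y.c₂ := rfl
@[simp] theorem neg_c₀ (x : CubicCyclicAlgebra φ hφ a) : (-x).c₀ = -x.c₀ := rfl
@[simp] theorem neg_c₁ (x : CubicCyclicAlgebra φ hφ a) : (-x).c₁ = -x.c₁ := rfl
@[simp] theorem neg_c₂ (x : CubicCyclicAlgebra φ hφ a) : (-x).c₂ = -x.c₂ := rfl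
@[simp] theorem mul_c₀ (x y : CubicCyclicAlgebra φ hφ a) : (x * y).c₀ =
    x.c₀ * y.c₀ + algebraMap K L a * (x.c₁ * φ y.c₂ + x.c₂ * φ (φ y.c₁)) := rfl
@[simp] theorem mul_c₁ (x y : CubicCyclicAlgebra φ hφ a) : (x * y).c₁ =
    x.c₀ * y.c₁ + x.c₁ * φ y.c₀ + algebraMap K L a * (x.c₂ * φ (φ y.c₂)) := rfl
@[simp] theorem mul_c₂ (x y : CubicCyclicAlgebra φ hφ a) : (x * y).c₂ =
    x.c₀ * y.c₂ + x.c₁ * φ y.c₁ + x.c₂ * φ (φ y.c₀) := rfl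

instance : Ring (CubicCyclicAlgebra φ hφ a) where
  add_assoc x y z := by ext <;> simp [add_assoc]
  zero_add x := by ext <;> simp
  add_zero x := by ext <;> simp
  add_comm x y := by ext <;> simp [add_comm]
  neg_add_cancel x := by ext <;> simp
  nsmul := nsmulRec
  zsmul := zsmulRec
  left_distrib x y z := by ext <;> simp <;> ring
  right_distrib x y z := by ext <;> simp <;> ring
  zero_mul x := by ext <;> simp
  mul_zero x := by ext <;> simp
  one_mul x := by ext <;> simp
  mul_one x := by ext <;> simp
  mul_assoc x y z := by ext <;> simp [hφ, AlgHom.commutes] <;> ring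

variable (φ hφ a)

/-- The inclusion of `L`. -/
def ofL : L →+* CubicCyclicAlgebra φ hφ a where
  toFun l := ⟨l, 0, 0⟩
  map_one' := rfl
  map_zero' := rfl
  map_add' x y := by ext <;> simp
  map_mul' x y := by ext <;> simp

/-- The generator `u`. -/
def u : CubicCyclicAlgebra φ hφ a := ⟨0, 1, 0⟩

theorem u_mul_ofL (l : L) : u φ hφ a * ofL φ hφ a l = ofL φ hφ a (φ l) * u φ hφ a := by
  ext <;> simp [u, ofL]

theorem u_pow_three : u φ hφ a ^ 3 = ofL φ hφ a (algebraMap K L a) := by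
  rw [pow_succ, pow_two]
  ext <;> simp [u, ofL]

end CubicCyclicAlgebra

/-! ### The explicit example -/

namespace Example9

/-- The primitive seventh root of unity `ζ = exp(2πi/7)`. -/
def zeta₀ : ℂ := Complex.exp (2 * Real.pi * Complex.I / 7)

/-- `α = ζ + ζ⁻¹` as a complex number. -/
def alpha₀ : ℂ := zeta₀ + zeta₀⁻¹

/-- `K = ℚ(ζ + ζ⁻¹)`, the maximal real subfield of the seventh cyclotomic field `ℚ(ζ)`. -/
def K : Type := IntermediateField.adjoin ℚ {alpha₀}

instance : Field K := inferInstanceAs (Field (IntermediateField.adjoin ℚ {alpha₀}))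

instance : CharZero K := inferInstanceAs (CharZero (IntermediateField.adjoin ℚ {alpha₀}))

/-- The primitive element `α` of `K`. -/
def alpha : K :=
  (⟨alpha₀, IntermediateField.mem_adjoin_simple_self ℚ alpha₀⟩ : IntermediateField.adjoin ℚ {alpha₀})

theorem alpha_rel : alpha ^ 3 + alpha ^ 2 - 2 * alpha - 1 = 0 := by
  have h0 : alpha₀ ^ 3 + alpha₀ ^ 2 - 2 * alpha₀ - 1 = 0 := by
    have hz : IsPrimitiveRoot zeta₀ 7 := by
      simpa [zeta₀] using Complex.isPrimitiveRoot_exp 7 (by norm_num)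
    have hz0 : zeta₀ ≠ 0 := hz.ne_zero (by norm_num)
    have hs := hz.geom_sum_eq_zero (by norm_num)
    unfold alpha₀
    simp only [Finset.sum_range_succ, Finset.sum_range_zero] at hs
    field_simp
    linear_combination hs
  exact Subtype.ext h0

/-- `f = x³ + (α - 2) x² - (α + 1) x + 1`. -/
def f : K[X] :=
  Polynomial.X ^ 3 + Polynomial.C (alpha - 2) * Polynomial.X ^ 2
    - Polynomial.C (alpha + 1) * Polynomial.X + 1

/-- `L = K(θ) = K[x]/(f)`. -/
abbrev L : Type := AdjoinRoot f

/-- The root `θ` of `f` in `L`. -/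
def theta : L := AdjoinRoot.root f

/-- The inclusion of `K` in `L`. -/
abbrev ofK : K →+* L := algebraMap K L

theorem eval₂_f {B : Type*} [CommRing B] (i : K →+* B) (y : B) : Polynomial.eval₂ i y f =
    y ^ 3 + (i alpha - 2) * y ^ 2 - (i alpha + 1) * y + 1 := by
  have h2 : i 2 = 2 := map_ofNat i 2
  simp [f, Polynomial.eval₂_add, Polynomial.eval₂_sub, Polynomial.eval₂_mul, h2]

theorem theta_rel :
    theta ^ 3 + (ofK alpha - 2) * theta ^ 2 - (ofK alpha + 1) * theta + 1 = 0 := by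
  rw [← eval₂_f]
  exact AdjoinRoot.eval₂_root f

theorem ofK_alpha_rel : ofK alpha ^ 3 + ofK alpha ^ 2 - 2 * ofK alpha - 1 = 0 := by
  have h := congrArg ofK alpha_rel
  simpa only [map_add, map_sub, map_mul, map_pow, map_one, map_ofNat, map_zero] using h

/-- The image `-θ² + (-α + 1) θ + 2` of `θ` under `φ`. -/
def phiTheta : L := -theta ^ 2 + (-ofK alpha + 1) * theta + 2

theorem phiTheta_rel :
    phiTheta ^ 3 + (ofK alpha - 2) * phiTheta ^ 2 - (ofK alpha + 1) * phiTheta + 1 = 0 := by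
  unfold phiTheta
  linear_combination (-1 + 2 * ofK alpha + 2 * theta + ofK alpha * theta + theta ^ 2
    - 2 * ofK alpha * theta ^ 2 - theta ^ 3 - ofK alpha ^ 2 * theta) * theta_rel

/-- The automorphism `φ` of `L/K` with `φ(θ) = -θ² + (-α + 1) θ + 2`. -/
def phi : L →ₐ[K] L :=
  AdjoinRoot.liftAlgHom f (Algebra.ofId K L) phiTheta (by
    change Polynomial.eval₂ ofK phiTheta f = 0
    rw [eval₂_f]
    exact phiTheta_rel)

theorem phi_theta : phi theta = -theta ^ 2 + (-ofK alpha + 1) * theta + 2 :=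
  AdjoinRoot.liftAlgHom_root ..

theorem phi_phi_phi (l : L) : phi (phi (phi l)) = l := by
  have hk : ∀ c : K, phi (ofK c) = ofK c := phi.commutes
  have h : (phi.comp (phi.comp phi)) = AlgHom.id K L := by
    refine AdjoinRoot.algHom_ext ?_
    change phi (phi (phi theta)) = theta
    simp only [phi_theta, map_add, map_neg, map_mul, map_pow, map_one, map_ofNat, hk]
    linear_combination (2 - 2 * ofK alpha - 2 * theta - 2 * ofK alpha ^ 2 - 7 * ofK alpha * theta
      - 5 * theta ^ 2 + 3 * ofK alpha ^ 2 * theta + ofK alpha ^ 3 * theta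
      + 4 * ofK alpha ^ 2 * theta ^ 2 + 5 * ofK alpha * theta ^ 3 + 2 * theta ^ 4
      - ofK alpha ^ 3 * theta ^ 2 - 3 * ofK alpha ^ 2 * theta ^ 3 - 3 * ofK alpha * theta ^ 4
      - theta ^ 5 + 6 * ofK alpha * theta ^ 2 + 3 * theta ^ 3) * theta_rel
  exact DFunLike.congr_fun h l

/-- `π = α² - α - 2`. -/
def piK : K := alpha ^ 2 - alpha - 2

/-- The cyclic cubic algebra `D = (L/K, φ, 2π)`. -/
abbrev D : Type := CubicCyclicAlgebra phi phi_phi_phi (2 * piK)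

/-- The inclusion of `K` in `D`. -/
def kD : K →+* D := (CubicCyclicAlgebra.ofL phi phi_phi_phi (2 * piK)).comp ofK

/-- The element `θ` of `D`. -/
def thetaD : D := CubicCyclicAlgebra.ofL phi phi_phi_phi (2 * piK) theta

/-- The element `u` of `D`. -/
def uD : D := CubicCyclicAlgebra.u phi phi_phi_phi (2 * piK)

/-- The matrix `(c_{ij})`, `0 ≤ i, j ≤ 2`. -/
def c : Matrix (Fin 3) (Fin 3) K :=
  !![303 * alpha ^ 2 - 154 * alpha - 276, 314 * alpha ^ 2 + 218 * alpha - 326,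
      -48 * alpha ^ 2 + 151 * alpha + 157;
    390 * alpha ^ 2 + 708 * alpha - 855, 40 * alpha ^ 2 - 238 * alpha + 430,
      -397 * alpha ^ 2 - 27 * alpha + 275;
    -106 * alpha ^ 2 + 25 * alpha + 543, -128 * alpha ^ 2 - 46 * alpha - 30,
      135 * alpha ^ 2 + 38 * alpha - 63]

/-- `λ = (α² + α) + (-α + 1) θ - θ²`. -/
def lam : D := kD (alpha ^ 2 + alpha) + kD (-alpha + 1) * thetaD - thetaD ^ 2

/-- The conditions that determine the automorphism `σ̃` of `D`: on `K` it is the automorphism `σ`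
with `σ(α) = -α² - α + 1`, and the images of `θ` and `u` are the prescribed ones. -/
structure IsSigmaTilde (τ : RingAut D) : Prop where
  map_alpha : τ (kD alpha) = kD (-alpha ^ 2 - alpha + 1)
  map_theta : τ thetaD =
    kD (1 / 673) * ∑ i : Fin 3, ∑ j : Fin 3, kD (c i j) * thetaD ^ (i : ℕ) * uD ^ (j : ℕ)
  map_u : τ uD = lam * uD

end Example9

end

/-! Write σ̃ for the automorphism (called τ in the proof), Q = D(x, σ̃) and F = ℚ(t). The proof
reduces the noncrossed product property of Q to a statement about D, and settles that by the
arithmetic of D at the primes 2 and 7.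

Suppose that E is a maximal subfield of Q, Galois over F with group G. It is its own centralizer and
all its automorphisms are induced by conjugation in Q, so [Q : F] = [E : F]² (`finrank_eq_sq`) and
|G| = 9. The x-adic valuation has values in a commutative monoid, hence is invariant under
conjugation and under G. An integral element of F has a constant coefficient that is central in D
and fixed by σ̃, hence rational. The residue characteristic is 0, so inertia is tame, and by
`Valuation.pow_eq_one_of_inertia` it is controlled by the ninth roots of unity in ℚ, of which there
is only 1. Hence G acts faithfully on the residue field of E, which is a subfield N of D whose
G-fixed elements are rational (`IsSigmaTilde.false_of_card_eq_nine`). It remains to see that D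
contains no Galois extension N of ℚ of degree 9 (`false_of_card_eq_nine`).

The prime 2 is inert in K, while 7 is totally ramified, with prime element π. At both places f stays
irreducible and u³ = 2π is a uniformizer, so u generates a completely prime ideal in a localized
order of D. This gives discrete valuations of D with residue fields 𝔽₅₁₂ and 𝔽₃₄₃
(`exists_valuation_of_normal_prime`, `ResiduePlace.exists_valuation`); in particular D is a division
ring. Their restrictions to N are invariant under G, because automorphisms preserve integrality over
ℤ. Over 2, tame inertia is trivial since 𝔽₂ contains only the root of unity 1; hence G acts
faithfully on a finite field and is cyclic (`isCyclic_of_fixed_rational`). Over 7, let g generate G.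
Its cube acts trivially on the residue field, which lies in 𝔽₃₄₃. Moreover N contains K, since
otherwise N and K would generate a commutative subring of dimension 27, that is, all of D. Thus K is
the fixed field of g³, and its residue field at 7 is 𝔽₇. Averaging over ⟨g³⟩ shows that g is
inertial; as 𝔽₇ has no primitive ninth roots of unity, g³ = 1, a contradiction.

The explicit identities that construct σ̃, and an element d with σ̃³(a) = dad⁻¹ and σ̃(d) = d, are
checked in integral coordinates. Then t = d⁻¹x³ is central and D[x, σ̃] is free over ℚ[t] of rank 27
· 3 = 81. Integrality over ℚ[t] gives the Ore condition (`TwistedPolynomial.exists_mul_eq_ofT`);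
comparison of coefficients gives the centre. The completion statement is truncation of series
together with stabilization of coefficients in Cauchy sequences. -/

noncomputable section

namespace Example9

/-! ### Integral coordinates -/

/-- Coordinates of an element of `ℤ[α]` with respect to `1, α, α²`. -/
abbrev ZK : Type := ℤ × ℤ × ℤ

/-- Coordinates of an element of `ℤ[α, θ]` with respect to `1, θ, θ²`. -/
abbrev ZL : Type := ZK × ZK × ZK

/-- Coordinates of an element of `ℤ[α, θ] ⊕ ℤ[α, θ] u ⊕ ℤ[α, θ] u²`. -/
abbrev ZD : Type := ZL × ZL × ZL

/-- The product in `ℤ[α]`, in coordinates. -/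
def ZK.mul (x y : ZK) : ZK :=
  let p₀ := x.1 * y.1
  let p₁ := x.1 * y.2.1 + x.2.1 * y.1
  let p₂ := x.1 * y.2.2 + x.2.1 * y.2.1 + x.2.2 * y.1
  let p₃ := x.2.1 * y.2.2 + x.2.2 * y.2.1
  let p₄ := x.2.2 * y.2.2
  -- Reduction by α³ = 1 + 2α − α², hence α⁴ = α + 2α² − α³.
  (p₀ + (p₃ - p₄), p₁ + 2 * (p₃ - p₄) + p₄, p₂ - (p₃ - p₄) + 2 * p₄)

/-- The product in `ℤ[α, θ]`, in coordinates. -/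
def ZL.mul (x y : ZL) : ZL :=
  let p₀ := x.1.mul y.1
  let p₁ := x.1.mul y.2.1 + x.2.1.mul y.1
  let p₂ := x.1.mul y.2.2 + x.2.1.mul y.2.1 + x.2.2.mul y.1
  let p₃ := x.2.1.mul y.2.2 + x.2.2.mul y.2.1
  let p₄ := x.2.2.mul y.2.2
  -- Reduction by θ³ = (2 − α)θ² + (1 + α)θ − 1; q₃ is the coefficient of θ³ after θ⁴ has been
  -- lowered once.
  let q₃ := p₃ + ZK.mul (2, -1, 0) p₄
  (p₀ - q₃, p₁ + ZK.mul (1, 1, 0) q₃ - p₄, p₂ + ZK.mul (2, -1, 0) q₃ + ZK.mul (1, 1, 0) p₄)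

/-- The coordinates of `φ(θ)`. -/
def ZL.phiTheta : ZL := ((2, 0, 0), (1, -1, 0), (-1, 0, 0))

/-- The automorphism `φ`, in coordinates. -/
def ZL.phi (x : ZL) : ZL :=
  (x.1, 0, 0) + ZL.mul (x.2.1, 0, 0) ZL.phiTheta +
    ZL.mul (x.2.2, 0, 0) (ZL.mul ZL.phiTheta ZL.phiTheta)

/-- The product in `D`, in coordinates. -/
def ZD.mul (x y : ZD) : ZD :=
  -- This is 2π = 2α² − 2α − 4.
  let a : ZL := ((-4, -2, 2), 0, 0)
  (x.1.mul y.1 + a.mul (x.2.1.mul y.2.2.phi + x.2.2.mul y.2.1.phi.phi),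
    x.1.mul y.2.1 + x.2.1.mul y.1.phi + a.mul (x.2.2.mul y.2.2.phi.phi),
    x.1.mul y.2.2 + x.2.1.mul y.2.1.phi + x.2.2.mul y.1.phi.phi)

/-- The element of `K` with given integral coordinates. -/
def ZK.toK (x : ZK) : K := x.1 + x.2.1 * alpha + x.2.2 * alpha ^ 2

/-- The element of `L` with given integral coordinates. -/
def ZL.toL (x : ZL) : L :=
  ofK x.1.toK + ofK x.2.1.toK * theta + ofK x.2.2.toK * theta ^ 2

/-- The element of `D` with given integral coordinates. -/
def ZD.toD (x : ZD) : D := ⟨x.1.toL, x.2.1.toL, x.2.2.toL⟩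

theorem ZK.toK_add (x y : ZK) : (x + y).toK = x.toK + y.toK := by
  simp only [ZK.toK, Prod.fst_add, Prod.snd_add, Int.cast_add]; ring

theorem ZK.toK_sub (x y : ZK) : (x - y).toK = x.toK - y.toK := by
  simp only [ZK.toK, Prod.fst_sub, Prod.snd_sub, Int.cast_sub]; ring

theorem ZK.toK_mul (x y : ZK) : (x.mul y).toK = x.toK * y.toK := by
  simp only [ZK.toK, ZK.mul, Int.cast_add, Int.cast_sub, Int.cast_mul, Int.cast_ofNat]
  linear_combination (-(x.2.1 * y.2.2 + x.2.2 * y.2.1 : K) - x.2.2 * y.2.2 * (alpha - 1)) *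
    alpha_rel

theorem ZK.toK_zero : (0 : ZK).toK = 0 := by simp [ZK.toK]

theorem ZL.toL_add (x y : ZL) : (x + y).toL = x.toL + y.toL := by
  simp only [ZL.toL, Prod.fst_add, Prod.snd_add, ZK.toK_add, map_add]; ring

theorem ZL.toL_mul (x y : ZL) : (x.mul y).toL = x.toL * y.toL := by
  simp only [ZL.toL, ZL.mul, ZK.toK_add, ZK.toK_sub, ZK.toK_mul, map_add, map_sub, map_mul]
  have h1 : ofK (ZK.toK (2, -1, 0)) = 2 - ofK alpha := by
    simp [ZK.toK, map_ofNat]; ring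
  have h2 : ofK (ZK.toK (1, 1, 0)) = 1 + ofK alpha := by
    simp [ZK.toK]
  rw [h1, h2]
  linear_combination (-(ofK x.2.1.toK * ofK y.2.2.toK + ofK x.2.2.toK * ofK y.2.1.toK)
    - ofK x.2.2.toK * ofK y.2.2.toK * (theta + (2 - ofK alpha))) * theta_rel

theorem ZL.toL_const (x : ZK) : ZL.toL (x, 0, 0) = ofK x.toK := by
  simp [ZL.toL, ZK.toK_zero]

theorem ZL.toL_phiTheta : ZL.phiTheta.toL = Example9.phi theta := by
  rw [phi_theta]
  simp [ZL.toL, ZL.phiTheta, ZK.toK, map_ofNat]; ring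

theorem ZL.toL_phi (x : ZL) : x.phi.toL = Example9.phi x.toL := by
  have hk (c : K) : Example9.phi (ofK c) = ofK c := Example9.phi.commutes c
  simp only [ZL.phi, ZL.toL_add, ZL.toL_mul, ZL.toL_const, ZL.toL_phiTheta]
  simp only [ZL.toL, map_add, map_mul, map_pow, hk]
  ring

theorem ZD.toD_add (x y : ZD) : (x + y).toD = x.toD + y.toD := by
  ext <;> simp only [ZD.toD, Prod.fst_add, Prod.snd_add, ZL.toL_add,
    CubicCyclicAlgebra.add_c₀, CubicCyclicAlgebra.add_c₁, CubicCyclicAlgebra.add_c₂]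

theorem ZK.toK_two_piK : ZK.toK (-4, -2, 2) = 2 * piK := by
  simp [ZK.toK, piK]; ring

theorem ZD.toD_mul (x y : ZD) : (x.mul y).toD = x.toD * y.toD := by
  ext <;> simp only [ZD.toD, ZD.mul, ZL.toL_add, ZL.toL_mul, ZL.toL_phi, ZL.toL_const,
    ZK.toK_two_piK, CubicCyclicAlgebra.mul_c₀, CubicCyclicAlgebra.mul_c₁,
    CubicCyclicAlgebra.mul_c₂]

/-- The coordinates of a constant of `ℤ[α]`. -/
def ZD.ofZK (x : ZK) : ZD := ((x, 0, 0), 0, 0)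

theorem ZL.toL_zero : (0 : ZL).toL = 0 := by
  change ZL.toL (0, 0, 0) = 0
  rw [ZL.toL_const, ZK.toK_zero, map_zero]

theorem ZD.toD_ofZK (x : ZK) : (ZD.ofZK x).toD = kD x.toK := by
  ext <;> simp [ZD.toD, ZD.ofZK, ZL.toL_const, ZL.toL_zero, kD, CubicCyclicAlgebra.ofL]

theorem ZD.toD_intCast (n : ℤ) : (ZD.ofZK (n, 0, 0)).toD = kD n := by
  rw [ZD.toD_ofZK]; simp [ZK.toK]

theorem ZD.toD_theta : ZD.toD ((0, (1, 0, 0), 0), 0, 0) = thetaD := by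
  ext <;> simp [ZD.toD, ZL.toL, ZK.toK, thetaD, CubicCyclicAlgebra.ofL]

theorem ZD.toD_u : ZD.toD (0, ((1, 0, 0), 0, 0), 0) = uD := by
  ext <;> simp [ZD.toD, ZL.toL, ZK.toK, uD, CubicCyclicAlgebra.u]

end Example9

/-! ### Finite-dimensional domains and coordinates in cubic extensions -/

theorem isUnit_of_finite_of_ne_zero (F : Type*) {A : Type*} [Field F] [Ring A] [Algebra F A]
    [Module.Finite F A] [IsDomain A] {x : A} (hx : x ≠ 0) : IsUnit x := by
  have hinj : Function.Injective (LinearMap.mulLeft F x) := mul_right_injective₀ hx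
  obtain ⟨y, hy⟩ := LinearMap.injective_iff_surjective.1 hinj 1
  rw [LinearMap.mulLeft_apply] at hy
  refine ⟨⟨x, y, hy, ?_⟩, rfl⟩
  exact mul_left_cancel₀ hx (by rw [← mul_assoc, hy, one_mul, mul_one])

theorem adjoinRoot_coords_eq_zero {k : Type*} [Field k] {g : k[X]} (hg : g.Monic)
    (hd : g.natDegree = 3) {a b c : k}
    (h : AdjoinRoot.of g a + AdjoinRoot.of g b * AdjoinRoot.root g
      + AdjoinRoot.of g c * AdjoinRoot.root g ^ 2 = 0) : a = 0 ∧ b = 0 ∧ c = 0 := by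
  set p : k[X] := Polynomial.C c * Polynomial.X ^ 2 + Polynomial.C b * Polynomial.X +
    Polynomial.C a with hp
  have hp0 : p = 0 := by
    by_contra hne
    refine AdjoinRoot.mk_ne_zero_of_degree_lt hg hne ?_ ?_
    · rw [Polynomial.degree_eq_natDegree hg.ne_zero, hd]
      exact Polynomial.degree_quadratic_le.trans_lt (by decide)
    · simp only [hp, map_add, map_mul, map_pow, AdjoinRoot.mk_C, AdjoinRoot.mk_X]
      linear_combination h
  refine ⟨?_, ?_, ?_⟩
  · simpa [hp] using congrArg (Polynomial.coeff · 0) hp0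
  · simpa [hp] using congrArg (Polynomial.coeff · 1) hp0
  · simpa [hp, Polynomial.coeff_X] using congrArg (Polynomial.coeff · 2) hp0

theorem adjoinRoot_exists_coords {k : Type*} [Field k] {g : k[X]} (hg : g.Monic)
    (hd : g.natDegree = 3) (x : AdjoinRoot g) : ∃ a b c : k, x =
      AdjoinRoot.of g a + AdjoinRoot.of g b * AdjoinRoot.root g
      + AdjoinRoot.of g c * AdjoinRoot.root g ^ 2 := by
  have : Nontrivial (AdjoinRoot g) :=
    AdjoinRoot.nontrivial g (by rw [Polynomial.degree_eq_natDegree hg.ne_zero, hd]; decide)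
  let pb := AdjoinRoot.powerBasis' hg
  have hdim : pb.dim = 3 := by rw [AdjoinRoot.powerBasis'_dim, hd]
  obtain ⟨q, hq, hx⟩ := pb.exists_eq_aeval x
  rw [hdim] at hq
  refine ⟨q.coeff 0, q.coeff 1, q.coeff 2, ?_⟩
  rw [hx, Polynomial.aeval_eq_sum_range' hq, Finset.sum_range_succ, Finset.sum_range_succ,
    Finset.sum_range_one]
  simp [Algebra.smul_def, pb]

namespace Example9

/-! ### Coordinates in `K` and `L`, and the automorphism of `K` -/

theorem alpha₀_rel : alpha₀ ^ 3 + alpha₀ ^ 2 - 2 * alpha₀ - 1 = 0 :=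
  congrArg (Subtype.val : IntermediateField.adjoin ℚ {alpha₀} → ℂ) alpha_rel

/-- The minimal polynomial of `α`, over any ring. -/
def alphaPoly (R : Type*) [CommRing R] : R[X] :=
  Polynomial.X ^ 3 + Polynomial.X ^ 2 - 2 * Polynomial.X - 1

theorem alphaPoly_monic (R : Type*) [CommRing R] : (alphaPoly R).Monic := by
  nontriviality R
  unfold alphaPoly
  have h2 : (2 : R[X]) = Polynomial.C 2 := rfl
  rw [h2]
  monicity!

theorem alphaPoly_natDegree (R : Type*) [CommRing R] [Nontrivial R] :
    (alphaPoly R).natDegree = 3 := by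
  unfold alphaPoly
  have h2 : (2 : R[X]) = Polynomial.C 2 := rfl
  rw [h2]
  compute_degree!

theorem alphaPoly_map {R S : Type*} [CommRing R] [CommRing S] (g : R →+* S) :
    (alphaPoly R).map g = alphaPoly S := by
  simp [alphaPoly, Polynomial.map_sub]

theorem alphaPoly_eval₂ {R B : Type*} [CommRing R] [CommRing B] (i : R →+* B) (y : B) :
    (alphaPoly R).eval₂ i y = y ^ 3 + y ^ 2 - 2 * y - 1 := by
  have h2 : (2 : R[X]) = Polynomial.C 2 := rfl
  have h3 : i 2 = 2 := map_ofNat i 2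
  simp [alphaPoly, h2, h3, Polynomial.eval₂_sub, Polynomial.eval₂_mul]

instance fact_two : Fact (Nat.Prime 2) := ⟨Nat.prime_two⟩
instance fact_seven : Fact (Nat.Prime 7) := ⟨by norm_num⟩

/-- A cubic without roots is irreducible. Besides irreducibility over ℚ, this shows that 2 is inert
in K, with residue field 𝔽₈. -/
theorem alphaPoly_irreducible_two : Irreducible (alphaPoly (ZMod 2)) := by
  rw [(alphaPoly_monic _).irreducible_iff_roots_eq_zero_of_degree_le_three
    (by rw [alphaPoly_natDegree]; norm_num) (by rw [alphaPoly_natDegree])]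
  rw [Multiset.eq_zero_iff_forall_notMem]
  intro x hx
  rw [Polynomial.mem_roots (alphaPoly_monic _).ne_zero, Polynomial.IsRoot] at hx
  simp only [alphaPoly, Polynomial.eval_sub, Polynomial.eval_add, Polynomial.eval_pow,
    Polynomial.eval_X, Polynomial.eval_mul, Polynomial.eval_ofNat, Polynomial.eval_one] at hx
  revert hx x
  decide

theorem alphaPoly_irreducible_rat : Irreducible (alphaPoly ℚ) := by
  have h : Irreducible (alphaPoly ℤ) :=
    (alphaPoly_monic ℤ).irreducible_of_irreducible_map (Int.castRingHom (ZMod 2)) _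
      (by rw [alphaPoly_map]; exact alphaPoly_irreducible_two)
  have := ((alphaPoly_monic ℤ).irreducible_iff_irreducible_map_fraction_map (K := ℚ)).1 h
  rwa [alphaPoly_map] at this

theorem minpoly_alpha₀ : minpoly ℚ alpha₀ = alphaPoly ℚ := by
  refine (minpoly.eq_of_irreducible_of_monic alphaPoly_irreducible_rat ?_
    (alphaPoly_monic ℚ)).symm
  simpa [alphaPoly, map_ofNat] using alpha₀_rel

theorem isIntegral_alpha₀ : IsIntegral ℚ alpha₀ := by
  by_contra h
  have := minpoly.eq_zero h
  rw [minpoly_alpha₀] at this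
  exact (alphaPoly_monic ℚ).ne_zero this

theorem exists_coords (x : K) : ∃ a b c : ℚ, x = a + b * alpha + c * alpha ^ 2 := by
  obtain ⟨x, hx⟩ := x
  suffices h : ∃ a b c : ℚ, x = a + b * alpha₀ + c * alpha₀ ^ 2 by
    obtain ⟨a, b, c, h⟩ := h
    exact ⟨a, b, c, Subtype.ext h⟩
  have hx' : x ∈ (IntermediateField.adjoin ℚ {alpha₀}).toSubalgebra := hx
  rw [IntermediateField.adjoin_simple_toSubalgebra_of_isAlgebraic
    isIntegral_alpha₀.isAlgebraic] at hx'
  clear hx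
  induction hx' using Algebra.adjoin_induction with
  | mem x h =>
    rw [Set.mem_singleton_iff] at h
    subst h
    exact ⟨0, 1, 0, by simp⟩
  | algebraMap r => exact ⟨r, 0, 0, by simp⟩
  | add x y _ _ h1 h2 =>
    obtain ⟨a, b, c, rfl⟩ := h1
    obtain ⟨a', b', c', rfl⟩ := h2
    exact ⟨a + a', b + b', c + c', by push_cast; ring⟩
  | mul x y _ _ h1 h2 =>
    obtain ⟨a, b, c, rfl⟩ := h1
    obtain ⟨a', b', c', rfl⟩ := h2
    refine ⟨a * a' + (b * c' + c * b' - c * c'),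
      a * b' + b * a' + 2 * (b * c' + c * b' - c * c') + c * c',
      a * c' + b * b' + c * a' - (b * c' + c * b' - c * c') + 2 * (c * c'), ?_⟩
    push_cast
    linear_combination ((b * c' + c * b' : ℂ) + c * c' * (alpha₀ - 1)) * alpha₀_rel

theorem coords_eq_zero {a b c : ℚ} (h : (a : K) + b * alpha + c * alpha ^ 2 = 0) :
    a = 0 ∧ b = 0 ∧ c = 0 := by
  have h0 : (a : ℂ) + b * alpha₀ + c * alpha₀ ^ 2 = 0 :=
    congrArg (Subtype.val : IntermediateField.adjoin ℚ {alpha₀} → ℂ) h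
  set p : ℚ[X] := Polynomial.C c * Polynomial.X ^ 2 + Polynomial.C b * Polynomial.X +
    Polynomial.C a with hp
  have hp0 : p = 0 := by
    by_contra hne
    have h1 := minpoly.degree_le_of_ne_zero ℚ alpha₀ hne (by
      simp only [hp, map_add, map_mul, map_pow, Polynomial.aeval_X, Polynomial.aeval_C,
        eq_ratCast]
      linear_combination h0)
    rw [minpoly_alpha₀, Polynomial.degree_eq_natDegree (alphaPoly_monic ℚ).ne_zero,
      alphaPoly_natDegree] at h1
    have h2 : p.degree ≤ 2 := Polynomial.degree_quadratic_le
    exact absurd (h1.trans h2) (by decide)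
  refine ⟨?_, ?_, ?_⟩
  · simpa [hp] using congrArg (Polynomial.coeff · 0) hp0
  · simpa [hp] using congrArg (Polynomial.coeff · 1) hp0
  · simpa [hp, Polynomial.coeff_X] using congrArg (Polynomial.coeff · 2) hp0

/-- `ℚ³ ≃ K`, by the basis `1, α, α²`. -/
def basisK : Module.Basis (Fin 3) ℚ K :=
  Module.Basis.mk (v := ![1, alpha, alpha ^ 2])
    (by
      rw [Fintype.linearIndependent_iff]
      intro g hg
      simp only [Fin.sum_univ_three, Matrix.cons_val_zero, Matrix.cons_val_one,
        Matrix.cons_val, Rat.smul_def, mul_one] at hg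
      obtain ⟨h0, h1, h2⟩ := coords_eq_zero hg
      intro i
      fin_cases i <;> assumption)
    (by
      intro x _
      obtain ⟨a, b, c, rfl⟩ := exists_coords x
      have hm (i : Fin 3) : ![1, alpha, alpha ^ 2] i ∈
          Submodule.span ℚ (Set.range ![1, alpha, alpha ^ 2]) :=
        Submodule.subset_span ⟨i, rfl⟩
      have h := add_mem (add_mem (Submodule.smul_mem _ a (hm 0)) (Submodule.smul_mem _ b (hm 1)))
        (Submodule.smul_mem _ c (hm 2))
      simpa [Rat.smul_def] using h)

theorem finrank_K : Module.finrank ℚ K = 3 := by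
  simpa using Module.finrank_eq_card_basis basisK

instance : Module.Finite ℚ K := Module.Finite.of_basis basisK

theorem exists_sigmaK : ∃ s : K →+* K, s alpha = -alpha ^ 2 - alpha + 1 := by
  let pb := IntermediateField.adjoin.powerBasis isIntegral_alpha₀
  -- For α = ζ + ζ⁻¹ this is ζ³ + ζ⁻³, another root of the same minimal polynomial.
  let y : IntermediateField.adjoin ℚ {alpha₀} := (-alpha ^ 2 - alpha + 1 : K)
  have hy0 : (-alpha ^ 2 - alpha + 1 : K) ^ 3 + (-alpha ^ 2 - alpha + 1) ^ 2
      - 2 * (-alpha ^ 2 - alpha + 1) - 1 = 0 := by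
    linear_combination (1 + alpha - 2 * alpha ^ 2 - alpha ^ 3) * alpha_rel
  refine ⟨((pb.lift y ?_).toRingHom : IntermediateField.adjoin ℚ {alpha₀} →+* _), ?_⟩
  · rw [IntermediateField.adjoin.powerBasis_gen, IntermediateField.minpoly_gen, minpoly_alpha₀]
    simp only [alphaPoly, map_sub, map_add, map_mul, map_pow, map_one, Polynomial.aeval_X,
      map_ofNat]
    exact hy0
  · exact pb.lift_gen y _

/-- The automorphism `σ` of `K`, with `σ(α) = -α² - α + 1`. -/
def sigmaK : K →+* K := exists_sigmaK.choose

theorem sigmaK_alpha : sigmaK alpha = -alpha ^ 2 - alpha + 1 := exists_sigmaK.choose_spec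

theorem ringHom_ext_alpha {A : Type*} [Ring A] {g h : K →+* A} (H : g alpha = h alpha) : g = h := by
  ext x
  obtain ⟨a, b, c, rfl⟩ := exists_coords x
  have hq (q : ℚ) : g (q : K) = h (q : K) :=
    DFunLike.congr_fun (RingHom.ext_rat (g.comp (algebraMap ℚ K)) (h.comp (algebraMap ℚ K))) q
  simp only [map_add, map_mul, map_pow, H, hq]

theorem f_monic : f.Monic := by
  have h : f = Polynomial.X ^ 3 + (Polynomial.C (alpha - 2) * Polynomial.X ^ 2
    - Polynomial.C (alpha + 1) * Polynomial.X + 1) := by unfold f; ring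
  rw [h]
  monicity!

theorem f_natDegree : f.natDegree = 3 := by
  unfold f
  compute_degree!

instance : Nontrivial L :=
  AdjoinRoot.nontrivial f (by
    rw [Polynomial.degree_eq_natDegree f_monic.ne_zero, f_natDegree]; decide)

theorem finrank_L : Module.finrank K L = 3 := by
  rw [(AdjoinRoot.powerBasis' f_monic).finrank, AdjoinRoot.powerBasis'_dim, f_natDegree]

instance : Module.Finite K L := (AdjoinRoot.powerBasis' f_monic).finite

theorem exists_coordsL (x : L) : ∃ a b c : K, x = ofK a + ofK b * theta + ofK c * theta ^ 2 :=
  adjoinRoot_exists_coords f_monic f_natDegree x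

theorem coordsL_eq_zero {a b c : K} (h : ofK a + ofK b * theta + ofK c * theta ^ 2 = 0) :
    a = 0 ∧ b = 0 ∧ c = 0 :=
  adjoinRoot_coords_eq_zero f_monic f_natDegree h

/-! ### `D` as an algebra over `ℚ` -/

theorem phi_ofK (k : K) : phi (ofK k) = ofK k := phi.commutes k

theorem kD_mul (k : K) (x : D) :
    kD k * x = ⟨ofK k * x.c₀, ofK k * x.c₁, ofK k * x.c₂⟩ := by
  ext <;> simp [kD, CubicCyclicAlgebra.ofL]

theorem kD_comm (k : K) (x : D) : kD k * x = x * kD k := by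
  rw [kD_mul]
  change _ = x * CubicCyclicAlgebra.ofL _ _ _ (ofK k)
  ext
  · simp [CubicCyclicAlgebra.ofL, mul_comm]
  · simp only [CubicCyclicAlgebra.mul_c₁]
    change _ = _ * 0 + _ * phi (ofK k) + _ * (_ * phi (phi 0))
    rw [phi_ofK]
    simp [mul_comm]
  · simp only [CubicCyclicAlgebra.mul_c₂]
    change _ = _ * 0 + _ * phi 0 + _ * phi (phi (ofK k))
    rw [phi_ofK, phi_ofK]
    simp [mul_comm]

instance : Algebra ℚ D :=
  RingHom.toAlgebra' (kD.comp (algebraMap ℚ K)) fun _ x ↦ kD_comm _ x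

theorem algebraMap_D (q : ℚ) : algebraMap ℚ D q = kD q := rfl

theorem smul_D (q : ℚ) (x : D) : q • x = ⟨q • x.c₀, q • x.c₁, q • x.c₂⟩ := by
  rw [Algebra.smul_def, algebraMap_D, kD_mul]
  have h (y : L) : ofK q * y = q • y := by
    rw [Algebra.smul_def, IsScalarTower.algebraMap_apply ℚ K L]
    rfl
  simp only [h]

/-- The coordinates with respect to `1, u, u²`, as a linear equivalence. -/
noncomputable def equivL : D ≃ₗ[ℚ] L × L × L where
  toFun x := (x.c₀, x.c₁, x.c₂)
  invFun x := ⟨x.1, x.2.1, x.2.2⟩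
  map_add' x y := rfl
  map_smul' q x := by rw [smul_D]; rfl
  left_inv x := rfl
  right_inv x := rfl

theorem finrank_D : Module.finrank ℚ D = 27 := by
  have : Module.Finite ℚ L := Module.Finite.trans K L
  rw [equivL.finrank_eq, Module.finrank_prod, Module.finrank_prod,
    ← Module.finrank_mul_finrank ℚ K L, finrank_K, finrank_L]

instance : Module.Finite ℚ D :=
  have : Module.Finite ℚ L := Module.Finite.trans K L
  Module.Finite.equiv equivL.symm

theorem phi_theta_sub_ne : phi theta - theta ≠ 0 := by
  intro h
  have h1 : ofK 2 + ofK (-alpha) * theta + ofK (-1) * theta ^ 2 = 0 := by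
    rw [phi_theta] at h
    simp only [map_neg, map_one, map_ofNat]
    linear_combination h
  have := (coordsL_eq_zero h1).1
  norm_num at this

theorem phi_phi_theta : phi (phi theta) = theta ^ 2 + (ofK alpha - 2) * theta - ofK alpha := by
  have h : phi (phi theta) = -phi theta ^ 2 + (-ofK alpha + 1) * phi theta + 2 := by
    conv_lhs => rw [phi_theta]
    simp only [map_add, map_mul, map_pow, map_neg, map_one, map_ofNat, phi_ofK]
  rw [h, phi_theta]
  linear_combination (-theta - ofK alpha) * theta_rel

theorem phi_phi_theta_sub_ne : phi (phi theta) - theta ≠ 0 := by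
  intro h
  have h1 : ofK (-alpha) + ofK (alpha - 3) * theta + ofK 1 * theta ^ 2 = 0 := by
    rw [phi_phi_theta] at h
    simp only [map_neg, map_one, map_ofNat, map_sub]
    linear_combination h
  have := (coordsL_eq_zero h1).2.2
  norm_num at this

/-- A fixed element is a third of its trace to K; here Tr θ = 2 − α and Tr θ² = α² − 2α + 6. -/
theorem mem_K_of_phi_eq {l : L} (h : phi l = l) : ∃ k : K, l = ofK k := by
  obtain ⟨a, b, c, rfl⟩ := exists_coordsL l
  refine ⟨a + (1 / 3) * b * (2 - alpha) + (1 / 3) * c * (alpha ^ 2 - 2 * alpha + 6), ?_⟩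
  have h3 : (3 : L) = ofK 3 := (map_ofNat ofK 3).symm
  have h4 : (3 : L) * ofK (1 / 3) = 1 := by
    rw [h3, ← map_mul]; norm_num
  have h2 := congrArg phi h
  simp only [map_add, map_mul, map_pow, phi_ofK, map_sub, map_ofNat] at h h2 ⊢
  rw [phi_phi_theta, phi_theta] at h2
  rw [phi_theta] at h
  have key : (3 : L) * (ofK a + ofK b * theta + ofK c * theta ^ 2) =
    3 * (ofK a + ofK (1 / 3) * ofK b * (2 - ofK alpha) +
      ofK (1 / 3) * ofK c * (ofK alpha ^ 2 - 2 * ofK alpha + 6)) := by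
    linear_combination (-2 * h - h2) - ofK b * (2 - ofK alpha) * h4
      - ofK c * (ofK alpha ^ 2 - 2 * ofK alpha + 6) * h4
      + ofK c * (2 * theta + 2 * ofK alpha - 2) * theta_rel
  have := congrArg (ofK (1 / 3) * ·) key
  simp only [← mul_assoc] at this
  rwa [mul_comm _ (3 : L), h4, one_mul, one_mul] at this

/-- An element of `D` commuting with `θ` and `u` lies in `K`. -/
theorem mem_K_of_commute [IsDomain L] {x : D} (h1 : x * thetaD = thetaD * x)
    (h2 : x * uD = uD * x) : ∃ k : K, x = kD k := by
  have e1 := congrArg CubicCyclicAlgebra.c₁ h1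
  have e2 := congrArg CubicCyclicAlgebra.c₂ h1
  have e0 := congrArg CubicCyclicAlgebra.c₁ h2
  simp only [thetaD, uD, CubicCyclicAlgebra.ofL, CubicCyclicAlgebra.u, RingHom.coe_mk,
    MonoidHom.coe_mk, OneHom.coe_mk, CubicCyclicAlgebra.mul_c₁, CubicCyclicAlgebra.mul_c₂,
    map_zero, mul_zero, zero_mul, add_zero, zero_add, mul_one, one_mul] at e1 e2 e0
  -- The coefficients of u and u² in xθ = θx give cᵢ (φⁱ(θ) − θ) = 0 for i = 1, 2. What is left is
  -- c₀, which is fixed by φ because x commutes with u.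
  have z1 : x.c₁ = 0 := by
    have : x.c₁ * (phi theta - theta) = 0 := by linear_combination e1
    exact (mul_eq_zero.1 this).resolve_right phi_theta_sub_ne
  have z2 : x.c₂ = 0 := by
    have : x.c₂ * (phi (phi theta) - theta) = 0 := by linear_combination e2
    exact (mul_eq_zero.1 this).resolve_right phi_phi_theta_sub_ne
  obtain ⟨k, hk⟩ := mem_K_of_phi_eq e0.symm
  refine ⟨k, ?_⟩
  ext
  · exact hk
  · exact z1
  · exact z2

end Example9

/-! ### The valuation of a normal prime element -/

section NormalPrime

open WithZero

theorem le_exp_of_lt_exp {y : ℤᵐ⁰} {n : ℤ} (h : y < exp (-n)) : y ≤ exp (-(n + 1)) := by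
  rcases eq_or_ne y 0 with rfl | hy
  · exact zero_le
  · rw [← exp_log hy] at h ⊢
    rw [exp_lt_exp] at h
    rw [exp_le_exp]
    omega

variable {A : Type*} [Ring A] {O : Subring A} {u : Aˣ}

theorem zpow_conj_mem (h1 : ∀ x ∈ O, ↑u * x * ↑u⁻¹ ∈ O) (h2 : ∀ x ∈ O, ↑u⁻¹ * x * ↑u ∈ O) (n : ℤ) :
    ∀ x ∈ O, ↑(u ^ n) * x * ↑(u ^ (-n)) ∈ O := by
  induction n using Int.induction_on with
  | zero => intro x hx; simpa using hx
  | succ n ih =>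
    intro x hx
    have := ih _ (h1 x hx)
    have e : u ^ (n + 1 : ℤ) = u ^ (n : ℤ) * u := zpow_add_one u n
    have e' : u ^ (-(n + 1) : ℤ) = u⁻¹ * u ^ (-n : ℤ) := by
      rw [neg_add, add_comm, zpow_add, zpow_neg_one]
    rw [e, e']
    simpa only [Units.val_mul, mul_assoc] using this
  | pred n ih =>
    intro x hx
    have := ih _ (h2 x hx)
    have e : u ^ (-n - 1 : ℤ) = u ^ (-n : ℤ) * u⁻¹ := zpow_sub_one u _
    have e' : u ^ (-(-n - 1) : ℤ) = u * u ^ (-(-n) : ℤ) := by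
      rw [neg_sub, sub_neg_eq_add, neg_neg, zpow_add, zpow_one]
    rw [e, e']
    simpa only [Units.val_mul, mul_assoc] using this

/-- A subring `O` of `A` and a unit `u` of `A` with `u O = O u` that generates a completely prime
ideal of `O`, whose powers intersect in zero and exhaust `A`, define a discrete valuation. -/
theorem exists_valuation_of_normal_prime (hu : ↑u ∈ O)
    (h1 : ∀ x ∈ O, ↑u * x * ↑u⁻¹ ∈ O) (h2 : ∀ x ∈ O, ↑u⁻¹ * x * ↑u ∈ O)
    (hprime : ∀ x ∈ O, ∀ y ∈ O, ↑u⁻¹ * (x * y) ∈ O → ↑u⁻¹ * x ∈ O ∨ ↑u⁻¹ * y ∈ O)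
    (hone : (↑u⁻¹ : A) ∉ O)
    (hsep : ∀ x : A, (∀ n : ℕ, ↑(u ^ (-n : ℤ)) * x ∈ O) → x = 0)
    (hgen : ∀ x : A, ∃ n : ℕ, ↑(u ^ (n : ℤ)) * x ∈ O) :
    ∃ v : Valuation A ℤᵐ⁰, ∀ (x : A) (n : ℤ), v x ≤ exp (-n) ↔ ↑(u ^ (-n)) * x ∈ O := by
  have hmono : ∀ (x : A) (n m : ℤ), m ≤ n → ↑(u ^ (-n)) * x ∈ O → ↑(u ^ (-m)) * x ∈ O := by
    intro x n m hmn hx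
    obtain ⟨k, rfl⟩ := Int.le.dest hmn
    have : ↑(u ^ (k : ℤ)) * (↑(u ^ (-(m + k) : ℤ)) * x) ∈ O :=
      O.mul_mem (by simpa using O.pow_mem hu k) hx
    rwa [← mul_assoc, ← Units.val_mul, ← zpow_add, show (k : ℤ) + -(m + k) = -m by ring] at this
  have hmul : ∀ (x y : A) (n m : ℤ), ↑(u ^ (-n)) * x ∈ O → ↑(u ^ (-m)) * y ∈ O →
      ↑(u ^ (-(n + m))) * (x * y) ∈ O := by
    intro x y n m hx hy
    have := O.mul_mem (zpow_conj_mem h1 h2 (-m) _ hx) hy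
    convert this using 1
    rw [show (-(n + m) : ℤ) = -m + -n by ring, zpow_add, neg_neg]
    have : (↑(u ^ m) : A) * ↑(u ^ (-m)) = 1 := by
      rw [← Units.val_mul, ← zpow_add, add_neg_cancel, zpow_zero, Units.val_one]
    simp only [Units.val_mul, mul_assoc]
    rw [← mul_assoc (↑(u ^ m) : A), this, one_mul]
  -- The order of x ≠ 0 is the largest n with x ∈ uⁿO: `hsep` bounds these n above and `hgen`
  -- provides one.
  have hex : ∀ x : A, x ≠ 0 → ∃ n : ℤ, ↑(u ^ (-n)) * x ∈ O ∧ ∀ m, ↑(u ^ (-m)) * x ∈ O → m ≤ n := by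
    intro x hx
    have hb : ∃ b : ℤ, ∀ m, ↑(u ^ (-m)) * x ∈ O → m ≤ b := by
      by_contra! hcon
      refine hx (hsep x fun n ↦ ?_)
      obtain ⟨m, hm, hnm⟩ := hcon n
      exact hmono x m n hnm.le hm
    obtain ⟨k, hk⟩ := hgen x
    obtain ⟨n, hn, hn'⟩ := Int.exists_greatest_of_bdd
      (P := fun m ↦ ↑(u ^ (-m)) * x ∈ O) hb ⟨-k, by simpa using hk⟩
    exact ⟨n, hn, hn'⟩
  classical
  let w : A → ℤᵐ⁰ := fun x ↦ if hx : x = 0 then 0 else exp (-(hex x hx).choose)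
  have hw : ∀ (x : A) (n : ℤ), w x ≤ exp (-n) ↔ ↑(u ^ (-n)) * x ∈ O := by
    intro x n
    by_cases hx : x = 0
    · simp [w, hx, O.zero_mem]
    · simp only [w, hx, dif_neg, not_false_eq_true, exp_le_exp, neg_le_neg_iff]
      have h := (hex x hx).choose_spec
      exact ⟨fun h' ↦ hmono _ _ _ h' h.1, h.2 n⟩
  have hord : ∀ x : A, x ≠ 0 → ∃ n : ℤ, w x = exp (-n) := fun x hx ↦ ⟨_, dif_neg hx⟩
  -- Complete primeness of uO, transported to x ∈ uⁿO and y ∈ uᵐO; conjugation by a power of u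
  -- collects the powers of u on the left of xy.
  have hprime' : ∀ (x y : A) (n m : ℤ), ↑(u ^ (-n)) * x ∈ O → ↑(u ^ (-m)) * y ∈ O →
      ↑(u ^ (-(n + m + 1))) * (x * y) ∈ O →
      ↑(u ^ (-(n + 1))) * x ∈ O ∨ ↑(u ^ (-(m + 1))) * y ∈ O := by
    intro x y n m hx hy hxy
    have hx' := zpow_conj_mem h1 h2 (-m) _ hx
    have e : ∀ (a b c : ℤ) (z : A), a + b = c → (↑(u ^ a) : A) * (↑(u ^ b) * z) = ↑(u ^ c) * z := by
      rintro a b _ z rfl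
      rw [zpow_add, Units.val_mul, mul_assoc]
    have e1 : ∀ z : A, (↑u⁻¹ : A) * z = ↑(u ^ (-1 : ℤ)) * z := by simp
    have key := hprime _ hx' _ hy ?_
    · refine key.imp (fun h ↦ ?_) fun h ↦ ?_
      · have h' := zpow_conj_mem h1 h2 m _ h
        have : (↑(u ^ (-(-m))) : A) * ↑(u ^ (-m)) = 1 := by
          rw [← Units.val_mul, ← zpow_add, neg_add_cancel, zpow_zero, Units.val_one]
        rw [e1] at h'
        simp only [mul_assoc] at h'
        rw [this, mul_one, e _ _ _ _ rfl, e _ _ _ _ rfl, e _ _ _ _ rfl] at h'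
        convert h' using 4
        ring
      · rw [e1, e _ _ _ _ rfl] at h
        convert h using 4
        ring
    · rw [e1]
      simp only [mul_assoc]
      rw [e (-(-m)) (-m) 0 _ (by ring), e _ _ _ _ rfl, e _ _ _ _ rfl]
      simp only [zpow_zero, Units.val_one, one_mul]
      convert hxy using 4
      ring
  have hw0 : w 0 = 0 := dif_pos rfl
  refine ⟨⟨⟨⟨w, hw0⟩, ?_, ?_⟩, ?_⟩, hw⟩
  · refine le_antisymm ?_ ?_
    · simpa using (hw 1 0).2 (by simp)
    · by_contra! hlt
      exact hone (by simpa using (hw 1 1).1 (by simpa using le_exp_of_lt_exp (n := 0) (by simpa using hlt)))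
  · intro x y
    change w (x * y) = w x * w y
    by_cases hx : x = 0
    · rw [hx, zero_mul, hw0, zero_mul]
    by_cases hy : y = 0
    · rw [hy, mul_zero, hw0, mul_zero]
    obtain ⟨n, hn⟩ := hord x hx
    obtain ⟨m, hm⟩ := hord y hy
    rw [hn, hm, ← exp_add, ← neg_add]
    have hxn := (hw x n).1 hn.le
    have hym := (hw y m).1 hm.le
    refine le_antisymm ((hw _ _).2 (hmul x y n m hxn hym)) ?_
    by_contra! hlt
    rcases hprime' x y n m hxn hym ((hw _ _).1 (le_exp_of_lt_exp hlt)) with h | h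
    · have := (hw _ _).2 h
      rw [hn, exp_le_exp] at this
      omega
    · have := (hw _ _).2 h
      rw [hm, exp_le_exp] at this
      omega
  · intro x y
    change w (x + y) ≤ max (w x) (w y)
    rcases eq_or_ne (max (w x) (w y)) 0 with h | h
    · have hz : ∀ z, w z = 0 → z = 0 := by
        intro z hz
        by_contra hne
        obtain ⟨n, hn⟩ := hord z hne
        exact exp_ne_zero (hn.symm.trans hz)
      have hx := hz x (le_antisymm (h ▸ le_max_left _ _) zero_le)
      have hy := hz y (le_antisymm (h ▸ le_max_right _ _) zero_le)
      rw [hx, hy, add_zero, hw0]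
      exact zero_le
    · obtain ⟨n, hn⟩ : ∃ n : ℤ, max (w x) (w y) = exp (-n) :=
        ⟨-log (max (w x) (w y)), by rw [neg_neg, exp_log h]⟩
      rw [hn, hw, mul_add]
      exact O.add_mem ((hw x n).1 (hn ▸ le_max_left _ _)) ((hw y n).1 (hn ▸ le_max_right _ _))

end NormalPrime

namespace Example9

/-! ### Integral coordinates are unique -/

theorem ZK.toK_eq_zero {x : ZK} (h : x.toK = 0) : x = 0 := by
  have := coords_eq_zero (a := x.1) (b := x.2.1) (c := x.2.2) (by simpa [ZK.toK] using h)
  ext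
  · exact_mod_cast this.1
  · exact_mod_cast this.2.1
  · exact_mod_cast this.2.2

theorem ZL.toL_eq_zero {x : ZL} (h : x.toL = 0) : x = 0 := by
  obtain ⟨h0, h1, h2⟩ := coordsL_eq_zero h
  exact Prod.ext (ZK.toK_eq_zero h0) (Prod.ext (ZK.toK_eq_zero h1) (ZK.toK_eq_zero h2))

theorem ZD.toD_eq_zero {x : ZD} (h : x.toD = 0) : x = 0 :=
  Prod.ext (ZL.toL_eq_zero (congrArg CubicCyclicAlgebra.c₀ h))
    (Prod.ext (ZL.toL_eq_zero (congrArg CubicCyclicAlgebra.c₁ h))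
      (ZL.toL_eq_zero (congrArg CubicCyclicAlgebra.c₂ h)))

theorem ZK.toK_smul (n : ℤ) (x : ZK) : (n • x).toK = n * x.toK := by
  simp only [ZK.toK, Prod.smul_fst, Prod.smul_snd, smul_eq_mul, Int.cast_mul]; ring

theorem ZL.toL_smul (n : ℤ) (x : ZL) : (n • x).toL = ofK n * x.toL := by
  simp only [ZL.toL, Prod.smul_fst, Prod.smul_snd, ZK.toK_smul, map_mul]; ring

theorem ZD.toD_smul (n : ℤ) (x : ZD) : (n • x).toD = kD n * x.toD := by
  rw [kD_mul]
  ext <;> simp only [ZD.toD, Prod.smul_fst, Prod.smul_snd, ZL.toL_smul]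

theorem ZD.toD_neg (x : ZD) : (-x).toD = -x.toD := by
  have h := ZD.toD_smul (-1) x
  simpa using h

theorem ZD.toD_injective : Function.Injective ZD.toD := by
  intro x y h
  have : (x + -y).toD = 0 := by rw [ZD.toD_add, ZD.toD_neg, h, add_neg_cancel]
  have h0 := ZD.toD_eq_zero this
  exact add_neg_eq_zero.1 h0

theorem exists_int_mul_eq_ratCast (q : ℚ) : ∃ m : ℤ, m ≠ 0 ∧ ∃ n : ℤ, (m : ℚ) * q = n :=
  ⟨q.den, by exact_mod_cast q.den_nz, q.num, by
    rw [mul_comm]; exact_mod_cast Rat.mul_den_eq_num q⟩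

theorem exists_toK (x : K) : ∃ m : ℤ, m ≠ 0 ∧ ∃ z : ZK, (m : K) * x = z.toK := by
  obtain ⟨a, b, c, rfl⟩ := exists_coords x
  obtain ⟨m, hm, i, hi⟩ := exists_int_mul_eq_ratCast a
  obtain ⟨n, hn, j, hj⟩ := exists_int_mul_eq_ratCast b
  obtain ⟨l, hl, k, hk⟩ := exists_int_mul_eq_ratCast c
  refine ⟨m * n * l, by positivity, (n * l * i, m * l * j, m * n * k), ?_⟩
  have hi' : (m : K) * a = i := by exact_mod_cast congrArg (Rat.cast : ℚ → K) hi
  have hj' : (n : K) * b = j := by exact_mod_cast congrArg (Rat.cast : ℚ → K) hj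
  have hk' : (l : K) * c = k := by exact_mod_cast congrArg (Rat.cast : ℚ → K) hk
  simp only [ZK.toK, Int.cast_mul, ← hi', ← hj', ← hk']
  ring

theorem exists_toL (x : L) : ∃ m : ℤ, m ≠ 0 ∧ ∃ z : ZL, ofK m * x = z.toL := by
  obtain ⟨a, b, c, rfl⟩ := exists_coordsL x
  obtain ⟨m, hm, i, hi⟩ := exists_toK a
  obtain ⟨n, hn, j, hj⟩ := exists_toK b
  obtain ⟨l, hl, k, hk⟩ := exists_toK c
  refine ⟨m * n * l, by positivity, ((n * l) • i, (m * l) • j, (m * n) • k), ?_⟩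
  simp only [ZL.toL, ZK.toK_smul, ← hi, ← hj, ← hk, map_mul, Int.cast_mul]
  ring

theorem exists_toD (x : D) : ∃ m : ℤ, m ≠ 0 ∧ ∃ z : ZD, kD m * x = z.toD := by
  obtain ⟨m, hm, i, hi⟩ := exists_toL x.c₀
  obtain ⟨n, hn, j, hj⟩ := exists_toL x.c₁
  obtain ⟨l, hl, k, hk⟩ := exists_toL x.c₂
  refine ⟨m * n * l, by positivity, ((n * l) • i, (m * l) • j, (m * n) • k), ?_⟩
  rw [kD_mul]
  ext <;> simp only [ZD.toD, ZL.toL_smul, ← hi, ← hj, ← hk, map_mul, Int.cast_mul] <;> ring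

theorem two_piK_ne_zero : 2 * piK ≠ 0 := by
  intro h
  rw [← ZK.toK_two_piK] at h
  exact absurd (ZK.toK_eq_zero h) (by decide)

theorem uD_pow_three : uD ^ 3 = kD (2 * piK) := CubicCyclicAlgebra.u_pow_three ..

/-- The unit `u` of `D`. -/
def uUnit : Dˣ where
  val := uD
  inv := uD ^ 2 * kD (2 * piK)⁻¹
  val_inv := by
    rw [← mul_assoc, ← pow_succ', uD_pow_three, ← map_mul, mul_inv_cancel₀ two_piK_ne_zero, map_one]
  inv_val := by
    rw [mul_assoc, kD_comm, ← mul_assoc, ← pow_succ, uD_pow_three, ← map_mul,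
      mul_inv_cancel₀ two_piK_ne_zero, map_one]

/-- The automorphism `x ↦ u x u⁻¹`, in coordinates. -/
def ZD.conj (x : ZD) : ZD := (x.1.phi, x.2.1.phi, x.2.2.phi)

theorem uD_mul (x : D) : uD * x =
    ⟨ofK (2 * piK) * phi x.c₂, phi x.c₀, phi x.c₁⟩ := by
  ext <;> simp [uD, CubicCyclicAlgebra.u]

theorem mul_uD (x : D) : x * uD = ⟨ofK (2 * piK) * x.c₂, x.c₀, x.c₁⟩ := by
  ext <;> simp [uD, CubicCyclicAlgebra.u]

theorem ZD.uD_mul_toD (x : ZD) : uD * x.toD = x.conj.toD * uD := by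
  rw [uD_mul, mul_uD]
  simp only [ZD.toD, ZD.conj, ZL.toL_phi]

theorem ZD.toD_mul_uD (x : ZD) : x.toD * uD = uD * x.conj.conj.toD := by
  rw [uD_mul, mul_uD]
  simp only [ZD.toD, ZD.conj, ZL.toL_phi, phi_phi_phi]

theorem kD_cancel {k : K} (hk : k ≠ 0) {x y : D} (h : kD k * x = kD k * y) : x = y := by
  have := congrArg (kD k⁻¹ * ·) h
  simpa only [← mul_assoc, ← map_mul, inv_mul_cancel₀ hk, map_one, one_mul] using this

theorem intCast_K_ne {m : ℤ} (hm : m ≠ 0) : (m : K) ≠ 0 := by exact_mod_cast hm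

/-! ### Residue maps -/

/-- A place of `ℤ[α, θ]` over the prime `p`, with values in the field `F`, at which
`2π` is a uniformizer. -/
structure ResiduePlace (p : ℕ) (F : Type*) [Field F] where
  a : F
  t : F
  a_rel : a ^ 3 + a ^ 2 - 2 * a - 1 = 0
  t_rel : t ^ 3 + (a - 2) * t ^ 2 - (a + 1) * t + 1 = 0
  two_pi : -4 - 2 * a + 2 * a ^ 2 = 0
  -- The kernel of the place is generated by 2π, up to integers prime to p.
  ker : ∀ z : ZL,
    (z.1.1 + z.1.2.1 * a + z.1.2.2 * a ^ 2 : F)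
      + (z.2.1.1 + z.2.1.2.1 * a + z.2.1.2.2 * a ^ 2) * t
      + (z.2.2.1 + z.2.2.2.1 * a + z.2.2.2.2 * a ^ 2) * t ^ 2 = 0 →
    ∃ m : ℤ, ¬ (p : ℤ) ∣ m ∧ ∃ w : ZL, m • z = ZL.mul ((-4, -2, 2), 0, 0) w
  -- Since u⁹ = (2π)³, this makes u⁹ divisible by p, so that high powers of u absorb any given power
  -- of p.
  ram : ∃ w : ZK, ZK.mul (ZK.mul (-4, -2, 2) (-4, -2, 2)) (-4, -2, 2) = (p : ℤ) • w

namespace ResiduePlace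

variable {p : ℕ} {F : Type*} [Field F] (P : ResiduePlace p F)

/-- The value of an element of `ℤ[α]` at the place. -/
def evK (x : ZK) : F := x.1 + x.2.1 * P.a + x.2.2 * P.a ^ 2

/-- The value of an element of `ℤ[α, θ]` at the place. -/
def ev (z : ZL) : F := P.evK z.1 + P.evK z.2.1 * P.t + P.evK z.2.2 * P.t ^ 2

theorem evK_add (x y : ZK) : P.evK (x + y) = P.evK x + P.evK y := by
  simp only [evK, Prod.fst_add, Prod.snd_add, Int.cast_add]; ring

theorem evK_sub (x y : ZK) : P.evK (x - y) = P.evK x - P.evK y := by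
  simp only [evK, Prod.fst_sub, Prod.snd_sub, Int.cast_sub]; ring

theorem evK_mul (x y : ZK) : P.evK (x.mul y) = P.evK x * P.evK y := by
  simp only [evK, ZK.mul, Int.cast_add, Int.cast_sub, Int.cast_mul, Int.cast_ofNat]
  linear_combination (-(x.2.1 * y.2.2 + x.2.2 * y.2.1 : F) - x.2.2 * y.2.2 * (P.a - 1)) *
    P.a_rel

theorem evK_smul (n : ℤ) (x : ZK) : P.evK (n • x) = n * P.evK x := by
  simp only [evK, Prod.smul_fst, Prod.smul_snd, smul_eq_mul, Int.cast_mul]; ring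

theorem ev_add (x y : ZL) : P.ev (x + y) = P.ev x + P.ev y := by
  simp only [ev, Prod.fst_add, Prod.snd_add, evK_add]; ring

theorem ev_smul (n : ℤ) (x : ZL) : P.ev (n • x) = n * P.ev x := by
  simp only [ev, Prod.smul_fst, Prod.smul_snd, evK_smul]; ring

theorem ev_mul (x y : ZL) : P.ev (x.mul y) = P.ev x * P.ev y := by
  simp only [ev, ZL.mul, evK_add, evK_sub, evK_mul]
  have h1 : P.evK (2, -1, 0) = 2 - P.a := by simp [evK]; ring
  have h2 : P.evK (1, 1, 0) = 1 + P.a := by simp [evK]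
  rw [h1, h2]
  linear_combination (-(P.evK x.2.1 * P.evK y.2.2 + P.evK x.2.2 * P.evK y.2.1)
    - P.evK x.2.2 * P.evK y.2.2 * (P.t + (2 - P.a))) * P.t_rel

theorem ev_two_pi : P.ev ((-4, -2, 2), 0, 0) = 0 := by
  have := P.two_pi
  simp [ev, evK]
  linear_combination this

/-- The terms of the constant coefficient that involve u or u² carry the factor u³ = 2π, which
vanishes at the place. Hence evaluating the constant coefficient is multiplicative although D is not
commutative. -/
theorem ev_mul_fst (x y : ZD) : P.ev (x.mul y).1 = P.ev x.1 * P.ev y.1 := by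
  simp only [ZD.mul, ev_add, ev_mul, ev_two_pi, zero_mul, add_zero]

theorem ev_one : P.ev (ZD.ofZK (1, 0, 0)).1 = 1 := by
  simp [ZD.ofZK, ev, evK]

end ResiduePlace

/-- The order in `D` spanned by the `αⁱ θʲ uᵏ`, localized at `p`. -/
def order (p : ℕ) [hp : Fact p.Prime] : Subring D where
  carrier := {x | ∃ m : ℤ, ¬ (p : ℤ) ∣ m ∧ ∃ z : ZD, kD m * x = z.toD}
  mul_mem' := by
    rintro x y ⟨m, hm, z, hz⟩ ⟨m', hm', z', hz'⟩
    refine ⟨m * m', (Nat.prime_iff_prime_int.1 hp.out).not_dvd_mul hm hm', z.mul z', ?_⟩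
    rw [ZD.toD_mul, ← hz, ← hz', Int.cast_mul, map_mul, mul_assoc, mul_assoc, ← mul_assoc (kD m'),
      ← mul_assoc x, kD_comm (m' : K) x, mul_assoc]
  one_mem' := ⟨1, by simpa using (Nat.prime_iff_prime_int.1 hp.out).not_dvd_one,
    ZD.ofZK (1, 0, 0), by rw [ZD.toD_intCast (1 : ℤ), mul_one]⟩
  add_mem' := by
    rintro x y ⟨m, hm, z, hz⟩ ⟨m', hm', z', hz'⟩
    refine ⟨m * m', (Nat.prime_iff_prime_int.1 hp.out).not_dvd_mul hm hm', m' • z + m • z', ?_⟩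
    rw [ZD.toD_add, ZD.toD_smul, ZD.toD_smul, ← hz, ← hz', Int.cast_mul, map_mul, mul_add,
      ← mul_assoc, ← mul_assoc, kD_comm (m : K) (kD m')]
  zero_mem' := ⟨1, by simpa using (Nat.prime_iff_prime_int.1 hp.out).not_dvd_one, 0, by
    rw [mul_zero]
    ext <;> simp [ZD.toD, ZL.toL_zero]⟩
  neg_mem' := by
    rintro x ⟨m, hm, z, hz⟩
    exact ⟨m, hm, -z, by rw [ZD.toD_neg, ← hz, mul_neg]⟩

theorem toD_mem_order (p : ℕ) [hp : Fact p.Prime] (z : ZD) : z.toD ∈ order p :=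
  ⟨1, by simpa using (Nat.prime_iff_prime_int.1 hp.out).not_dvd_one, z, by simp⟩

namespace ResiduePlace

theorem cast_ne_zero {p : ℕ} {F : Type*} [Field F] [CharP F p] {m : ℤ} (hm : ¬ (p : ℤ) ∣ m) :
    (m : F) ≠ 0 := by
  rwa [Ne, CharP.intCast_eq_zero_iff F p]

variable {p : ℕ} [hp : Fact p.Prime] {F : Type*} [Field F] [CharP F p] (P : ResiduePlace p F)

/-- The residue map of the order, as a function. -/
def resFun (x : order p) : F :=
  (x.2.choose : F)⁻¹ * P.ev x.2.choose_spec.2.choose.1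

/-- Two representations of x with different denominators are compared by cross-multiplication, using
that coordinates are unique; so the residue does not depend on the choices made in `resFun`. -/
theorem resFun_spec (x : order p) {m : ℤ} {z : ZD} (h : kD m * x = z.toD) :
    (m : F) * P.resFun x = P.ev z.1 := by
  have h1 := x.2.choose_spec.1
  have h2 := x.2.choose_spec.2.choose_spec
  set m' := x.2.choose
  set z' := x.2.choose_spec.2.choose
  have h3 : m • z' = m' • z := by
    apply ZD.toD_injective
    rw [ZD.toD_smul, ZD.toD_smul, ← h, ← h2, ← mul_assoc, ← mul_assoc, kD_comm]
  have h4 := congrArg (fun z : ZD ↦ P.ev z.1) h3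
  simp only [Prod.smul_fst, ev_smul] at h4
  have h5 : P.resFun x = (m' : F)⁻¹ * P.ev z'.1 := rfl
  rw [h5, mul_left_comm, h4, inv_mul_cancel_left₀ (cast_ne_zero h1)]

/-- The residue map of the order. -/
def res : order p →+* F where
  toFun := P.resFun
  map_one' := by
    have := P.resFun_spec (1 : order p) (m := 1) (z := ZD.ofZK (1, 0, 0)) (by
      rw [ZD.toD_intCast (1 : ℤ)]; simp)
    rw [ev_one] at this
    simpa using this
  map_zero' := by
    have := P.resFun_spec (0 : order p) (m := 1) (z := 0) (by
      rw [ZeroMemClass.coe_zero, mul_zero]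
      ext <;> simp [ZD.toD, ZL.toL_zero])
    simpa [ev, evK] using this
  map_mul' x y := by
    obtain ⟨m, hm, z, hz⟩ := x.2
    obtain ⟨n, hn, w, hw⟩ := y.2
    have h := P.resFun_spec (x * y) (m := m * n) (z := z.mul w) (by
      rw [ZD.toD_mul, ← hz, ← hw, Int.cast_mul, map_mul, Subring.coe_mul, mul_assoc, mul_assoc,
        ← mul_assoc (kD n), ← mul_assoc (x : D), kD_comm (n : K) x, mul_assoc])
    rw [ev_mul_fst, ← P.resFun_spec x hz, ← P.resFun_spec y hw, Int.cast_mul] at h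
    have : ((m : F) * n) ≠ 0 := mul_ne_zero (cast_ne_zero hm) (cast_ne_zero hn)
    exact mul_left_cancel₀ this (by rw [h]; ring)
  map_add' x y := by
    obtain ⟨m, hm, z, hz⟩ := x.2
    obtain ⟨n, hn, w, hw⟩ := y.2
    have h := P.resFun_spec (x + y) (m := m * n) (z := n • z + m • w) (by
      rw [ZD.toD_add, ZD.toD_smul, ZD.toD_smul, ← hz, ← hw, Int.cast_mul, map_mul,
        Subring.coe_add, mul_add, ← mul_assoc, ← mul_assoc, kD_comm (m : K) (kD n)])
    rw [Prod.fst_add, ev_add, Prod.smul_fst, Prod.smul_fst, ev_smul, ev_smul,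
      ← P.resFun_spec x hz, ← P.resFun_spec y hw, Int.cast_mul] at h
    have : ((m : F) * n) ≠ 0 := mul_ne_zero (cast_ne_zero hm) (cast_ne_zero hn)
    exact mul_left_cancel₀ this (by rw [h]; ring)

theorem res_spec (x : order p) {m : ℤ} {z : ZD} (h : kD m * x = z.toD) :
    (m : F) * P.res x = P.ev z.1 := P.resFun_spec x h

/-- If c₀ + c₁u + c₂u² has residue 0, then up to an integer prime to p one has c₀ = 2πw = u³w, and
u⁻¹ times the element is φ⁻¹(c₁) + φ⁻¹(c₂)u + φ⁻¹(w)u², where φ⁻¹ = φ². So u generates the kernel of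
the residue map, which is therefore a completely prime ideal. -/
theorem res_eq_zero_iff (x : order p) : P.res x = 0 ↔ ↑uUnit⁻¹ * (x : D) ∈ order p := by
  constructor
  · intro h
    obtain ⟨m, hm, z, hz⟩ := x.2
    have h0 := P.res_spec x hz
    rw [h, mul_zero] at h0
    obtain ⟨n, hn, w, hw⟩ := P.ker z.1 (by simpa [ev, evK] using h0.symm)
    refine ⟨n * m, (Nat.prime_iff_prime_int.1 hp.out).not_dvd_mul hn hm,
      (n • z.2.1.phi.phi, n • z.2.2.phi.phi, w.phi.phi), ?_⟩
    rw [← uUnit.mul_right_inj, ← mul_assoc, ← kD_comm, mul_assoc, Units.mul_inv_cancel_left,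
      Int.cast_mul, map_mul, mul_assoc, hz, ← ZD.toD_smul]
    change _ = uD * _
    rw [uD_mul]
    simp only [ZD.toD, ZL.toL_smul, ZL.toL_phi, phi_phi_phi, map_mul, phi_ofK, Prod.smul_fst,
      Prod.smul_snd]
    rw [← ZL.toL_smul, hw, ZL.toL_mul, ZL.toL_const, ZK.toK_two_piK, map_mul]
  · rintro ⟨m, hm, z, hz⟩
    rw [← uUnit.mul_right_inj, ← mul_assoc, ← kD_comm, mul_assoc, Units.mul_inv_cancel_left] at hz
    have h := P.res_spec x (m := m) (z := ZD.mul (0, ((1, 0, 0), 0, 0), 0) z) (by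
      rw [ZD.toD_mul, ZD.toD_u]; exact hz)
    rw [ev_mul_fst] at h
    have h0 : P.ev ((0, ((1, 0, 0), 0, 0), 0) : ZD).1 = 0 := by simp [ev, evK]
    rw [h0, zero_mul] at h
    exact (mul_eq_zero.1 h).resolve_left (cast_ne_zero hm)

end ResiduePlace

end Example9

/-! ### Comparison of the `p`-adic and `u`-adic filtrations, and the valuation at a place -/

namespace Example9

/-- An additive group is separated for `p` if no nonzero element is divisible by all powers of
`p`, up to integral factors prime to `p`. -/
def PSeparated (p : ℕ) (G : Type*) [AddCommGroup G] : Prop :=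
  ∀ x : G, (∀ n : ℕ, ∃ m : ℤ, ¬ (p : ℤ) ∣ m ∧ ∃ y : G, m • x = (p : ℤ) ^ n • y) → x = 0

theorem PSeparated.int (p : ℕ) [hp : Fact p.Prime] : PSeparated p ℤ := by
  intro x h
  by_contra hx
  obtain ⟨n, hn⟩ : FiniteMultiplicity (p : ℤ) x :=
    Int.finiteMultiplicity_iff.2 ⟨by simpa using hp.out.ne_one, hx⟩
  obtain ⟨m, hm, y, hy⟩ := h (n + 1)
  have hc : IsCoprime ((p : ℤ) ^ (n + 1)) m :=
    ((Nat.prime_iff_prime_int.1 hp.out).coprime_iff_not_dvd.2 hm).pow_left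
  exact hn (hc.dvd_of_dvd_mul_left ⟨_, hy⟩)

theorem PSeparated.prod {p : ℕ} {G H : Type*} [AddCommGroup G] [AddCommGroup H]
    (hG : PSeparated p G) (hH : PSeparated p H) : PSeparated p (G × H) := by
  intro x h
  refine Prod.ext (hG _ fun n ↦ ?_) (hH _ fun n ↦ ?_) <;> obtain ⟨m, hm, y, hy⟩ := h n
  · exact ⟨m, hm, y.1, congrArg Prod.fst hy⟩
  · exact ⟨m, hm, y.2, congrArg Prod.snd hy⟩

theorem PSeparated.zD (p : ℕ) [Fact p.Prime] : PSeparated p ZD :=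
  have hK : PSeparated p ZK := (PSeparated.int p).prod ((PSeparated.int p).prod (PSeparated.int p))
  have hL : PSeparated p ZL := hK.prod (hK.prod hK)
  hL.prod (hL.prod hL)

namespace ResiduePlace


/-- From u⁹ = (2π)³ and `ram`. This transfers the separation and exhaustion properties, which are
evident for powers of p in coordinates, to powers of u. -/
theorem exists_uUnit_pow_nine {p : ℕ} {F : Type*} [Field F] (P : ResiduePlace p F) :
    ∃ w : ZD, ∀ x : D, ((uUnit ^ 9 : Dˣ) : D) * x = kD p * (w.toD * x) := by
  obtain ⟨w, hw⟩ := P.ram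
  refine ⟨ZD.ofZK w, fun x ↦ ?_⟩
  have h := congrArg ZK.toK hw
  rw [ZK.toK_mul, ZK.toK_mul, ZK.toK_smul, ZK.toK_two_piK] at h
  have h9 : ((uUnit ^ 9 : Dˣ) : D) = kD p * (ZD.ofZK w).toD := by
    rw [ZD.toD_ofZK, ← map_mul, show (p : K) = ((p : ℤ) : K) by norm_cast, ← h, map_mul, map_mul,
      ← uD_pow_three, ← pow_add, ← pow_add]
    rfl
  rw [h9, mul_assoc]

variable {p : ℕ} [hp : Fact p.Prime] {F : Type*} [Field F]

theorem exists_uUnit_pow_nine_mul {p : ℕ} {F : Type*} [Field F] (P : ResiduePlace p F) (n : ℕ) : ∃ w : ZD, ∀ x : D,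
    ((uUnit ^ (9 * n) : Dˣ) : D) * x = kD (p ^ n) * (w.toD * x) := by
  obtain ⟨w, hw⟩ := P.exists_uUnit_pow_nine
  induction n with
  | zero => exact ⟨ZD.ofZK (1, 0, 0), fun x ↦ by rw [ZD.toD_intCast (1 : ℤ)]; simp⟩
  | succ n ih =>
    obtain ⟨w', hw'⟩ := ih
    refine ⟨w'.mul w, fun x ↦ ?_⟩
    rw [mul_add, mul_one, pow_add, Units.val_mul, mul_assoc, hw, hw', ← mul_assoc w'.toD,
      ← kD_comm (p : K), mul_assoc, ← mul_assoc, ← map_mul, ← pow_succ, ZD.toD_mul, mul_assoc]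

theorem exists_mem_order (x : D) : ∃ n : ℕ, kD (p ^ n) * x ∈ order p := by
  obtain ⟨m, hm, z, hz⟩ := exists_toD x
  obtain ⟨m', hmm, hm'⟩ := (Int.finiteMultiplicity_iff (a := p).2
    ⟨by simpa using hp.out.ne_one, hm⟩).exists_eq_pow_mul_and_not_dvd
  refine ⟨multiplicity (p : ℤ) m, m', hm', z, ?_⟩
  have h : ((m : ℤ) : K) = p ^ multiplicity (p : ℤ) m * m' := by
    conv_lhs => rw [hmm]
    push_cast
    rfl
  rw [← hz, ← mul_assoc, ← map_mul, h, mul_comm (m' : K)]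

theorem eq_zero_of_forall_pow {x : D}
    (h : ∀ n : ℕ, ∃ y ∈ order p, x = kD (p ^ n) * y) : x = 0 := by
  obtain ⟨m₀, hm₀, z₀, hz₀⟩ := exists_toD x
  suffices hz : z₀ = 0 by
    refine kD_cancel (intCast_K_ne hm₀) ?_
    rw [hz₀, hz, mul_zero]
    ext <;> simp [ZD.toD, ZL.toL_zero]
  refine PSeparated.zD p z₀ fun n ↦ ?_
  obtain ⟨y, ⟨m, hm, z, hz⟩, hy⟩ := h n
  refine ⟨m, hm, m₀ • z, ZD.toD_injective ?_⟩
  rw [ZD.toD_smul, ZD.toD_smul, ZD.toD_smul, ← hz, ← hz₀, hy]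
  simp only [← mul_assoc, ← map_mul]
  push_cast
  congr 2
  ring

theorem uUnit_mem_order : (uUnit : D) ∈ order p := by
  have hu : (uUnit : D) = ZD.toD (0, ((1, 0, 0), 0, 0), 0) := ZD.toD_u.symm
  rw [hu]
  exact toD_mem_order p _

theorem uUnit_conj_mem (x : D) (hx : x ∈ order p) : ↑uUnit * x * ↑uUnit⁻¹ ∈ order p := by
  obtain ⟨m, hm, z, hz⟩ := hx
  refine ⟨m, hm, z.conj, ?_⟩
  have h : uD * z.toD = z.conj.toD * uUnit := ZD.uD_mul_toD z
  rw [← mul_assoc, ← mul_assoc, kD_comm, mul_assoc (uUnit : D), hz, Units.mul_inv_eq_iff_eq_mul]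
  exact h

theorem uUnit_inv_conj_mem (x : D) (hx : x ∈ order p) : ↑uUnit⁻¹ * x * ↑uUnit ∈ order p := by
  obtain ⟨m, hm, z, hz⟩ := hx
  refine ⟨m, hm, z.conj.conj, ?_⟩
  have h : z.toD * uUnit = uUnit * z.conj.conj.toD := ZD.toD_mul_uD z
  rw [← mul_assoc, ← mul_assoc, kD_comm, mul_assoc (↑uUnit⁻¹ : D), hz, mul_assoc, h,
    Units.inv_mul_cancel_left]

theorem exists_uUnit_pow_mul_mem (P : ResiduePlace p F) (x : D) :
    ∃ n : ℕ, ↑(uUnit ^ (n : ℤ)) * x ∈ order p := by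
  obtain ⟨n, hn⟩ := exists_mem_order (p := p) x
  obtain ⟨w, hw⟩ := P.exists_uUnit_pow_nine_mul n
  refine ⟨9 * n, ?_⟩
  rw [zpow_natCast, hw, ← mul_assoc, kD_comm, mul_assoc]
  exact (order p).mul_mem (toD_mem_order p w) hn

theorem eq_zero_of_forall_uUnit_pow (P : ResiduePlace p F) (x : D)
    (h : ∀ n : ℕ, ↑(uUnit ^ (-n : ℤ)) * x ∈ order p) : x = 0 := by
  refine eq_zero_of_forall_pow (p := p) fun n ↦ ?_
  obtain ⟨w, hw⟩ := P.exists_uUnit_pow_nine_mul n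
  refine ⟨_, (order p).mul_mem (toD_mem_order p w) (h (9 * n)), ?_⟩
  rw [← hw, zpow_neg, zpow_natCast, Units.mul_inv_cancel_left]

theorem uUnit_inv_mul_mem [CharP F p] (P : ResiduePlace p F) (x : D) (hx : x ∈ order p) (y : D)
    (hy : y ∈ order p) (h : ↑uUnit⁻¹ * (x * y) ∈ order p) :
    ↑uUnit⁻¹ * x ∈ order p ∨ ↑uUnit⁻¹ * y ∈ order p := by
  have h' := (P.res_eq_zero_iff (⟨x, hx⟩ * ⟨y, hy⟩)).2
  rw [Subring.coe_mul] at h'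
  replace h' := h' h
  rw [map_mul, mul_eq_zero] at h'
  exact h'.imp (P.res_eq_zero_iff ⟨x, hx⟩).1 (P.res_eq_zero_iff ⟨y, hy⟩).1

theorem uUnit_inv_notMem [CharP F p] (P : ResiduePlace p F) : (↑uUnit⁻¹ : D) ∉ order p := by
  intro h
  have h' := (P.res_eq_zero_iff 1).2
  rw [OneMemClass.coe_one, mul_one] at h'
  have h2 := h' h
  rw [RingHom.map_one] at h2
  exact one_ne_zero h2

open WithZero

/-- The `u`-adic valuation of `D` at a place. -/
theorem exists_valuation [CharP F p] (P : ResiduePlace p F) : ∃ v : Valuation D ℤᵐ⁰, (∀ x, v x = 0 → x = 0) ∧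
    (∀ x, v x ≤ 1 ↔ x ∈ order p) ∧ ∀ x : order p, v x < 1 ↔ P.res x = 0 := by
  obtain ⟨v, hv⟩ := exists_valuation_of_normal_prime (O := order p) (u := uUnit)
    uUnit_mem_order uUnit_conj_mem uUnit_inv_conj_mem
    (uUnit_inv_mul_mem P) (uUnit_inv_notMem P)
    (eq_zero_of_forall_uUnit_pow P) (exists_uUnit_pow_mul_mem P)
  refine ⟨v, ?_, ?_, ?_⟩
  · intro x hx
    exact eq_zero_of_forall_uUnit_pow P x fun n ↦ (hv x n).1 (by rw [hx]; exact zero_le)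
  · intro x
    have h := hv x 0
    rwa [neg_zero, zpow_zero, Units.val_one, one_mul, exp_zero] at h
  · intro x
    rw [P.res_eq_zero_iff]
    have h := hv x 1
    rw [zpow_neg_one] at h
    rw [← h]
    constructor
    · intro h'
      simpa using le_exp_of_lt_exp (n := 0) (by simpa using h')
    · intro h'
      refine h'.trans_lt ?_
      rw [← exp_zero, exp_lt_exp]
      norm_num

end ResiduePlace

end Example9

namespace Example9

/-! ### The places over `2` and `7` -/

theorem ZL.mul_const (c : ZK) (w : ZL) : ZL.mul (c, 0, 0) w = (c.mul w.1, c.mul w.2.1, c.mul w.2.2) := by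
  ext <;> simp [ZL.mul, ZK.mul]

/-- `f`, over a field containing a root `a` of the minimal polynomial of `α`. -/
def fPoly {k : Type*} [Field k] (a : k) : k[X] :=
  Polynomial.X ^ 3 + (Polynomial.C (a - 2) * Polynomial.X ^ 2
    - Polynomial.C (a + 1) * Polynomial.X + 1)

theorem fPoly_monic {k : Type*} [Field k] (a : k) : (fPoly a).Monic := by
  unfold fPoly
  monicity!

theorem fPoly_natDegree {k : Type*} [Field k] (a : k) : (fPoly a).natDegree = 3 := by
  unfold fPoly
  compute_degree!

theorem fPoly_eval {k : Type*} [Field k] (a x : k) :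
    (fPoly a).eval x = x ^ 3 + ((a - 2) * x ^ 2 - (a + 1) * x + 1) := by
  simp [fPoly]

theorem fPoly_eval₂ {k B : Type*} [Field k] [CommRing B] (i : k →+* B) (a : k) (y : B) :
    (fPoly a).eval₂ i y = y ^ 3 + ((i a - 2) * y ^ 2 - (i a + 1) * y + 1) := by
  have h2 : i 2 = 2 := map_ofNat i 2
  simp [fPoly, Polynomial.eval₂_add, Polynomial.eval₂_sub, Polynomial.eval₂_mul, h2]

theorem fPoly_root {k : Type*} [Field k] (a : k) :
    AdjoinRoot.root (fPoly a) ^ 3 + (AdjoinRoot.of (fPoly a) a - 2) * AdjoinRoot.root (fPoly a) ^ 2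
      - (AdjoinRoot.of (fPoly a) a + 1) * AdjoinRoot.root (fPoly a) + 1 = 0 := by
  have h := AdjoinRoot.eval₂_root (fPoly a)
  rw [fPoly_eval₂] at h
  linear_combination h

theorem fPoly_irreducible {k : Type*} [Field k] (a : k)
    (h : ∀ x : k, x ^ 3 + ((a - 2) * x ^ 2 - (a + 1) * x + 1) ≠ 0) : Irreducible (fPoly a) := by
  rw [(fPoly_monic a).irreducible_iff_roots_eq_zero_of_degree_le_three
    (by rw [fPoly_natDegree]; norm_num) (by rw [fPoly_natDegree]),
    Multiset.eq_zero_iff_forall_notMem]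
  intro x hx
  rw [Polynomial.mem_roots (fPoly_monic a).ne_zero, Polynomial.IsRoot, fPoly_eval] at hx
  exact h x hx

/-! #### The place over `7` -/

/-- Modulo 7 the minimal polynomial of α is (X − 2)³, so 2 is the only residue of α. The reduction
of f there has no root in 𝔽₇, so the prime over 7 is inert in L. -/
instance : Fact (Irreducible (fPoly (2 : ZMod 7))) := ⟨fPoly_irreducible _ (by decide)⟩

/-- The field with `343` elements. -/
abbrev F343 : Type := AdjoinRoot (fPoly (2 : ZMod 7))

instance : CharP F343 7 :=
  charP_of_injective_algebraMap (algebraMap (ZMod 7) F343).injective 7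

instance : Module.Finite (ZMod 7) F343 := (AdjoinRoot.powerBasis' (fPoly_monic _)).finite

instance : Finite F343 := Module.finite_of_finite (ZMod 7)

theorem finrank_F343 : Module.finrank (ZMod 7) F343 = 3 := by
  rw [(AdjoinRoot.powerBasis' (fPoly_monic _)).finrank, AdjoinRoot.powerBasis'_dim, fPoly_natDegree]

/-- The hypothesis writes x as a combination of α − 2, α² − 4 and 7. All are multiples of π = (α −
2)(α + 1), where α + 1 is a unit with inverse 2 − α²: the cofactors are 2 − α², 3 − α² and 2α² − α −
6. The factor 2 turns π into 2π and is harmless at 7. -/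
theorem exists_two_pi_mul_of_seven_dvd {x : ZK} (h : ((x.1 + x.2.1 * 2 + x.2.2 * 4 : ℤ) : ZMod 7) = 0) :
    ∃ w : ZK, (2 : ℤ) • x = ZK.mul (-4, -2, 2) w := by
  rw [ZMod.intCast_zmod_eq_zero_iff_dvd] at h
  obtain ⟨k, hk⟩ := h
  have hx : x.1 = -2 * x.2.1 - 4 * x.2.2 + 7 * k := by push_cast at hk; linarith
  refine ⟨(2 * x.2.1 + 3 * x.2.2 - 6 * k, -k, -x.2.1 - x.2.2 + 2 * k), ?_⟩
  ext <;> simp [ZK.mul, hx] <;> ring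

/-- The place over `7`. -/
def place7 : ResiduePlace 7 F343 where
  a := 2
  t := AdjoinRoot.root _
  a_rel := by
    have : (7 : F343) = 0 := by exact_mod_cast CharP.cast_eq_zero F343 7
    linear_combination this
  t_rel := by
    have h := fPoly_root (2 : ZMod 7)
    rwa [map_ofNat] at h
  two_pi := by norm_num
  ker := by
    intro z hz
    have e (x : ZK) : (x.1 + x.2.1 * 2 + x.2.2 * 2 ^ 2 : F343)
        = AdjoinRoot.of (fPoly (2 : ZMod 7)) ((x.1 + x.2.1 * 2 + x.2.2 * 4 : ℤ) : ZMod 7) := by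
      push_cast
      simp only [map_add, map_mul, map_intCast, map_ofNat]
      norm_num
    rw [e, e, e] at hz
    obtain ⟨h0, h1, h2⟩ := adjoinRoot_coords_eq_zero (fPoly_monic _) (fPoly_natDegree _) hz
    obtain ⟨w0, hw0⟩ := exists_two_pi_mul_of_seven_dvd h0
    obtain ⟨w1, hw1⟩ := exists_two_pi_mul_of_seven_dvd h1
    obtain ⟨w2, hw2⟩ := exists_two_pi_mul_of_seven_dvd h2
    refine ⟨2, by decide, (w0, w1, w2), ?_⟩
    rw [ZL.mul_const, ← hw0, ← hw1, ← hw2]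
    rfl
  -- This is π³ = 7(α² − α − 1), multiplied by 8.
  ram := ⟨(-8, -8, 8), by decide⟩

/-! #### The place over `2` -/

instance : Fact (Irreducible (alphaPoly (ZMod 2))) := ⟨alphaPoly_irreducible_two⟩

/-- The field with `8` elements. -/
abbrev F8 : Type := AdjoinRoot (alphaPoly (ZMod 2))

instance : CharP F8 2 :=
  charP_of_injective_algebraMap (algebraMap (ZMod 2) F8).injective 2

/-- The image of `α` in the field with `8` elements. -/
abbrev alpha8 : F8 := AdjoinRoot.root _

theorem alpha8_rel : alpha8 ^ 3 + alpha8 ^ 2 - 2 * alpha8 - 1 = 0 := by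
  have h := AdjoinRoot.eval₂_root (alphaPoly (ZMod 2))
  rwa [alphaPoly_eval₂] at h

/-- The value in `F8` of an element of `ℤ[α]`. -/
def ev8 (x : ZK) : F8 := x.1 + x.2.1 * alpha8 + x.2.2 * alpha8 ^ 2

theorem ev8_add (x y : ZK) : ev8 (x + y) = ev8 x + ev8 y := by
  simp only [ev8, Prod.fst_add, Prod.snd_add, Int.cast_add]; ring

theorem ev8_sub (x y : ZK) : ev8 (x - y) = ev8 x - ev8 y := by
  simp only [ev8, Prod.fst_sub, Prod.snd_sub, Int.cast_sub]; ring

theorem ev8_mul (x y : ZK) : ev8 (x.mul y) = ev8 x * ev8 y := by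
  simp only [ev8, ZK.mul, Int.cast_add, Int.cast_sub, Int.cast_mul, Int.cast_ofNat]
  linear_combination (-(x.2.1 * y.2.2 + x.2.2 * y.2.1 : F8) - x.2.2 * y.2.2 * (alpha8 - 1)) *
    alpha8_rel

theorem even_of_ev8_eq_zero {x : ZK} (h : ev8 x = 0) : ∃ y : ZK, x = (2 : ℤ) • y := by
  have h' : AdjoinRoot.of (alphaPoly (ZMod 2)) (x.1 : ZMod 2)
      + AdjoinRoot.of (alphaPoly (ZMod 2)) (x.2.1 : ZMod 2) * alpha8
      + AdjoinRoot.of (alphaPoly (ZMod 2)) (x.2.2 : ZMod 2) * alpha8 ^ 2 = 0 := by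
    simpa [ev8] using h
  obtain ⟨h0, h1, h2⟩ := adjoinRoot_coords_eq_zero (alphaPoly_monic _) (alphaPoly_natDegree _) h'
  rw [ZMod.intCast_zmod_eq_zero_iff_dvd] at h0 h1 h2
  obtain ⟨a, ha⟩ := h0
  obtain ⟨b, hb⟩ := h1
  obtain ⟨c, hc⟩ := h2
  exact ⟨(a, b, c), Prod.ext ha (Prod.ext hb hc)⟩

theorem exists_ev8_eq (x : F8) : ∃ a b c : Fin 2, x = ev8 ((a : ℤ), (b : ℤ), (c : ℤ)) := by
  obtain ⟨a, b, c, rfl⟩ := adjoinRoot_exists_coords (alphaPoly_monic _) (alphaPoly_natDegree _) x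
  refine ⟨a, b, c, ?_⟩
  have e (a : ZMod 2) : AdjoinRoot.of (alphaPoly (ZMod 2)) a =
      ((((show Fin 2 from a) : ℕ) : ℤ) : F8) := by
    rw [← map_intCast (AdjoinRoot.of (alphaPoly (ZMod 2)))]
    congr 1
    revert a
    decide
  rw [e, e, e]
  rfl

/-- Each of the eight elements of the field lifts to ℤ[α] with coordinates 0 and 1. The value of f
is computed on the lift, and a root would make all its coordinates even; the eight cases are
checked. -/
theorem fPoly8_ne_zero (x : F8) :
    x ^ 3 + ((alpha8 - 2) * x ^ 2 - (alpha8 + 1) * x + 1) ≠ 0 := by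
  obtain ⟨a, b, c, rfl⟩ := exists_ev8_eq x
  intro h
  have key (z : ZK) : ev8 z ^ 3 + ((alpha8 - 2) * ev8 z ^ 2 - (alpha8 + 1) * ev8 z + 1) =
      ev8 (z.mul (z.mul z) + (ZK.mul (-2, 1, 0) (z.mul z) - ZK.mul (1, 1, 0) z + (1, 0, 0))) := by
    simp only [ev8_add, ev8_mul, ev8_sub]
    simp [ev8]
    ring
  rw [key] at h
  obtain ⟨⟨p, q, r⟩, hy⟩ := even_of_ev8_eq_zero h
  have hp := congrArg (fun z : ZK ↦ z.1 % 2) hy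
  have hq := congrArg (fun z : ZK ↦ z.2.1 % 2) hy
  have hr := congrArg (fun z : ZK ↦ z.2.2 % 2) hy
  simp only [Prod.smul_mk, smul_eq_mul, Int.mul_emod_right] at hp hq hr
  clear hy h
  revert a b c
  decide

instance : Fact (Irreducible (fPoly alpha8)) := ⟨fPoly_irreducible _ fPoly8_ne_zero⟩

/-- The field with `512` elements. -/
abbrev F512 : Type := AdjoinRoot (fPoly alpha8)

instance : CharP F512 2 :=
  charP_of_injective_algebraMap (algebraMap F8 F512).injective 2

instance : Finite F512 :=
  have : Module.Finite (ZMod 2) F8 := (AdjoinRoot.powerBasis' (alphaPoly_monic _)).finite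
  have : Finite F8 := Module.finite_of_finite (ZMod 2)
  have : Module.Finite F8 F512 := (AdjoinRoot.powerBasis' (fPoly_monic _)).finite
  Module.finite_of_finite F8

/-- The place over `2`. -/
def place2 : ResiduePlace 2 F512 where
  a := AdjoinRoot.of _ alpha8
  t := AdjoinRoot.root _
  a_rel := by
    have := congrArg (AdjoinRoot.of (fPoly alpha8)) alpha8_rel
    simpa only [map_add, map_sub, map_mul, map_pow, map_one, map_ofNat, map_zero] using this
  t_rel := fPoly_root alpha8
  two_pi := by
    have : (2 : F512) = 0 := by exact_mod_cast CharP.cast_eq_zero F512 2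
    linear_combination (-2 - AdjoinRoot.of (fPoly alpha8) alpha8
      + AdjoinRoot.of (fPoly alpha8) alpha8 ^ 2) * this
  ker := by
    intro z hz
    have e (x : ZK) : (x.1 + x.2.1 * AdjoinRoot.of (fPoly alpha8) alpha8
        + x.2.2 * AdjoinRoot.of (fPoly alpha8) alpha8 ^ 2 : F512)
        = AdjoinRoot.of (fPoly alpha8) (ev8 x) := by
      simp only [ev8, map_add, map_mul, map_intCast, map_pow]
    rw [e, e, e] at hz
    obtain ⟨h0, h1, h2⟩ := adjoinRoot_coords_eq_zero (fPoly_monic _) (fPoly_natDegree _) hz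
    have key {x : ZK} (hx : ev8 x = 0) : ∃ w : ZK, (7 : ℤ) • x = ZK.mul (-4, -2, 2) w := by
      obtain ⟨y, rfl⟩ := even_of_ev8_eq_zero hx
      -- By 7 = π(2α² − α − 6), the element 14y is a multiple of 2π; the factor 7 is prime to 2.
      refine ⟨ZK.mul (-6, -1, 2) y, ?_⟩
      ext <;> simp [ZK.mul] <;> ring
    obtain ⟨w0, hw0⟩ := key h0
    obtain ⟨w1, hw1⟩ := key h1
    obtain ⟨w2, hw2⟩ := key h2
    refine ⟨7, by decide, (w0, w1, w2), ?_⟩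
    rw [ZL.mul_const, ← hw0, ← hw1, ← hw2]
    rfl
  ram := ⟨(-28, -28, 28), by decide⟩

/-! ### `D` is a division ring -/

instance : Nontrivial D := ⟨0, 1, fun h ↦ zero_ne_one (congrArg CubicCyclicAlgebra.c₀ h)⟩

/-- A valuation that vanishes only at 0 excludes zero divisors. No norm condition on 2π has to be
verified. -/
instance : NoZeroDivisors D where
  eq_zero_or_eq_zero_of_mul_eq_zero {x y} h := by
    obtain ⟨v, h0, -, -⟩ := place7.exists_valuation
    have := congrArg v h
    rw [map_mul, map_zero, mul_eq_zero] at this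
    exact this.imp (h0 x) (h0 y)

instance : IsDomain D := NoZeroDivisors.to_isDomain D

theorem isUnit_D {x : D} (hx : x ≠ 0) : IsUnit x := isUnit_of_finite_of_ne_zero ℚ hx

theorem ofL_injective : Function.Injective (CubicCyclicAlgebra.ofL phi phi_phi_phi (2 * piK)) :=
  fun _ _ h ↦ congrArg CubicCyclicAlgebra.c₀ h

/-- L is a subring of the domain D, so f is never shown to be irreducible over K directly. -/
instance : IsDomain L := ofL_injective.isDomain _

end Example9

/-! ### The universal property of cubic cyclic algebras -/

namespace CubicCyclicAlgebra

variable {K L B : Type*} [CommRing K] [CommRing L] [Algebra K L] [Ring B]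
  {φ : L →ₐ[K] L} {hφ : ∀ l, φ (φ (φ l)) = l} {a : K}

/-- A homomorphism on `L` and an element `U` with `U g(l) = g(φ(l)) U` and `U³ = g(a)` extend to
the cyclic algebra. -/
def lift (g : L →+* B) (U : B) (hU : ∀ l, U * g l = g (φ l) * U)
    (hU3 : U * U * U = g (algebraMap K L a)) : CubicCyclicAlgebra φ hφ a →+* B where
  toFun x := g x.c₀ + g x.c₁ * U + g x.c₂ * (U * U)
  map_one' := by simp
  map_zero' := by simp
  map_add' x y := by simp only [add_c₀, add_c₁, add_c₂, map_add]; noncomm_ring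
  map_mul' x y := by
    have c1 (l : L) (b : B) : U * (g l * b) = g (φ l) * (U * b) := by
      rw [← mul_assoc, hU, mul_assoc]
    have c3 : U * (U * U) = g (algebraMap K L a) := by rw [← mul_assoc, hU3]
    simp only [mul_c₀, mul_c₁, mul_c₂, add_mul, mul_add, mul_assoc, hU, c1, c3, φ.commutes]
    simp only [map_add, map_mul, mul_assoc, add_mul]
    have hg (l m : L) : g l * g m = g m * g l := by rw [← map_mul, ← map_mul, mul_comm]
    have hg' (l m : L) (b : B) : g l * (g m * b) = g m * (g l * b) := by
      rw [← mul_assoc, hg, mul_assoc]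
    simp only [hg' (algebraMap K L a), hg (algebraMap K L a)]
    abel

theorem lift_ofL (g : L →+* B) (U : B) (hU : ∀ l, U * g l = g (φ l) * U)
    (hU3 : U * U * U = g (algebraMap K L a)) (l : L) :
    lift (hφ := hφ) g U hU hU3 (ofL φ hφ a l) = g l := by
  simp [lift, ofL]

theorem lift_u (g : L →+* B) (U : B) (hU : ∀ l, U * g l = g (φ l) * U)
    (hU3 : U * U * U = g (algebraMap K L a)) :
    lift (hφ := hφ) g U hU hU3 (u φ hφ a) = U := by
  simp [lift, u]

end CubicCyclicAlgebra

namespace Example9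

/-! ### The automorphism `τ` in coordinates -/

instance : DecidableEq ZK := instDecidableEqProd
instance : DecidableEq ZL := instDecidableEqProd
instance : DecidableEq ZD := instDecidableEqProd

/-- The automorphism `σ`, in coordinates. -/
def ZK.sigma (x : ZK) : ZK :=
  (x.1, 0, 0) + ZK.mul (x.2.1, 0, 0) (1, -1, -1) + ZK.mul (x.2.2, 0, 0) (ZK.mul (1, -1, -1) (1, -1, -1))

theorem ZK.toK_int (n : ℤ) : ZK.toK (n, 0, 0) = n := by simp [ZK.toK]

theorem ZK.toK_sigmaAlpha : ZK.toK (1, -1, -1) = -alpha ^ 2 - alpha + 1 := by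
  simp [ZK.toK]; ring

theorem ZK.toK_sigma (x : ZK) : x.sigma.toK = sigmaK x.toK := by
  simp only [ZK.sigma, ZK.toK_add, ZK.toK_mul, ZK.toK_int, ZK.toK_sigmaAlpha]
  simp only [ZK.toK, map_add, map_mul, map_pow, map_intCast, sigmaK_alpha]
  ring

/-- The coordinates of `673 τ(θ)`. -/
def ZD.tauTheta : ZD :=
  (((-276, -154, 303), (-855, 708, 390), (543, 25, -106)),
    ((-326, 218, 314), (430, -238, 40), (-30, -46, -128)),
    ((157, 151, -48), (275, -27, -397), (-63, 38, 135)))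

/-- The coordinates of `τ(u)`. -/
def ZD.tauU : ZD := (0, ((0, 1, 1), (1, -1, 0), (-1, 0, 0)), 0)

/-- `673² τ(l)` for `l` in `ℤ[α, θ]`, in coordinates. -/
def ZD.tauL (x : ZL) : ZD :=
  (673 ^ 2 : ℤ) • ZD.ofZK x.1.sigma + (673 : ℤ) • (ZD.ofZK x.2.1.sigma).mul ZD.tauTheta +
    (ZD.ofZK x.2.2.sigma).mul (ZD.tauTheta.mul ZD.tauTheta)

/-- `673² τ`, in coordinates. -/
def ZD.tau (x : ZD) : ZD :=
  ZD.tauL x.1 + (ZD.tauL x.2.1).mul ZD.tauU + (ZD.tauL x.2.2).mul (ZD.tauU.mul ZD.tauU)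

/-- `τ(θ)`. -/
def tauTheta : D := kD (1 / 673) * ZD.tauTheta.toD

theorem ZD.toD_qsmul (n : ℤ) (x : ZD) : (n • x).toD = (n : ℚ) • x.toD := by
  rw [ZD.toD_smul, Algebra.smul_def, algebraMap_D, Rat.cast_intCast]

theorem ZD.toD_sub (x y : ZD) : (x - y).toD = x.toD - y.toD := by
  rw [sub_eq_add_neg, ZD.toD_add, ZD.toD_neg, sub_eq_add_neg]

theorem ZD.toD_zero : ZD.toD 0 = 0 := by
  have h := ZD.toD_add 0 0
  rwa [add_zero, left_eq_add] at h

/-- The coordinates of `θ`. -/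
def ZD.theta : ZD := ((0, (1, 0, 0), 0), 0, 0)

/-- The coordinates of `u`. -/
def ZD.u : ZD := (0, ((1, 0, 0), 0, 0), 0)

theorem lam_mul_uD : lam * uD = ZD.tauU.toD := by
  have h1 : lam = ZD.toD (ZD.ofZK (0, 1, 1) + (ZD.ofZK (1, -1, 0)).mul ZD.theta
      + ZD.mul (ZD.ofZK (-1, 0, 0)) (ZD.mul ZD.theta ZD.theta)) := by
    have e1 : ZK.toK (0, 1, 1) = alpha ^ 2 + alpha := by simp [ZK.toK]; ring
    have e2 : ZK.toK (1, -1, 0) = -alpha + 1 := by simp [ZK.toK]; ring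
    have e3 : ZK.toK (-1, 0, 0) = -1 := by simp [ZK.toK]
    simp only [ZD.toD_add, ZD.toD_mul, ZD.toD_ofZK, ZD.theta, ZD.toD_theta, e1, e2, e3]
    rw [map_neg, map_one, neg_one_mul, ← sub_eq_add_neg, ← pow_two]
    rfl
  rw [h1, ← ZD.toD_u, ← ZD.toD_mul]
  exact congrArg ZD.toD (by decide +kernel)

/-- The coordinates of the matrix `(c_{ij})`. -/
def ZK.c : Matrix (Fin 3) (Fin 3) ZK :=
  !![(-276, -154, 303), (-326, 218, 314), (157, 151, -48);
    (-855, 708, 390), (430, -238, 40), (275, -27, -397);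
    (543, 25, -106), (-30, -46, -128), (-63, 38, 135)]

theorem ZK.toK_c (i j : Fin 3) : (ZK.c i j).toK = Example9.c i j := by
  fin_cases i <;> fin_cases j <;> simp [ZK.c, Example9.c, ZK.toK] <;> ring

theorem sum_c_eq : ∑ i : Fin 3, ∑ j : Fin 3, kD (c i j) * thetaD ^ (i : ℕ) * uD ^ (j : ℕ)
    = ZD.tauTheta.toD := by
  have h : ZD.tauTheta = ((ZD.ofZK (ZK.c 0 0)) + (ZD.ofZK (ZK.c 0 1)).mul ZD.u
      + (ZD.ofZK (ZK.c 0 2)).mul (ZD.u.mul ZD.u))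
      + ((ZD.ofZK (ZK.c 1 0)).mul ZD.theta + ((ZD.ofZK (ZK.c 1 1)).mul ZD.theta).mul ZD.u
      + ((ZD.ofZK (ZK.c 1 2)).mul ZD.theta).mul (ZD.u.mul ZD.u))
      + ((ZD.ofZK (ZK.c 2 0)).mul (ZD.theta.mul ZD.theta)
      + ((ZD.ofZK (ZK.c 2 1)).mul (ZD.theta.mul ZD.theta)).mul ZD.u
      + ((ZD.ofZK (ZK.c 2 2)).mul (ZD.theta.mul ZD.theta)).mul (ZD.u.mul ZD.u)) := by
    decide +kernel
  have h1 : ((1 : Fin 3) : ℕ) = 1 := rfl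
  have h2 : ((2 : Fin 3) : ℕ) = 2 := rfl
  have h0 : ((0 : Fin 3) : ℕ) = 0 := rfl
  rw [h]
  simp only [ZD.toD_add, ZD.toD_mul, ZD.toD_ofZK, ZK.toK_c, ZD.theta, ZD.toD_theta, ZD.u, ZD.toD_u,
    Fin.sum_univ_three, h0, h1, h2, pow_zero, pow_one, pow_two, mul_one]

theorem tauTheta_eq_smul : tauTheta = (1 / 673 : ℚ) • ZD.tauTheta.toD := by
  rw [tauTheta, Algebra.smul_def, algebraMap_D]; norm_num

/-- This says that τ(θ) is a root of f with σ applied to the coefficients, the condition for σ to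
extend to L. After multiplication by 673³ it is an identity between integral coordinates. -/
theorem tauTheta_rel : tauTheta * tauTheta * tauTheta
    + kD (sigmaK (alpha - 2)) * (tauTheta * tauTheta)
    - kD (sigmaK (alpha + 1)) * tauTheta + 1 = 0 := by
  have e1 : ZK.toK (-1, -1, -1) = sigmaK (alpha - 2) := by
    rw [map_sub, sigmaK_alpha, map_ofNat]; simp [ZK.toK]; ring
  have e2 : ZK.toK (2, -1, -1) = sigmaK (alpha + 1) := by
    rw [map_add, sigmaK_alpha, map_one]; simp [ZK.toK]; ring
  have e3 : ZD.toD (ZD.ofZK (1, 0, 0)) = 1 := by rw [ZD.toD_intCast]; simp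
  have h : (ZD.tauTheta.mul ZD.tauTheta).mul ZD.tauTheta
      + (673 : ℤ) • (ZD.ofZK (-1, -1, -1)).mul (ZD.tauTheta.mul ZD.tauTheta)
      - (673 ^ 2 : ℤ) • (ZD.ofZK (2, -1, -1)).mul ZD.tauTheta
      + (673 ^ 3 : ℤ) • ZD.ofZK (1, 0, 0) = 0 := by decide +kernel
  have h' := congrArg ZD.toD h
  simp only [ZD.toD_add, ZD.toD_sub, ZD.toD_qsmul, ZD.toD_mul, ZD.toD_ofZK, e1, e2,
    ZD.toD_zero] at h'
  rw [← ZD.toD_ofZK, e3] at h'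
  simp only [tauTheta_eq_smul, smul_mul_assoc, mul_smul_comm, smul_smul]
  have h3 := congrArg ((1 / 673 ^ 3 : ℚ) • ·) h'
  simp only [smul_zero] at h3
  rw [← h3]
  push_cast
  module

end Example9

/-- Conjugation by a unit. -/
def conjHom {A : Type*} [Ring A] (d : Aˣ) : A →+* A where
  toFun x := d * x * ↑d⁻¹
  map_one' := by simp
  map_zero' := by simp
  map_add' x y := by simp [mul_add, add_mul]
  map_mul' x y := by simp [mul_assoc]

theorem conjHom_eq {A : Type*} [Ring A] {d : Aˣ} {x y : A} (h : y * d = d * x) : conjHom d x = y := by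
  change ↑d * x * ↑d⁻¹ = y
  rw [← h, mul_assoc, Units.mul_inv, mul_one]

/-! ### Existence and uniqueness of σ̃, and its cube -/

namespace Example9

/-- The restriction of `τ` to `L`. -/
def tauOfL : L →+* D :=
  -- Evaluation at τ(θ) in the noncommutative ring D is a homomorphism because the coefficients are
  -- mapped into the central subfield K.
  Ideal.Quotient.lift _ (Polynomial.eval₂RingHom' (kD.comp sigmaK) tauTheta
    fun k ↦ kD_comm (sigmaK k) tauTheta) (by
      intro p hp
      obtain ⟨q, rfl⟩ := Ideal.mem_span_singleton'.1 hp
      have hf : Polynomial.eval₂RingHom' (kD.comp sigmaK) tauTheta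
          (fun k ↦ kD_comm (sigmaK k) tauTheta) f = 0 := by
        have hX : Polynomial.eval₂RingHom' (kD.comp sigmaK) tauTheta
            (fun k ↦ kD_comm (sigmaK k) tauTheta) Polynomial.X = tauTheta :=
          Polynomial.eval₂_X ..
        have hC (k : K) : Polynomial.eval₂RingHom' (kD.comp sigmaK) tauTheta
            (fun k ↦ kD_comm (sigmaK k) tauTheta) (Polynomial.C k) = kD (sigmaK k) :=
          Polynomial.eval₂_C ..
        rw [← tauTheta_rel]
        simp only [f, map_add, map_sub, map_mul, map_one, hX, hC, pow_succ, pow_zero, one_mul]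
      rw [map_mul, hf, mul_zero])

theorem tauOfL_theta : tauOfL theta = tauTheta := by
  change Polynomial.eval₂ (kD.comp sigmaK) tauTheta Polynomial.X = _
  rw [Polynomial.eval₂_X]

theorem tauOfL_ofK (k : K) : tauOfL (ofK k) = kD (sigmaK k) := by
  change Polynomial.eval₂ (kD.comp sigmaK) tauTheta (Polynomial.C k) = _
  rw [Polynomial.eval₂_C, RingHom.comp_apply]

/-- `τ(u)`. -/
def tauU : D := ZD.tauU.toD

theorem sigmaK_toK_neg_alpha_add_one : ZK.toK (0, 1, 1) = sigmaK (-alpha + 1) := by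
  rw [map_add, map_neg, sigmaK_alpha, map_one]; simp [ZK.toK]

theorem ZD.toD_one : ZD.toD (ZD.ofZK (1, 0, 0)) = 1 := by rw [ZD.toD_intCast]; simp

theorem tauOfL_phi_theta : tauOfL (phi theta) =
    -(tauTheta * tauTheta) + kD (sigmaK (-alpha + 1)) * tauTheta + 2 := by
  have h : -ofK alpha + 1 = ofK (-alpha + 1) := by simp
  rw [phi_theta, h, map_add, map_add, map_neg, map_pow, map_mul, tauOfL_theta, tauOfL_ofK,
    pow_two, map_ofNat]

/-- The relation uθ = φ(θ)u under τ, needed for the universal property of D. The denominators 673 of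
τ(θ) are cleared by the factor 673². -/
theorem tauU_mul_tauTheta : tauU * tauTheta = tauOfL (phi theta) * tauU := by
  have h : (673 : ℤ) • ZD.tauU.mul ZD.tauTheta =
      (-(ZD.tauTheta.mul ZD.tauTheta) + (673 : ℤ) • (ZD.ofZK (0, 1, 1)).mul ZD.tauTheta
        + (673 ^ 2 * 2 : ℤ) • ZD.ofZK (1, 0, 0)).mul ZD.tauU := by decide +kernel
  have h' := congrArg ZD.toD h
  simp only [ZD.toD_add, ZD.toD_neg, ZD.toD_qsmul, ZD.toD_mul, ZD.toD_one] at h'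
  rw [ZD.toD_ofZK, sigmaK_toK_neg_alpha_add_one] at h'
  have e : (2 : D) = (2 : ℚ) • (1 : D) := by
    rw [Algebra.smul_def, mul_one, map_ofNat]
  rw [tauOfL_phi_theta, e, tauTheta_eq_smul, tauU]
  simp only [add_mul, neg_mul, smul_mul_assoc, mul_smul_comm, smul_smul, one_mul] at h' ⊢
  have h3 := congrArg ((1 / 673 ^ 2 : ℚ) • ·) h'
  simp only [smul_smul, smul_add, smul_neg] at h3
  push_cast at h3
  norm_num at h3 ⊢
  exact h3

theorem tauU_mul_tauOfL (l : L) : tauU * tauOfL l = tauOfL (phi l) * tauU := by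
  obtain ⟨a, b, c, rfl⟩ := exists_coordsL l
  simp only [map_add, map_mul, map_pow, tauOfL_ofK, phi_ofK, tauOfL_theta, mul_add, add_mul]
  rw [← kD_comm (sigmaK a), ← mul_assoc tauU (kD (sigmaK b)), ← kD_comm (sigmaK b) tauU,
    ← mul_assoc tauU (kD (sigmaK c)), ← kD_comm (sigmaK c) tauU, mul_assoc, tauU_mul_tauTheta,
    mul_assoc (kD (sigmaK c)), pow_two, ← mul_assoc tauU, tauU_mul_tauTheta,
    mul_assoc (tauOfL (phi theta)), tauU_mul_tauTheta]
  simp only [mul_assoc, pow_two]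

theorem tauU_pow_three : tauU * tauU * tauU = tauOfL (algebraMap K L (2 * piK)) := by
  have h : ((ZD.tauU.mul ZD.tauU).mul ZD.tauU) = ZD.ofZK (ZK.sigma (-4, -2, 2)) := by
    decide +kernel
  have h' := congrArg ZD.toD h
  rw [ZD.toD_ofZK, ZK.toK_sigma, ZK.toK_two_piK, ZD.toD_mul, ZD.toD_mul] at h'
  exact h'.trans (tauOfL_ofK _).symm

/-- The automorphism `τ` of `D`, as an endomorphism. -/
def tauHom : D →+* D :=
  CubicCyclicAlgebra.lift tauOfL tauU tauU_mul_tauOfL tauU_pow_three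

theorem tauHom_ofL (l : L) : tauHom (CubicCyclicAlgebra.ofL phi phi_phi_phi (2 * piK) l) = tauOfL l :=
  CubicCyclicAlgebra.lift_ofL ..

theorem tauHom_kD (k : K) : tauHom (kD k) = kD (sigmaK k) :=
  (tauHom_ofL _).trans (tauOfL_ofK k)

theorem tauHom_theta : tauHom thetaD = tauTheta := (tauHom_ofL _).trans tauOfL_theta

theorem tauHom_u : tauHom uD = tauU := CubicCyclicAlgebra.lift_u ..

/-- Injective because nonzero elements of D are units, and then surjective because the map is
ℚ-linear on a finite-dimensional space. -/
theorem tauHom_bijective : Function.Bijective tauHom := by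
  have hinj : Function.Injective tauHom := by
    rw [injective_iff_map_eq_zero]
    intro x hx
    by_contra h0
    have := (isUnit_D h0).map tauHom
    rw [hx] at this
    exact not_isUnit_zero this
  refine ⟨hinj, ?_⟩
  have hl (q : ℚ) (x : D) : tauHom (q • x) = q • tauHom x := by
    rw [Algebra.smul_def, Algebra.smul_def, map_mul, algebraMap_D, tauHom_kD, map_ratCast]
  exact (LinearMap.injective_iff_surjective (f := (⟨⟨tauHom, map_add tauHom⟩, hl⟩ : D →ₗ[ℚ] D))).1 hinj

theorem D_eq_coords (x : D) : x = CubicCyclicAlgebra.ofL phi phi_phi_phi (2 * piK) x.c₀ +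
    CubicCyclicAlgebra.ofL phi phi_phi_phi (2 * piK) x.c₁ * uD +
    CubicCyclicAlgebra.ofL phi phi_phi_phi (2 * piK) x.c₂ * (uD * uD) := by
  ext <;> simp [CubicCyclicAlgebra.ofL, uD, CubicCyclicAlgebra.u]

theorem ofL_coords (a b c : K) : CubicCyclicAlgebra.ofL phi phi_phi_phi (2 * piK)
    (ofK a + ofK b * theta + ofK c * theta ^ 2) = kD a + kD b * thetaD + kD c * thetaD ^ 2 := by
  simp only [map_add, map_mul, map_pow]; rfl

theorem ringHom_ext_D {B : Type*} [Ring B] {g h : D →+* B} (hα : g (kD alpha) = h (kD alpha))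
    (hθ : g thetaD = h thetaD) (hu : g uD = h uD) : g = h := by
  have hk (k : K) : g (kD k) = h (kD k) :=
    DFunLike.congr_fun (ringHom_ext_alpha (g := g.comp kD) (h := h.comp kD) hα) k
  have hl (l : L) : g (CubicCyclicAlgebra.ofL phi phi_phi_phi (2 * piK) l) =
      h (CubicCyclicAlgebra.ofL phi phi_phi_phi (2 * piK) l) := by
    obtain ⟨a, b, c, rfl⟩ := exists_coordsL l
    rw [ofL_coords]
    simp only [map_add, map_mul, map_pow, hk, hθ]
  refine RingHom.ext fun x ↦ ?_
  rw [D_eq_coords x]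
  simp only [map_add, map_mul, hl, hu]

theorem tauTheta_eq_sum : kD (1 / 673) *
    ∑ i : Fin 3, ∑ j : Fin 3, kD (c i j) * thetaD ^ (i : ℕ) * uD ^ (j : ℕ) = tauTheta := by
  rw [sum_c_eq]; rfl

theorem isSigmaTilde_iff (τ : RingAut D) : IsSigmaTilde τ ↔ ∀ x, τ x = tauHom x := by
  constructor
  · intro h x
    refine DFunLike.congr_fun (f := (τ : D →+* D)) (ringHom_ext_D ?_ ?_ ?_) x
    · rw [tauHom_kD, sigmaK_alpha]; exact h.map_alpha
    · rw [tauHom_theta, ← tauTheta_eq_sum]; exact h.map_theta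
    · rw [tauHom_u]; exact h.map_u.trans lam_mul_uD
  · intro h
    refine ⟨?_, ?_, ?_⟩
    · rw [h, tauHom_kD, sigmaK_alpha]
    · rw [h, tauHom_theta, tauTheta_eq_sum]
    · rw [h, tauHom_u, lam_mul_uD]; rfl

theorem existsUnique_isSigmaTilde : ∃! τ : RingAut D, IsSigmaTilde τ := by
  refine ⟨RingEquiv.ofBijective tauHom tauHom_bijective, ?_, ?_⟩
  · exact (isSigmaTilde_iff _).2 fun x ↦ rfl
  · intro τ hτ
    exact RingEquiv.ext ((isSigmaTilde_iff _).1 hτ)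

theorem ZL.tauOfL_toL (x : ZL) : (673 ^ 2 : ℚ) • tauOfL x.toL = (ZD.tauL x).toD := by
  simp only [ZL.toL, ZD.tauL, map_add, map_mul, tauOfL_ofK, tauOfL_theta, ZD.toD_add,
    ZD.toD_qsmul, ZD.toD_mul, ZD.toD_ofZK, ZK.toK_sigma, tauTheta_eq_smul, pow_two, smul_add,
    mul_smul_comm, smul_mul_assoc, smul_smul]
  norm_num

theorem ZD.tauHom_toD (x : ZD) : (673 ^ 2 : ℚ) • tauHom x.toD = x.tau.toD := by
  rw [D_eq_coords x.toD]
  simp only [map_add, map_mul, tauHom_ofL, tauHom_u, ZD.tau, ZD.toD_add, ZD.toD_mul,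
    ← ZL.tauOfL_toL, smul_add, smul_mul_assoc]
  rfl

/-- The coordinates of an element `d` with `τ(d) = d` that induces `τ³`. -/
def ZD.d : ZD :=
  (((136, 536, 468), (-624, -244, 628), (324, -240, -416)),
    ((184, -30, -52), (-574, -14, 350), (-84, 14, -14)),
    ((77, -357, -126), (-201, -163, 151), (-124, 166, 74)))

/-- Since `ZD.tau` is 673² times τ, one application contributes 673² and three contribute 673⁶. The
two intertwining identities below are linear in d and determine it up to Kˣ; invariance under τ
determines it up to ℚˣ. -/
theorem ZD.tau_d : ZD.d.tau = (673 ^ 2 : ℤ) • ZD.d := by decide +kernel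

theorem ZD.tau_tau_tau_theta :
    ZD.theta.tau.tau.tau.mul ZD.d = (673 ^ 6 : ℤ) • ZD.d.mul ZD.theta := by decide +kernel

theorem ZD.tau_tau_tau_u :
    ZD.u.tau.tau.tau.mul ZD.d = (673 ^ 6 : ℤ) • ZD.d.mul ZD.u := by decide +kernel

theorem sigmaK_sigmaK_sigmaK (k : K) : sigmaK (sigmaK (sigmaK k)) = k := by
  have h : (sigmaK.comp (sigmaK.comp sigmaK)) = RingHom.id K := by
    refine ringHom_ext_alpha ?_
    simp only [RingHom.comp_apply, sigmaK_alpha, map_add, map_sub, map_neg, map_pow, map_one,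
      RingHom.id_apply]
    linear_combination (-alpha ^ 5 - 3 * alpha ^ 4 + 5 * alpha ^ 2 + alpha ^ 3 + alpha ^ 2 - 1) * alpha_rel
  exact DFunLike.congr_fun h k

theorem qsmul_cancel {q : ℚ} (hq : q ≠ 0) {x y : D} (h : q • x = q • y) : x = y := by
  have := congrArg (q⁻¹ • ·) h
  simpa only [smul_smul, inv_mul_cancel₀ hq, one_smul] using this

theorem tauHom_qsmul (q : ℚ) (x : D) : tauHom (q • x) = q • tauHom x := by
  rw [Algebra.smul_def, Algebra.smul_def, map_mul, algebraMap_D, tauHom_kD, map_ratCast]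

theorem ZD.tauHom_tauHom_tauHom_toD (x : ZD) :
    (673 ^ 6 : ℚ) • tauHom (tauHom (tauHom x.toD)) = x.tau.tau.tau.toD := by
  rw [← ZD.tauHom_toD, ← ZD.tauHom_toD, ← ZD.tauHom_toD]
  simp only [tauHom_qsmul, smul_smul]
  norm_num

theorem ZD.d_ne_zero : ZD.d.toD ≠ 0 := fun h ↦ by
  have := ZD.toD_eq_zero h
  revert this
  decide +kernel

theorem tauHom_tauHom_tauHom_kD (k : K) : tauHom (tauHom (tauHom (kD k))) = kD k := by
  rw [tauHom_kD, tauHom_kD, tauHom_kD, sigmaK_sigmaK_sigmaK]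

/-- Since σ³ = 1 on K, τ³ and conjugation by d agree on α; they agree on θ and u by the identities
in coordinates, and these three elements determine a homomorphism on D. -/
theorem exists_d : ∃ d : Dˣ, (∀ a, tauHom (tauHom (tauHom a)) = d * a * ↑d⁻¹) ∧ tauHom d = d := by
  obtain ⟨d, hd⟩ := isUnit_D ZD.d_ne_zero
  have key (x : ZD) (h : x.tau.tau.tau.mul ZD.d = (673 ^ 6 : ℤ) • ZD.d.mul x) :
      tauHom (tauHom (tauHom x.toD)) = conjHom d x.toD := by
    refine (conjHom_eq ?_).symm
    rw [hd]
    refine qsmul_cancel (q := 673 ^ 6) (by norm_num) ?_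
    rw [← smul_mul_assoc, ZD.tauHom_tauHom_tauHom_toD, ← ZD.toD_mul, ← ZD.toD_mul, h,
      ZD.toD_qsmul]
    norm_num
  have h : tauHom.comp (tauHom.comp tauHom) = conjHom d := by
    refine ringHom_ext_D ?_ ?_ ?_
    · rw [conjHom_eq (kD_comm alpha (d : D)), RingHom.comp_apply, RingHom.comp_apply,
        tauHom_tauHom_tauHom_kD]
    · rw [← show ZD.theta.toD = thetaD from ZD.toD_theta, RingHom.comp_apply, RingHom.comp_apply]
      exact key _ ZD.tau_tau_tau_theta
    · rw [← show ZD.u.toD = uD from ZD.toD_u, RingHom.comp_apply, RingHom.comp_apply]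
      exact key _ ZD.tau_tau_tau_u
  refine ⟨d, fun a ↦ DFunLike.congr_fun h a, ?_⟩
  rw [hd]
  refine qsmul_cancel (q := 673 ^ 2) (by norm_num) ?_
  rw [ZD.tauHom_toD, ZD.tau_d, ZD.toD_qsmul]
  norm_num

end Example9

/-! ### Twisted Laurent series over a division ring -/

namespace TwistedLaurentSeries

variable {R : Type*} [Ring R] {σ : RingAut R}

/-- The order of a series: the least exponent that occurs in it. -/
def ord (f : TwistedLaurentSeries σ) : ℤ := HahnSeries.order (Γ := ℤ) (R := R) f

theorem coeff_ord_ne_zero {f : TwistedLaurentSeries σ} (hf : f ≠ 0) : coeff f (ord f) ≠ 0 :=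
  fun h ↦ hf (HahnSeries.coeff_order_eq_zero (Γ := ℤ) (R := R).1 h)

theorem coeff_eq_zero_of_lt_ord {f : TwistedLaurentSeries σ} {n : ℤ} (h : n < ord f) :
    coeff f n = 0 := HahnSeries.coeff_eq_zero_of_lt_order (Γ := ℤ) (R := R) h

theorem ord_le {f : TwistedLaurentSeries σ} {n : ℤ} (h : coeff f n ≠ 0) : ord f ≤ n :=
  HahnSeries.order_le_of_coeff_ne_zero (Γ := ℤ) (R := R) h

theorem le_ord {f : TwistedLaurentSeries σ} (hf : f ≠ 0) {k : ℤ} (h : ∀ n < k, coeff f n = 0) :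
    k ≤ ord f := not_lt.1 fun h1 ↦ coeff_ord_ne_zero hf (h _ h1)

theorem ord_eq {f : TwistedLaurentSeries σ} {k : ℤ} (h : ∀ n < k, coeff f n = 0)
    (hk : coeff f k ≠ 0) : ord f = k :=
  le_antisymm (ord_le hk) (le_ord (fun h0 ↦ hk (by rw [h0, coeff_zero])) h)

theorem coeff_neg (f : TwistedLaurentSeries σ) (n : ℤ) : coeff (-f) n = -coeff f n := rfl

theorem coeff_sub (f g : TwistedLaurentSeries σ) (n : ℤ) :
    coeff (f - g) n = coeff f n - coeff g n := by
  rw [sub_eq_add_neg, coeff_add, coeff_neg, sub_eq_add_neg]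

theorem coeff_sum {ι : Type*} (s : Finset ι) (f : ι → TwistedLaurentSeries σ) (n : ℤ) :
    coeff (∑ i ∈ s, f i) n = ∑ i ∈ s, coeff (f i) n :=
  map_sum (⟨⟨fun g ↦ coeff g n, rfl⟩, fun _ _ ↦ rfl⟩ : TwistedLaurentSeries σ →+ R) f s

theorem coeff_one (n : ℤ) : coeff (1 : TwistedLaurentSeries σ) n = if n = 0 then 1 else 0 :=
  coeff_monomial 0 n 1

theorem coeff_mul_eq_zero {f g : TwistedLaurentSeries σ} {m k : ℤ} (hf : ∀ n < m, coeff f n = 0)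
    (hg : ∀ n < k, coeff g n = 0) {n : ℤ} (hn : n < m + k) : coeff (f * g) n = 0 := by
  rw [coeff_mul]
  refine Finset.sum_eq_zero fun ij hij ↦ ?_
  obtain ⟨-, -, h⟩ := Finset.mem_antidiagonal.1 hij
  by_cases h1 : ij.1 < m
  · rw [hf _ h1, zero_mul]
  · rw [hg _ (by omega), map_zero, mul_zero]

theorem coeff_mul_add {f g : TwistedLaurentSeries σ} {m k : ℤ} (hf : ∀ n < m, coeff f n = 0)
    (hg : ∀ n < k, coeff g n = 0) :
    coeff (f * g) (m + k) = coeff f m * (σ ^ m) (coeff g k) := by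
  rw [coeff_mul, Finset.sum_eq_single (m, k)]
  · intro ij hij hne
    obtain ⟨-, -, h⟩ := Finset.mem_antidiagonal.1 hij
    by_cases h1 : ij.1 < m
    · rw [hf _ h1, zero_mul]
    · by_cases h2 : ij.2 < k
      · rw [hg _ h2, map_zero, mul_zero]
      · exact absurd (Prod.ext (by simp; omega) (by simp; omega)) hne
  · intro h
    by_cases h1 : coeff f m = 0
    · rw [h1, zero_mul]
    · by_cases h2 : coeff g k = 0
      · rw [h2, map_zero, mul_zero]
      · exact absurd (Finset.mem_antidiagonal.2 ⟨h1, h2, rfl⟩) h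

theorem coeff_monomial_mul (m : ℤ) (a : R) (g : TwistedLaurentSeries σ) (n : ℤ) :
    coeff (monomial σ m a * g) n = a * (σ ^ m) (coeff g (n - m)) := by
  rw [coeff_mul, Finset.sum_eq_single (m, n - m)]
  · rw [coeff_monomial, if_pos rfl]
  · intro ij hij hne
    obtain ⟨-, -, h⟩ := Finset.mem_antidiagonal.1 hij
    rw [coeff_monomial, if_neg fun h1 ↦ hne (Prod.ext h1 (by simp; omega)), zero_mul]
  · intro h
    by_cases h1 : a = 0
    · rw [coeff_monomial, if_pos rfl, h1, zero_mul]
    · by_cases h2 : coeff g (n - m) = 0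
      · rw [h2, map_zero, mul_zero]
      · refine absurd (Finset.mem_antidiagonal.2 ⟨?_, h2, by simp⟩) h
        change coeff (monomial σ m a) m ≠ 0
        rwa [coeff_monomial, if_pos rfl]

theorem coeff_mul_monomial (m : ℤ) (a : R) (f : TwistedLaurentSeries σ) (n : ℤ) :
    coeff (f * monomial σ m a) n = coeff f (n - m) * (σ ^ (n - m)) a := by
  rw [coeff_mul, Finset.sum_eq_single (n - m, m)]
  · rw [coeff_monomial, if_pos rfl]
  · intro ij hij hne
    obtain ⟨-, -, h⟩ := Finset.mem_antidiagonal.1 hij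
    rw [coeff_monomial, if_neg fun h1 ↦ hne (Prod.ext (by simp; omega) h1), map_zero, mul_zero]
  · intro h
    by_cases h1 : a = 0
    · rw [coeff_monomial, if_pos rfl, h1, map_zero, mul_zero]
    · by_cases h2 : coeff f (n - m) = 0
      · rw [h2, zero_mul]
      · refine absurd (Finset.mem_antidiagonal.2 ⟨h2, ?_, by simp⟩) h
        change coeff (monomial σ m a) m ≠ 0
        rwa [coeff_monomial, if_pos rfl]

theorem monomial_mul_monomial (m n : ℤ) (a b : R) :
    monomial σ m a * monomial σ n b = monomial σ (m + n) (a * (σ ^ m) b) := by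
  refine ext fun k ↦ ?_
  rw [coeff_monomial_mul, coeff_monomial, coeff_monomial]
  by_cases h : k = m + n
  · rw [if_pos h, if_pos (by omega)]
  · rw [if_neg h, if_neg (by omega), map_zero, mul_zero]

theorem monomial_zero (m : ℤ) : monomial σ m 0 = 0 := ext fun n ↦ by
  rw [coeff_monomial, coeff_zero, ite_self]

theorem monomial_add (m : ℤ) (a b : R) : monomial σ m (a + b) = monomial σ m a + monomial σ m b :=
  ext fun n ↦ by
    rw [coeff_add, coeff_monomial, coeff_monomial, coeff_monomial]
    split_ifs <;> simp

theorem monomial_zero_one : monomial σ 0 1 = 1 := rfl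

theorem monomial_pow (n : ℕ) : monomial σ 1 1 ^ n = monomial σ n 1 := by
  induction n with
  | zero => rw [pow_zero, Nat.cast_zero, monomial_zero_one]
  | succ n ih => rw [pow_succ, ih, monomial_mul_monomial, map_one, mul_one]; push_cast; rfl

theorem bddBelow_support {c : ℤ → R} {k : ℤ} (h : ∀ n < k, c n = 0) :
    BddBelow (Function.support c) :=
  ⟨k, fun n hn ↦ not_lt.1 fun h1 ↦ hn (h n h1)⟩

/-- The series with given coefficients. -/
def mk (σ : RingAut R) (c : ℤ → R) (k : ℤ) (h : ∀ n < k, c n = 0) : TwistedLaurentSeries σ :=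
  (HahnSeries.ofSuppBddBelow c (bddBelow_support h) : HahnSeries ℤ R)

theorem coeff_mk (c : ℤ → R) (k : ℤ) (h : ∀ n < k, c n = 0) (n : ℤ) :
    coeff (mk σ c k h) n = c n := by
  change (HahnSeries.ofSuppBddBelow c (bddBelow_support h)).coeff n = _
  rw [HahnSeries.coeff_ofSuppBddBelow]

instance [Nontrivial R] : Nontrivial (TwistedLaurentSeries σ) :=
  ⟨0, 1, fun h ↦ zero_ne_one (α := R) (by
    have := congrArg (fun f ↦ coeff f 0) h
    simpa only [coeff_zero, coeff_one, if_true] using this)⟩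

theorem coeff_mul_ord (f g : TwistedLaurentSeries σ) :
    coeff (f * g) (ord f + ord g) = coeff f (ord f) * (σ ^ ord f) (coeff g (ord g)) :=
  coeff_mul_add (fun _ ↦ coeff_eq_zero_of_lt_ord) fun _ ↦ coeff_eq_zero_of_lt_ord

theorem coeff_mul_ord_ne_zero [NoZeroDivisors R] {f g : TwistedLaurentSeries σ} (hf : f ≠ 0)
    (hg : g ≠ 0) : coeff (f * g) (ord f + ord g) ≠ 0 := by
  rw [coeff_mul_ord]
  exact mul_ne_zero (coeff_ord_ne_zero hf)
    ((map_ne_zero_iff _ (σ ^ ord f).injective).2 (coeff_ord_ne_zero hg))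

instance [NoZeroDivisors R] : NoZeroDivisors (TwistedLaurentSeries σ) where
  eq_zero_or_eq_zero_of_mul_eq_zero {f g} h := by
    by_contra! hn
    have := coeff_mul_ord_ne_zero hn.1 hn.2
    rw [h, coeff_zero] at this
    exact this rfl

theorem ord_mul [NoZeroDivisors R] {f g : TwistedLaurentSeries σ} (hf : f ≠ 0) (hg : g ≠ 0) :
    ord (f * g) = ord f + ord g :=
  ord_eq (fun _ ↦ coeff_mul_eq_zero (fun _ ↦ coeff_eq_zero_of_lt_ord)
    fun _ ↦ coeff_eq_zero_of_lt_ord) (coeff_mul_ord_ne_zero hf hg)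

theorem ord_one [Nontrivial R] : ord (1 : TwistedLaurentSeries σ) = 0 :=
  ord_eq (fun n hn ↦ by rw [coeff_one, if_neg hn.ne]) (by rw [coeff_one, if_pos rfl]; exact one_ne_zero)

theorem xAdic_zero (δ : ℝ≥0) : xAdic δ (0 : TwistedLaurentSeries σ) = 0 := if_pos rfl

theorem xAdic_of_ne {δ : ℝ≥0} {f : TwistedLaurentSeries σ} (hf : f ≠ 0) :
    xAdic δ f = δ ^ ord f := if_neg hf

theorem xAdic_le_iff {δ : ℝ≥0} (h0 : 0 < δ) (h1 : δ < 1) (f : TwistedLaurentSeries σ) (k : ℤ) :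
    xAdic δ f ≤ δ ^ k ↔ ∀ n < k, coeff f n = 0 := by
  by_cases hf : f = 0
  · rw [hf, xAdic_zero]
    exact ⟨fun _ n _ ↦ coeff_zero n, fun _ ↦ zero_le⟩
  · rw [xAdic_of_ne hf, zpow_le_zpow_iff_right_of_lt_one₀ h0 h1]
    exact ⟨fun h n hn ↦ coeff_eq_zero_of_lt_ord (hn.trans_le h), fun h ↦ le_ord hf h⟩

/-- The `x`-adic valuation. -/
def xAdicValuation [Nontrivial R] [NoZeroDivisors R] (σ : RingAut R) {δ : ℝ≥0} (h0 : 0 < δ)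
    (h1 : δ < 1) : Valuation (TwistedLaurentSeries σ) ℝ≥0 where
  toFun := xAdic δ
  map_zero' := xAdic_zero δ
  map_one' := by rw [xAdic_of_ne one_ne_zero, ord_one, zpow_zero]
  map_mul' f g := by
    by_cases hf : f = 0
    · rw [hf, zero_mul, xAdic_zero, zero_mul]
    by_cases hg : g = 0
    · rw [hg, mul_zero, xAdic_zero, mul_zero]
    rw [xAdic_of_ne hf, xAdic_of_ne hg, xAdic_of_ne (mul_ne_zero hf hg), ord_mul hf hg,
      zpow_add₀ h0.ne']
  map_add_le_max' f g := by
    by_cases hf : f = 0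
    · rw [hf, zero_add]; exact le_max_right _ _
    by_cases hg : g = 0
    · rw [hg, add_zero]; exact le_max_left _ _
    have key : xAdic δ (f + g) ≤ δ ^ min (ord f) (ord g) := by
      rw [xAdic_le_iff h0 h1]
      intro n hn
      rw [coeff_add, coeff_eq_zero_of_lt_ord (hn.trans_le (min_le_left _ _)),
        coeff_eq_zero_of_lt_ord (hn.trans_le (min_le_right _ _)), add_zero]
    refine key.trans ?_
    rcases min_choice (ord f) (ord g) with h | h
    · rw [h, ← xAdic_of_ne hf]; exact le_max_left _ _
    · rw [h, ← xAdic_of_ne hg]; exact le_max_right _ _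

theorem xAdicValuation_apply [Nontrivial R] [NoZeroDivisors R] {δ : ℝ≥0} (h0 : 0 < δ)
    (h1 : δ < 1) (f : TwistedLaurentSeries σ) : xAdicValuation σ h0 h1 f = xAdic δ f := rfl

theorem coeff_pow_eq_zero {h : TwistedLaurentSeries σ} (hh : ∀ n < 1, coeff h n = 0) (i : ℕ) :
    ∀ n < (i : ℤ), coeff (h ^ i) n = 0 := by
  induction i with
  | zero =>
    intro n hn
    rw [pow_zero, coeff_one, if_neg (by push_cast at hn; omega)]
  | succ i ih =>
    intro n hn
    rw [pow_succ]
    exact coeff_mul_eq_zero ih hh (by push_cast at hn; omega)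

/-- The inverse is the geometric series ∑ hⁱ. As hⁱ has order at least i, only finitely many powers
contribute to a given coefficient. -/
theorem exists_one_sub_mul_eq_one {h : TwistedLaurentSeries σ} (hh : ∀ n < 1, coeff h n = 0) :
    ∃ s, (1 - h) * s = 1 := by
  let S (N : ℕ) : TwistedLaurentSeries σ := ∑ i ∈ Finset.range (N + 1), h ^ i
  have hS (N M : ℕ) (hNM : N ≤ M) (n : ℤ) (hn : n < N + 1) : coeff (S M) n = coeff (S N) n := by
    induction M, hNM using Nat.le_induction with
    | base => rfl
    | succ M hM ih =>
      rw [← ih]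
      change coeff (∑ i ∈ Finset.range (M + 1 + 1), h ^ i) n = _
      rw [Finset.sum_range_succ, coeff_add, coeff_pow_eq_zero hh _ n (by push_cast; omega),
        add_zero]
  have hneg (N : ℕ) (n : ℤ) (hn : n < 0) : coeff (S N) n = 0 := by
    rw [coeff_sum]
    exact Finset.sum_eq_zero fun i _ ↦ coeff_pow_eq_zero hh i n (by omega)
  -- The coefficient of index n no longer changes from the partial sum `S n.toNat` on.
  refine ⟨mk σ (fun n ↦ coeff (S n.toNat) n) 0 fun n hn ↦ hneg _ n hn, ext fun n ↦ ?_⟩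
  set s := mk σ (fun n ↦ coeff (S n.toNat) n) 0 fun n hn ↦ hneg _ n hn
  have hd : ∀ m < (n.toNat : ℤ) + 1, coeff (s - S n.toNat) m = 0 := by
    intro m hm
    rw [coeff_sub, coeff_mk, sub_eq_zero]
    rcases lt_or_ge m 0 with h0 | h0
    · rw [hneg _ _ h0, hneg _ _ h0]
    · exact (hS _ _ (by omega) m (by omega)).symm
  have h1 : ∀ m < 0, coeff (1 - h) m = 0 := by
    intro m hm
    rw [coeff_sub, coeff_one, if_neg hm.ne, hh m (by omega), sub_zero]
  -- By the finite geometric sum, (1 − h)s differs from 1 only by terms of order greater than n.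
  have e : (1 - h) * s = 1 - h ^ (n.toNat + 1) + (1 - h) * (s - S n.toNat) := by
    rw [← mul_neg_geom_sum, mul_sub, add_sub_cancel]
  rw [e, coeff_add, coeff_sub, coeff_pow_eq_zero hh _ n (by push_cast; omega), sub_zero,
    coeff_mul_eq_zero h1 hd (by omega), add_zero]

theorem mul_eq_one_swap {A : Type*} [Ring A] [NoZeroDivisors A] [Nontrivial A] {a b : A}
    (h : a * b = 1) : b * a = 1 := by
  have hb : b ≠ 0 := right_ne_zero_of_mul (h ▸ one_ne_zero)
  have : (b * a - 1) * b = 0 := by rw [sub_mul, mul_assoc, h, mul_one, one_mul, sub_self]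
  exact sub_eq_zero.1 ((mul_eq_zero.1 this).resolve_right hb)

theorem isUnit_of_ne_zero [Nontrivial R] [NoZeroDivisors R] (hR : ∀ a : R, a ≠ 0 → IsUnit a)
    {f : TwistedLaurentSeries σ} (hf : f ≠ 0) : IsUnit f := by
  obtain ⟨a, ha⟩ := hR _ (coeff_ord_ne_zero hf)
  -- Left multiplication by this monomial normalizes f to order 0 and constant coefficient 1. The
  -- power of σ compensates for moving the coefficient past x to the power −`ord f`.
  let g := monomial σ (-ord f) ((σ ^ (-ord f)) ↑a⁻¹) * f
  have hg (n : ℤ) : coeff g n = (σ ^ (-ord f)) (↑a⁻¹ * coeff f (n + ord f)) := by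
    rw [coeff_monomial_mul, sub_neg_eq_add, map_mul]
  obtain ⟨s, hs⟩ := exists_one_sub_mul_eq_one (h := 1 - g) (by
    intro n hn
    rw [coeff_sub, coeff_one, hg]
    rcases (show n < 0 ∨ n = 0 by omega) with h | h
    · rw [if_neg h.ne, coeff_eq_zero_of_lt_ord (by omega), mul_zero, map_zero, sub_zero]
    · rw [if_pos h, h, zero_add, ← ha, Units.inv_mul, map_one, sub_self])
  rw [sub_sub_cancel, mul_assoc] at hs
  have h1 := mul_eq_one_swap hs
  rw [mul_assoc] at h1
  exact ⟨⟨f, _, h1, mul_eq_one_swap h1⟩, rfl⟩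

end TwistedLaurentSeries

/-! ### Twisted polynomials as twisted Laurent series -/

namespace TwistedPolynomial

variable {R : Type*} [Ring R] {σ : RingAut R}

theorem ext {p q : TwistedPolynomial σ} (h : ∀ n, coeff p n = coeff q n) : p = q := by
  have h1 : ∀ n, SkewPolynomial.coeff (R := R) p n = SkewPolynomial.coeff (R := R) q n := h
  exact SkewPolynomial.ext_iff.2 h1

theorem coeff_zero (n : ℕ) : coeff (0 : TwistedPolynomial σ) n = 0 := rfl

theorem coeff_add (p q : TwistedPolynomial σ) (n : ℕ) :
    coeff (p + q) n = coeff p n + coeff q n := by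
  exact SkewPolynomial.coeff_add (R := R) p q n

theorem C_mul_X_pow_eq (a : R) (n : ℕ) :
    C σ a * X σ ^ n = (SkewPolynomial.monomial n a : SkewPolynomial R) := by
  let _ := twistAction σ
  exact SkewPolynomial.C_mul_X_pow_eq_monomial (R := R) (a := a) (n := n)

theorem coeff_C_mul_X_pow (a : R) (m n : ℕ) :
    coeff (C σ a * X σ ^ m) n = if n = m then a else 0 := by
  rw [C_mul_X_pow_eq]
  change SkewPolynomial.coeff (SkewPolynomial.monomial m a : SkewPolynomial R) n = _
  rw [SkewPolynomial.coeff_monomial]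
  simp only [eq_comm]

theorem induction {motive : TwistedPolynomial σ → Prop} (p : TwistedPolynomial σ)
    (add : ∀ p q, motive p → motive q → motive (p + q))
    (mono : ∀ a n, motive (C σ a * X σ ^ n)) : motive p := by
  refine SkewPolynomial.induction (R := R) p ?_ ?_
  · have h := mono 0 0
    rwa [map_zero, zero_mul] at h
  · intro n r q _ _ hq
    have h := mono r n
    rw [C_mul_X_pow_eq] at h
    exact add _ _ h hq

/-- The inclusion of the twisted polynomials in the twisted Laurent series. -/
def toLaurent (σ : RingAut R) : TwistedPolynomial σ →+* TwistedLaurentSeries σ :=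
  letI := twistAction σ
  SkewMonoidAlgebra.liftNCRingHom (k := R) (G := Multiplicative ℕ)
    { toFun := TwistedLaurentSeries.monomial σ 0
      map_one' := rfl
      map_zero' := TwistedLaurentSeries.monomial_zero 0
      map_add' := TwistedLaurentSeries.monomial_add 0
      map_mul' := fun a b ↦ by
        rw [TwistedLaurentSeries.monomial_mul_monomial, zpow_zero, add_zero]; rfl }
    (powersHom _ (TwistedLaurentSeries.monomial σ 1 1)) (by
      intro x y
      have h : y • x = (σ ^ (Multiplicative.toAdd y)) x := by
        change (powersHom (RingAut R) σ y) • x = _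
        rw [powersHom_apply]; rfl
      rw [powersHom_apply, TwistedLaurentSeries.monomial_pow, h]
      change TwistedLaurentSeries.monomial σ 0 _ * _ = _ * TwistedLaurentSeries.monomial σ 0 x
      rw [TwistedLaurentSeries.monomial_mul_monomial, TwistedLaurentSeries.monomial_mul_monomial,
        map_one, mul_one, one_mul, zero_add, add_zero]
      rfl)

theorem toLaurent_C (a : R) : toLaurent σ (C σ a) = TwistedLaurentSeries.monomial σ 0 a := by
  let _ := twistAction σ
  refine (SkewMonoidAlgebra.liftNC_single (k := R) (G := Multiplicative ℕ) _ _ 1 a).trans ?_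
  change TwistedLaurentSeries.monomial σ 0 a *
    (powersHom _ (TwistedLaurentSeries.monomial σ 1 1) 1) = _
  rw [map_one, mul_one]

theorem toLaurent_X : toLaurent σ (X σ) = TwistedLaurentSeries.monomial σ 1 1 := by
  let _ := twistAction σ
  refine (SkewMonoidAlgebra.liftNC_single (k := R) (G := Multiplicative ℕ) _ _
    (Multiplicative.ofAdd 1) 1).trans ?_
  change TwistedLaurentSeries.monomial σ 0 1 *
    (powersHom _ (TwistedLaurentSeries.monomial σ 1 1) (Multiplicative.ofAdd 1)) = _
  rw [TwistedLaurentSeries.monomial_zero_one, one_mul, powersHom_apply]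
  exact pow_one _

theorem toLaurent_C_mul_X_pow (a : R) (n : ℕ) :
    toLaurent σ (C σ a * X σ ^ n) = TwistedLaurentSeries.monomial σ n a := by
  rw [map_mul, map_pow, toLaurent_C, toLaurent_X, TwistedLaurentSeries.monomial_pow,
    TwistedLaurentSeries.monomial_mul_monomial, zpow_zero, zero_add, map_one, mul_one]

theorem coeff_toLaurent (p : TwistedPolynomial σ) (n : ℤ) :
    TwistedLaurentSeries.coeff (toLaurent σ p) n = if 0 ≤ n then coeff p n.toNat else 0 := by
  induction p using induction with
  | add p q hp hq =>
    rw [map_add, TwistedLaurentSeries.coeff_add, hp, hq, coeff_add]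
    split_ifs <;> simp
  | mono a m =>
    rw [toLaurent_C_mul_X_pow, TwistedLaurentSeries.coeff_monomial, coeff_C_mul_X_pow]
    by_cases h : n = m
    · rw [if_pos h, if_pos (by omega), if_pos (by omega)]
    · rw [if_neg h]
      by_cases h1 : 0 ≤ n
      · rw [if_pos h1, if_neg (by omega)]
      · rw [if_neg h1]

theorem coeff_toLaurent_natCast (p : TwistedPolynomial σ) (n : ℕ) :
    TwistedLaurentSeries.coeff (toLaurent σ p) n = coeff p n := by
  rw [coeff_toLaurent, if_pos (by omega), Int.toNat_natCast]

theorem toLaurent_injective : Function.Injective (toLaurent σ) := fun p q h ↦ ext fun n ↦ by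
  rw [← coeff_toLaurent_natCast, h, coeff_toLaurent_natCast]

instance [Nontrivial R] : Nontrivial (TwistedPolynomial σ) := (toLaurent σ).domain_nontrivial

instance [NoZeroDivisors R] : NoZeroDivisors (TwistedPolynomial σ) :=
  toLaurent_injective.noZeroDivisors (toLaurent σ) (map_zero _) (map_mul _)

theorem coeff_C_mul (a : R) (p : TwistedPolynomial σ) (n : ℕ) :
    coeff (C σ a * p) n = a * coeff p n := by
  rw [← coeff_toLaurent_natCast, map_mul, toLaurent_C, TwistedLaurentSeries.coeff_monomial_mul,
    sub_zero, coeff_toLaurent_natCast, zpow_zero]; rfl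

theorem coeff_mul_C (a : R) (p : TwistedPolynomial σ) (n : ℕ) :
    coeff (p * C σ a) n = coeff p n * (σ ^ n) a := by
  rw [← coeff_toLaurent_natCast, map_mul, toLaurent_C, TwistedLaurentSeries.coeff_mul_monomial,
    sub_zero, coeff_toLaurent_natCast, zpow_natCast]

theorem coeff_X_mul (p : TwistedPolynomial σ) (n : ℕ) :
    coeff (X σ * p) (n + 1) = σ (coeff p n) := by
  rw [← coeff_toLaurent_natCast, map_mul, toLaurent_X, TwistedLaurentSeries.coeff_monomial_mul,
    one_mul, zpow_one, Nat.cast_add, Nat.cast_one, add_sub_cancel_right, coeff_toLaurent_natCast]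

theorem coeff_mul_X (p : TwistedPolynomial σ) (n : ℕ) :
    coeff (p * X σ) (n + 1) = coeff p n := by
  rw [← coeff_toLaurent_natCast, map_mul, toLaurent_X, TwistedLaurentSeries.coeff_mul_monomial,
    map_one, mul_one, Nat.cast_add, Nat.cast_one, add_sub_cancel_right, coeff_toLaurent_natCast]

theorem X_pow_mul_C (a : R) (n : ℕ) : X σ ^ n * C σ a = C σ ((σ ^ n) a) * X σ ^ n := by
  induction n generalizing a with
  | zero => simp
  | succ n ih => rw [pow_succ, mul_assoc, X_mul_C, ← mul_assoc, ih, mul_assoc, pow_succ]; rfl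

theorem ne_zero_of_coeff {p : TwistedPolynomial σ} (hp : p ≠ 0) : ∃ n, coeff p n ≠ 0 := by
  by_contra! h
  exact hp (ext h)

theorem xAdic_toLaurent (δ : ℝ≥0) {p : TwistedPolynomial σ} (hp : p ≠ 0) :
    TwistedLaurentSeries.xAdic δ (toLaurent σ p) = δ ^ sInf {n : ℕ | p.coeff n ≠ 0} := by
  have h0 : toLaurent σ p ≠ 0 := (map_ne_zero_iff _ toLaurent_injective).2 hp
  rw [TwistedLaurentSeries.xAdic_of_ne h0, ← zpow_natCast]
  congr 1
  have hs : (sInf {n : ℕ | p.coeff n ≠ 0}) ∈ {n : ℕ | p.coeff n ≠ 0} :=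
    Nat.sInf_mem (ne_zero_of_coeff hp)
  refine TwistedLaurentSeries.ord_eq (fun n hn ↦ ?_) ?_
  · rw [coeff_toLaurent]
    split_ifs with h
    · by_contra hc
      have := Nat.sInf_le (s := {n : ℕ | p.coeff n ≠ 0}) hc
      omega
    · rfl
  · rw [coeff_toLaurent_natCast]; exact hs

end TwistedPolynomial

/-! ### The twisted function field in the twisted Laurent series -/

namespace TwistedFunctionField

variable {R : Type*} [Ring R] {σ : RingAut R}
  [OreLocalization.OreSet (nonZeroDivisors (TwistedPolynomial σ))]

/-- The inclusion of the twisted polynomial ring, as a ring homomorphism. -/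
def ofPolyHom (σ : RingAut R) [OreLocalization.OreSet (nonZeroDivisors (TwistedPolynomial σ))] :
    TwistedPolynomial σ →+* TwistedFunctionField σ where
  toFun := ofPoly σ
  map_one' := map_one _
  map_mul' := map_mul _
  map_zero' := OreLocalization.zero_def.symm
  map_add' _ _ := (OreLocalization.add_oreDiv (s := (1 : nonZeroDivisors (TwistedPolynomial σ)))).symm

theorem ofPolyHom_injective : Function.Injective (ofPolyHom σ) :=
  OreLocalization.numeratorHom_inj inf_le_left

theorem ofPolyHom_ne_zero {p : TwistedPolynomial σ} (hp : p ≠ 0) : ofPolyHom σ p ≠ 0 :=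
  (map_ne_zero_iff _ ofPolyHom_injective).2 hp

theorem exists_mul_eq [Nontrivial R] (q : TwistedFunctionField σ) :
    ∃ s p : TwistedPolynomial σ, s ≠ 0 ∧ ofPolyHom σ s * q = ofPolyHom σ p := by
  induction q using OreLocalization.ind with
  | _ p s =>
    refine ⟨s, p, nonZeroDivisors.coe_ne_zero s, ?_⟩
    change (OreLocalization.numeratorHom (s : TwistedPolynomial σ)) * _ = OreLocalization.numeratorHom p
    exact OreLocalization.mul_cancel

variable [Nontrivial R] [NoZeroDivisors R]

/-- The homomorphism `R(x, σ) → R((x, σ))` for a division ring `R`. -/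
def toLaurent (hR : ∀ a : R, a ≠ 0 → IsUnit a) :
    TwistedFunctionField σ →+* TwistedLaurentSeries σ :=
  OreLocalization.universalHom (TwistedPolynomial.toLaurent σ)
    (IsUnit.liftRight ((TwistedPolynomial.toLaurent σ : _ →* TwistedLaurentSeries σ).comp
      (nonZeroDivisors (TwistedPolynomial σ)).subtype) fun s ↦
        TwistedLaurentSeries.isUnit_of_ne_zero hR
          ((map_ne_zero_iff _ TwistedPolynomial.toLaurent_injective).2
            (nonZeroDivisors.coe_ne_zero s)))
    fun _ ↦ rfl

theorem toLaurent_ofPoly (hR : ∀ a : R, a ≠ 0 → IsUnit a) (p : TwistedPolynomial σ) :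
    toLaurent hR (ofPoly σ p) = TwistedPolynomial.toLaurent σ p :=
  OreLocalization.universalHom_commutes ..

theorem toLaurent_C (hR : ∀ a : R, a ≠ 0 → IsUnit a) (a : R) :
    toLaurent hR (C σ a) = TwistedLaurentSeries.monomial σ 0 a :=
  (toLaurent_ofPoly hR _).trans (TwistedPolynomial.toLaurent_C a)

theorem toLaurent_X (hR : ∀ a : R, a ≠ 0 → IsUnit a) :
    toLaurent hR (X σ) = TwistedLaurentSeries.monomial σ 1 1 :=
  (toLaurent_ofPoly hR _).trans TwistedPolynomial.toLaurent_X

end TwistedFunctionField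

/-! ### Twisted polynomials for an automorphism whose cube is inner -/

/-- The unit `d` is fixed by `σ` and induces `σ³`. -/
structure InducesCube {R : Type*} [Ring R] (σ : RingAut R) (d : Rˣ) : Prop where
  cube : ∀ a, σ (σ (σ a)) = d * a * ↑d⁻¹
  fixed : σ d = d

namespace InducesCube

variable {R : Type*} [Ring R] {σ : RingAut R} {d : Rˣ}

theorem fixed_inv (h : InducesCube σ d) : σ (↑d⁻¹ : R) = ↑d⁻¹ := by
  have h1 : Units.map (σ : R →* R) d = d := Units.ext h.fixed
  have h2 : Units.map (σ : R →* R) d⁻¹ = d⁻¹ := by rw [map_inv, h1]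
  exact congrArg Units.val h2

theorem pow_fixed_inv_pow (h : InducesCube σ d) (n k : ℕ) :
    (σ ^ n) ((↑d⁻¹ : R) ^ k) = (↑d⁻¹ : R) ^ k := by
  induction n with
  | zero => rfl
  | succ n ih => rw [pow_succ, RingAut.mul_apply, map_pow, h.fixed_inv, ih]

theorem pow_three_mul (h : InducesCube σ d) (k : ℕ) (a : R) :
    (σ ^ (3 * k)) a = (d : R) ^ k * a * (↑d⁻¹ : R) ^ k := by
  induction k generalizing a with
  | zero => simp
  | succ k ih =>
    have e : (σ ^ (3 * (k + 1))) a = (σ ^ (3 * k)) (σ (σ (σ a))) := by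
      rw [show 3 * (k + 1) = 3 * k + 3 by ring, pow_add]; rfl
    rw [e, ih, h.cube, pow_succ, pow_succ']
    simp only [mul_assoc]

end InducesCube

namespace TwistedPolynomial

variable {R : Type*} [Ring R] {σ : RingAut R} {d : Rˣ}

/-- The element `t = d⁻¹ x³`. -/
def t (σ : RingAut R) (d : Rˣ) : TwistedPolynomial σ := C σ ↑d⁻¹ * X σ ^ 3

/-- Conjugation by x³ is σ³ on R, which is conjugation by d, so d⁻¹x³ commutes with constants; it
commutes with x because σ(d) = d. -/
theorem t_comm (h : InducesCube σ d) (p : TwistedPolynomial σ) : t σ d * p = p * t σ d := by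
  have hX : t σ d * X σ = X σ * t σ d := by
    rw [t, ← mul_assoc, X_mul_C, h.fixed_inv, mul_assoc, mul_assoc, ← pow_succ, ← pow_succ']
  have hC (a : R) : t σ d * C σ a = C σ a * t σ d := by
    have e : (σ ^ 3) a = d * a * ↑d⁻¹ := h.cube a
    rw [t, mul_assoc, X_pow_mul_C, e, ← mul_assoc, ← mul_assoc, ← map_mul, ← map_mul, mul_assoc,
      Units.inv_mul_cancel_left]
  induction p using induction with
  | add p q hp hq => rw [mul_add, add_mul, hp, hq]
  | mono a n =>
    have hn : Commute (t σ d) (X σ ^ n) := Commute.pow_right hX n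
    rw [← mul_assoc, hC, mul_assoc, hn.eq, mul_assoc]

theorem t_pow (h : InducesCube σ d) (k : ℕ) : t σ d ^ k = C σ ((↑d⁻¹ : R) ^ k) * X σ ^ (3 * k) := by
  induction k with
  | zero => simp
  | succ k ih =>
    have h1 := h.pow_fixed_inv_pow (3 * k) 1
    rw [pow_one] at h1
    rw [pow_succ, ih, t, mul_assoc, ← mul_assoc (X σ ^ (3 * k)), X_pow_mul_C, h1,
      ← mul_assoc, ← mul_assoc, ← map_mul, mul_assoc, ← pow_add, ← pow_succ]
    rfl

variable [Algebra ℚ R]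

theorem C_qsmul_comm (q : ℚ) (p : TwistedPolynomial σ) :
    C σ (algebraMap ℚ R q) * p = p * C σ (algebraMap ℚ R q) := by
  have hs (n : ℕ) : (σ ^ n) (algebraMap ℚ R q) = algebraMap ℚ R q :=
    DFunLike.congr_fun (RingHom.ext_rat (((σ ^ n : RingAut R) : R →+* R).comp (algebraMap ℚ R))
      (algebraMap ℚ R)) q
  refine ext fun n ↦ ?_
  rw [coeff_C_mul, coeff_mul_C, hs, Algebra.commutes]

/-- The homomorphism `ℚ[t] → R[x, σ]`. -/
def ofT (_h : InducesCube σ d) : ℚ[X] →+* TwistedPolynomial σ :=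
  Polynomial.eval₂RingHom' ((C σ).comp (algebraMap ℚ R)) (t σ d) fun q ↦ C_qsmul_comm q _

theorem ofT_monomial (h : InducesCube σ d) (k : ℕ) (q : ℚ) :
    ofT h (Polynomial.monomial k q) = C σ (q • (↑d⁻¹ : R) ^ k) * X σ ^ (3 * k) := by
  change Polynomial.eval₂ _ _ _ = _
  rw [Polynomial.eval₂_monomial, t_pow h, Algebra.smul_def, map_mul, mul_assoc]
  rfl

theorem ofT_X (h : InducesCube σ d) : ofT h Polynomial.X = t σ d := by
  change Polynomial.eval₂ _ _ _ = _
  rw [Polynomial.eval₂_X]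

theorem ofT_comm (h : InducesCube σ d) (c : ℚ[X]) (p : TwistedPolynomial σ) :
    ofT h c * p = p * ofT h c := by
  induction c using Polynomial.induction_on' with
  | add a b ha hb => rw [map_add, add_mul, mul_add, ha, hb]
  | monomial k q =>
    change Polynomial.eval₂ _ _ _ * p = p * Polynomial.eval₂ _ _ _
    rw [Polynomial.eval₂_monomial]
    have h1 : Commute (C σ (algebraMap ℚ R q)) p := C_qsmul_comm q p
    have h2 : Commute (t σ d ^ k) p := Commute.pow_left (t_comm h p) k
    exact (h1.mul_left h2).eq

/-- The coefficients of `p(t) a xⁱ`. -/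
theorem coeff_ofT_mul (h : InducesCube σ d) (c : ℚ[X]) (a : R) (i j : Fin 3) (k : ℕ) :
    coeff (ofT h c * (C σ a * X σ ^ (i : ℕ))) (3 * k + j) =
      if i = j then c.coeff k • (a * (↑d⁻¹ : R) ^ k) else 0 := by
  induction c using Polynomial.induction_on' with
  | add p q hp hq =>
    rw [map_add, add_mul, coeff_add, hp, hq, Polynomial.coeff_add]
    split_ifs
    · rw [add_smul]
    · rw [add_zero]
  | monomial m q =>
    have e : (C σ a * X σ ^ (i : ℕ)) * (C σ (q • (↑d⁻¹ : R) ^ m) * X σ ^ (3 * m)) =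
        C σ (q • (a * (↑d⁻¹ : R) ^ m)) * X σ ^ (3 * m + i) := by
      have hs : (σ ^ (i : ℕ)) (q • (↑d⁻¹ : R) ^ m) = q • (↑d⁻¹ : R) ^ m := by
        rw [map_rat_smul, h.pow_fixed_inv_pow]
      rw [mul_assoc, ← mul_assoc (X σ ^ (i : ℕ)), X_pow_mul_C, hs, ← mul_assoc, ← mul_assoc,
        ← map_mul, mul_smul_comm, mul_assoc, ← pow_add, add_comm (i : ℕ)]
    rw [ofT_comm, ofT_monomial, e, coeff_C_mul_X_pow, Polynomial.coeff_monomial]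
    have hi := i.2
    have hj := j.2
    by_cases hij : i = j
    · subst hij
      rw [if_pos rfl]
      by_cases hk : m = k
      · subst hk; simp
      · rw [if_neg (by omega), if_neg hk, zero_smul]
    · have : (i : ℕ) ≠ j := fun h ↦ hij (Fin.ext h)
      rw [if_neg (by omega), if_neg hij]

theorem ofT_injective [Nontrivial R] (h : InducesCube σ d) : Function.Injective (ofT h) := by
  rw [injective_iff_map_eq_zero]
  intro c hc
  ext k
  have h1 := coeff_ofT_mul h c 1 0 0 k
  rw [hc, zero_mul, coeff_zero, if_pos rfl, one_mul, eq_comm, ← Units.val_pow_eq_pow_val] at h1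
  by_contra h0
  rw [Polynomial.coeff_zero] at h0
  have h2 := congrArg ((c.coeff k)⁻¹ • ·) h1
  simp only [smul_smul, inv_mul_cancel₀ h0, one_smul, smul_zero] at h2
  exact Units.ne_zero _ h2

/-- `R[x, σ]` as an algebra over `ℚ[t]`. -/
@[reducible] def algebraT (h : InducesCube σ d) : Algebra ℚ[X] (TwistedPolynomial σ) :=
  (ofT h).toAlgebra' (ofT_comm h)

variable {ι : Type*} [Fintype ι] (b : Module.Basis ι ℚ R)

/-- From x³ᵏ = dᵏtᵏ one gets a x³ᵏ⁺ⁱ = tᵏ (a dᵏ) xⁱ, and a dᵏ is expanded in the basis of R. -/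
theorem sum_ofT_mul_eq (h : InducesCube σ d) (a : R) (i : Fin 3) (k : ℕ) :
    ∑ j, ofT h (Polynomial.monomial k (b.repr (a * (d : R) ^ k) j)) * (C σ (b j) * X σ ^ (i : ℕ)) =
      C σ a * X σ ^ (3 * k + i) := by
  refine ext fun n ↦ ?_
  have hsum (f : ι → TwistedPolynomial σ) (n : ℕ) : coeff (∑ j, f j) n = ∑ j, coeff (f j) n :=
    map_sum (⟨⟨fun p ↦ coeff p n, rfl⟩, fun _ _ ↦ coeff_add _ _ _⟩ : TwistedPolynomial σ →+ R) f _
  obtain ⟨m, l, rfl⟩ : ∃ (m : ℕ) (l : Fin 3), n = 3 * m + l :=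
    ⟨n / 3, ⟨n % 3, Nat.mod_lt _ (by norm_num)⟩, (Nat.div_add_mod n 3).symm⟩
  have hi := i.2
  have hl := l.2
  rw [hsum, coeff_C_mul_X_pow]
  simp only [coeff_ofT_mul, Polynomial.coeff_monomial]
  by_cases hil : i = l
  · subst hil
    by_cases hk : k = m
    · subst hk
      simp only [if_true, ← smul_mul_assoc, ← Finset.sum_mul, b.sum_repr, mul_assoc]
      rw [← Units.val_pow_eq_pow_val, ← Units.val_pow_eq_pow_val, inv_pow, Units.mul_inv, mul_one]
    · simp only [if_true, if_neg hk, zero_smul, Finset.sum_const_zero]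
      rw [if_neg (by omega)]
  · have : (i : ℕ) ≠ l := fun h ↦ hil (Fin.ext h)
    simp only [if_neg hil, Finset.sum_const_zero]
    rw [if_neg (by omega)]

theorem exists_eq_sum (h : InducesCube σ d) (p : TwistedPolynomial σ) :
    ∃ c : ι × Fin 3 → ℚ[X], p = ∑ ji, ofT h (c ji) * (C σ (b ji.1) * X σ ^ (ji.2 : ℕ)) := by
  induction p using induction with
  | add p q hp hq =>
    obtain ⟨c, hc⟩ := hp
    obtain ⟨e, he⟩ := hq
    refine ⟨c + e, ?_⟩
    simp only [Pi.add_apply, map_add, add_mul, Finset.sum_add_distrib, ← hc, ← he]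
  | mono a n =>
    obtain ⟨m, l, rfl⟩ : ∃ (m : ℕ) (l : Fin 3), n = 3 * m + l :=
      ⟨n / 3, ⟨n % 3, Nat.mod_lt _ (by norm_num)⟩, (Nat.div_add_mod n 3).symm⟩
    refine ⟨fun ji ↦ if ji.2 = l then Polynomial.monomial m (b.repr (a * (d : R) ^ m) ji.1) else 0,
      ?_⟩
    rw [← sum_ofT_mul_eq b h, Fintype.sum_prod_type]
    refine Finset.sum_congr rfl fun j _ ↦ ?_
    rw [Finset.sum_eq_single l]
    · simp
    · intro i _ hi
      simp [hi]
    · simp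

/-- The exponents 3k + i with 0 ≤ i < 3 separate the powers of t and x, and the unit d⁻ᵏ cancels.
Thus the products of basis elements of R with 1, x, x² form a basis of R[x, σ] over ℚ[t]. -/
theorem coeff_eq_zero_of_sum_eq_zero (h : InducesCube σ d) {c : ι × Fin 3 → ℚ[X]}
    (hc : ∑ ji, ofT h (c ji) * (C σ (b ji.1) * X σ ^ (ji.2 : ℕ)) = 0) : c = 0 := by
  have hsum (f : ι × Fin 3 → TwistedPolynomial σ) (n : ℕ) :
      coeff (∑ j, f j) n = ∑ j, coeff (f j) n :=
    map_sum (⟨⟨fun p ↦ coeff p n, rfl⟩, fun _ _ ↦ coeff_add _ _ _⟩ : TwistedPolynomial σ →+ R) f _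
  ext ⟨j, i⟩ k
  have h1 := congrArg (fun p ↦ coeff p (3 * k + i)) hc
  simp only [hsum, coeff_zero, coeff_ofT_mul] at h1
  simp only [Fintype.sum_prod_type, Finset.sum_ite_eq', Finset.mem_univ, if_true,
    ← smul_mul_assoc, ← Finset.sum_mul] at h1
  rw [← Units.val_pow_eq_pow_val, Units.mul_left_eq_zero] at h1
  exact Fintype.linearIndependent_iff.1 b.linearIndependent _ h1 j

include b in
/-- Every nonzero twisted polynomial divides a nonzero polynomial in `t`. -/
theorem exists_mul_eq_ofT [Nontrivial R] [NoZeroDivisors R] (h : InducesCube σ d)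
    {s : TwistedPolynomial σ} (hs : s ≠ 0) : ∃ c : ℚ[X], c ≠ 0 ∧ ∃ r, s * r = ofT h c := by
  let _ := algebraT h
  have halg (c : ℚ[X]) : algebraMap ℚ[X] (TwistedPolynomial σ) c = ofT h c := rfl
  -- Finiteness over the central subring ℚ[t] makes s integral over it.
  have : Module.Finite ℚ[X] (TwistedPolynomial σ) := by
    classical
    refine ⟨⟨Finset.univ.image fun ji : ι × Fin 3 ↦ C σ (b ji.1) * X σ ^ (ji.2 : ℕ), ?_⟩⟩
    rw [eq_top_iff]
    intro p _
    obtain ⟨c, rfl⟩ := exists_eq_sum b h p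
    refine Submodule.sum_mem _ fun ji _ ↦ ?_
    rw [← halg, ← Algebra.smul_def]
    exact Submodule.smul_mem _ _ (Submodule.subset_span (by simp))
  obtain ⟨p, hp, hp0⟩ := Algebra.IsIntegral.isIntegral (R := ℚ[X]) s
  -- The constant term of a polynomial relation for s is a right multiple of s. A vanishing constant
  -- term is removed by cancelling one factor s, which lowers the degree.
  have key : ∀ n, ∀ p : (ℚ[X])[X], p.natDegree = n → p ≠ 0 →
      Polynomial.eval₂ (algebraMap ℚ[X] (TwistedPolynomial σ)) s p = 0 →
      ∃ c : ℚ[X], c ≠ 0 ∧ ∃ r, s * r = ofT h c := by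
    intro n
    induction n using Nat.strong_induction_on with
    | _ n ih =>
      intro p hn hp h0
      have e : s * Polynomial.aeval s p.divX = -ofT h (p.coeff 0) := by
        rw [eq_neg_iff_add_eq_zero, ← halg, ← h0]
        have := congrArg (Polynomial.aeval s) (Polynomial.X_mul_divX_add p)
        simp only [map_add, map_mul, Polynomial.aeval_X, Polynomial.aeval_C] at this
        exact this
      by_cases hc : p.coeff 0 = 0
      · rw [hc, map_zero, neg_zero, mul_eq_zero, or_iff_right hs] at e
        have hd0 : p.divX ≠ 0 := by
          intro h1
          have := Polynomial.X_mul_divX_add p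
          rw [h1, hc, map_zero, mul_zero, add_zero] at this
          exact hp this.symm
        have hpos : 0 < p.natDegree := by
          by_contra hpos
          have h2 := Polynomial.eq_C_of_natDegree_le_zero (not_lt.1 hpos)
          rw [hc, map_zero] at h2
          exact hp h2
        refine ih _ ?_ p.divX rfl hd0 e
        rw [Polynomial.natDegree_divX_eq_natDegree_tsub_one]
        omega
      · exact ⟨-p.coeff 0, neg_ne_zero.2 hc, _, by rw [e, map_neg]⟩
  exact key _ p rfl hp.ne_zero hp0

-- For given r and s, choose q with sq = qs = c a nonzero polynomial in t. As c is central, (rq)s =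
-- rc = cr, which is the Ore condition.
include b in
theorem nonempty_oreSet [Nontrivial R] [NoZeroDivisors R] (h : InducesCube σ d) :
    Nonempty (OreLocalization.OreSet (nonZeroDivisors (TwistedPolynomial σ))) := by
  rw [OreLocalization.nonempty_oreSet_iff_of_noZeroDivisors]
  intro r s
  obtain ⟨c, hc, q, hq⟩ := exists_mul_eq_ofT b h (nonZeroDivisors.coe_ne_zero s)
  refine ⟨r * q, ⟨ofT h c, mem_nonZeroDivisors_of_ne_zero
    ((map_ne_zero_iff _ (ofT_injective h)).2 hc)⟩, ?_⟩
  have hq' : q * s = ofT h c := by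
    have h1 : (s : TwistedPolynomial σ) * (q * s) = s * ofT h c := by
      rw [← mul_assoc, hq, ofT_comm]
    exact mul_left_cancel₀ (nonZeroDivisors.coe_ne_zero s) h1
  rw [ofT_comm, ← hq', mul_assoc]

end TwistedPolynomial

/-! ### The twisted function field as an algebra over `ℚ(t)` -/

namespace TwistedFunctionField

variable {R : Type*} [Ring R] [Nontrivial R] [NoZeroDivisors R] [Algebra ℚ R] {σ : RingAut R}
  {d : Rˣ} [OreLocalization.OreSet (nonZeroDivisors (TwistedPolynomial σ))]

theorem ofT_mem_center (h : InducesCube σ d) (c : ℚ[X]) :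
    ofPolyHom σ (TwistedPolynomial.ofT h c) ∈ Subring.center (TwistedFunctionField σ) := by
  rw [Subring.mem_center_iff]
  intro q
  obtain ⟨s, p, hs, hq⟩ := exists_mul_eq q
  refine mul_left_cancel₀ (ofPolyHom_ne_zero hs) ?_
  rw [← mul_assoc, hq, ← mul_assoc, ← map_mul, ← map_mul, ← TwistedPolynomial.ofT_comm h c s,
    ← TwistedPolynomial.ofT_comm h c p, map_mul, map_mul, mul_assoc, hq]

/-- The homomorphism from `ℚ[t]` to the centre. -/
def ofTCenter (h : InducesCube σ d) : ℚ[X] →+* Subring.center (TwistedFunctionField σ) :=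
  ((ofPolyHom σ).comp (TwistedPolynomial.ofT h)).codRestrict _ (ofT_mem_center h)

theorem ofTCenter_injective (h : InducesCube σ d) : Function.Injective (ofTCenter h) := by
  intro a b hab
  exact TwistedPolynomial.ofT_injective h (ofPolyHom_injective (congrArg Subtype.val hab))

/-- The homomorphism from `ℚ(t)` to the centre. -/
def ofRatFunc (h : InducesCube σ d) : RatFunc ℚ →+* Subring.center (TwistedFunctionField σ) :=
  IsFractionRing.lift (A := ℚ[X]) (ofTCenter_injective h)

/-- `R(x, σ)` as an algebra over `ℚ(t)`. -/
@[reducible] def algebraRatFunc (h : InducesCube σ d) :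
    Algebra (RatFunc ℚ) (TwistedFunctionField σ) :=
  ((Subring.center (TwistedFunctionField σ)).subtype.comp (ofRatFunc h)).toAlgebra' fun c x ↦
    (Subring.mem_center_iff.1 (ofRatFunc h c).2 x).symm

theorem algebraMap_algebraMap (h : InducesCube σ d) (c : ℚ[X]) :
    letI := algebraRatFunc h
    algebraMap (RatFunc ℚ) (TwistedFunctionField σ) (algebraMap ℚ[X] (RatFunc ℚ) c) =
      ofPolyHom σ (TwistedPolynomial.ofT h c) :=
  congrArg Subtype.val (IsFractionRing.lift_algebraMap (ofTCenter_injective h) c)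

theorem algebraMap_X (h : InducesCube σ d) :
    letI := algebraRatFunc h
    algebraMap (RatFunc ℚ) (TwistedFunctionField σ) RatFunc.X = C σ ↑d⁻¹ * X σ ^ 3 := by
  have h1 := algebraMap_algebraMap h Polynomial.X
  rw [RatFunc.algebraMap_X] at h1
  rw [h1, TwistedPolynomial.ofT_X, TwistedPolynomial.t, map_mul, map_pow]
  rfl

variable {ι : Type*} [Fintype ι] (b : Module.Basis ι ℚ R)

-- A nonzero left denominator s divides some nonzero c in ℚ[t], so every fraction has a central
-- denominator. This reduces questions over ℚ(t) to twisted polynomials over ℚ[t].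
include b in
theorem exists_ofT_mul_eq (h : InducesCube σ d) (q : TwistedFunctionField σ) :
    ∃ (c : ℚ[X]) (p : TwistedPolynomial σ), c ≠ 0 ∧
      ofPolyHom σ (TwistedPolynomial.ofT h c) * q = ofPolyHom σ p := by
  obtain ⟨s, p, hs, hq⟩ := exists_mul_eq q
  obtain ⟨c, hc, r, hr⟩ := TwistedPolynomial.exists_mul_eq_ofT b h hs
  refine ⟨c, r * p, hc, ?_⟩
  have hr' : r * s = TwistedPolynomial.ofT h c := by
    have h1 : s * (r * s) = s * TwistedPolynomial.ofT h c := by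
      rw [← mul_assoc, hr, TwistedPolynomial.ofT_comm]
    exact mul_left_cancel₀ hs h1
  rw [← hr', map_mul, mul_assoc, hq, map_mul]

/-- The family `e_j xⁱ`, where `e_j` is a basis of `R` over `ℚ` and `0 ≤ i < 3`. -/
def family (σ : RingAut R) [OreLocalization.OreSet (nonZeroDivisors (TwistedPolynomial σ))]
    (ji : ι × Fin 3) : TwistedFunctionField σ :=
  ofPolyHom σ (TwistedPolynomial.C σ (b ji.1) * TwistedPolynomial.X σ ^ (ji.2 : ℕ))

theorem linearIndependent_family (h : InducesCube σ d) :
    letI := algebraRatFunc h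
    LinearIndependent (RatFunc ℚ) (family b σ) := by
  let _ := algebraRatFunc h
  rw [Fintype.linearIndependent_iff]
  intro g hg
  obtain ⟨m, hm⟩ := IsLocalization.exist_integer_multiples_of_finite (nonZeroDivisors ℚ[X]) g
  choose c hc using hm
  have hc' (ji) : algebraMap ℚ[X] (RatFunc ℚ) (c ji) =
      algebraMap ℚ[X] (RatFunc ℚ) m * g ji := by rw [hc]; exact Algebra.smul_def _ _
  have h0 : c = 0 := by
    refine TwistedPolynomial.coeff_eq_zero_of_sum_eq_zero b h (ofPolyHom_injective ?_)
    rw [map_sum, map_zero]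
    have h1 := congrArg (algebraMap (RatFunc ℚ) (TwistedFunctionField σ)
      (algebraMap ℚ[X] (RatFunc ℚ) m) * ·) hg
    simp only [mul_zero, Finset.mul_sum] at h1
    refine (Finset.sum_congr rfl fun ji _ ↦ ?_).trans h1
    rw [Algebra.smul_def, ← mul_assoc (algebraMap (RatFunc ℚ) _ _), ← map_mul, ← hc',
      algebraMap_algebraMap h, map_mul]
    rfl
  intro ji
  have h2 := hc' ji
  rw [h0, Pi.zero_apply, map_zero, eq_comm, mul_eq_zero] at h2
  refine h2.resolve_left ?_
  exact (map_ne_zero_iff _ (IsFractionRing.injective ℚ[X] (RatFunc ℚ))).2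
    (nonZeroDivisors.coe_ne_zero m)

theorem span_family (h : InducesCube σ d) :
    letI := algebraRatFunc h
    ⊤ ≤ Submodule.span (RatFunc ℚ) (Set.range (family b σ)) := by
  let _ := algebraRatFunc h
  intro q _
  obtain ⟨c, p, hc, hq⟩ := exists_ofT_mul_eq b h q
  have hc0 : algebraMap ℚ[X] (RatFunc ℚ) c ≠ 0 :=
    (map_ne_zero_iff _ (IsFractionRing.injective ℚ[X] (RatFunc ℚ))).2 hc
  have hq' : q = (algebraMap ℚ[X] (RatFunc ℚ) c)⁻¹ • ofPolyHom σ p := by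
    rw [← hq, ← algebraMap_algebraMap h, ← Algebra.smul_def, smul_smul, inv_mul_cancel₀ hc0,
      one_smul]
  rw [hq']
  refine Submodule.smul_mem _ _ ?_
  obtain ⟨e, rfl⟩ := TwistedPolynomial.exists_eq_sum b h p
  rw [map_sum]
  refine Submodule.sum_mem _ fun ji _ ↦ ?_
  rw [map_mul, ← algebraMap_algebraMap h, ← Algebra.smul_def]
  exact Submodule.smul_mem _ _ (Submodule.subset_span ⟨ji, rfl⟩)

include b in
theorem finite_ratFunc (h : InducesCube σ d) :
    letI := algebraRatFunc h
    Module.Finite (RatFunc ℚ) (TwistedFunctionField σ) := by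
  let _ := algebraRatFunc h
  exact Module.Finite.of_basis
    (Module.Basis.mk (linearIndependent_family b h) (span_family b h))

include b in
theorem finrank_ratFunc (h : InducesCube σ d) :
    letI := algebraRatFunc h
    Module.finrank (RatFunc ℚ) (TwistedFunctionField σ) = Fintype.card ι * 3 := by
  let _ := algebraRatFunc h
  rw [Module.finrank_eq_card_basis
    (Module.Basis.mk (linearIndependent_family b h) (span_family b h)), Fintype.card_prod,
    Fintype.card_fin]

end TwistedFunctionField

/-! ### The centre of the twisted function field -/

namespace TwistedPolynomial

variable {R : Type*} [Ring R] [Algebra ℚ R] {σ : RingAut R} {d : Rˣ}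

/-- The only elements of `R` that induce inverses of powers of `σ` and are fixed by `σ` are
the rational multiples of powers of `d⁻¹`. -/
def OnlyInnerPowers (σ : RingAut R) (d : Rˣ) : Prop :=
  ∀ (n : ℕ) (a : R), a ≠ 0 → (∀ b, a * (σ ^ n) b = b * a) → σ a = a →
    ∃ (k : ℕ) (q : ℚ), n = 3 * k ∧ a = q • (↑d⁻¹ : R) ^ k

/-- Comparing coefficients in pa = ap and px = xp gives pₙσⁿ(a) = apₙ and σ(pₙ) = pₙ. Each nonzero
term of p is then q d⁻ᵏx³ᵏ = q tᵏ. -/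
theorem exists_eq_ofT (h : InducesCube σ d) (hZ : OnlyInnerPowers σ d) {p : TwistedPolynomial σ}
    (hC : ∀ a, p * C σ a = C σ a * p) (hX : p * X σ = X σ * p) : ∃ c : ℚ[X], p = ofT h c := by
  have h1 (n : ℕ) (hn : coeff p n ≠ 0) :
      ∃ (k : ℕ) (q : ℚ), n = 3 * k ∧ coeff p n = q • (↑d⁻¹ : R) ^ k := by
    refine hZ n _ hn (fun b ↦ ?_) ?_
    · rw [← coeff_mul_C, hC, coeff_C_mul]
    · rw [← coeff_X_mul, ← hX, coeff_mul_X]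
  have h2 (n : ℕ) : ∃ c : ℚ[X], C σ (coeff p n) * X σ ^ n = ofT h c := by
    by_cases hn : coeff p n = 0
    · exact ⟨0, by rw [hn, map_zero, map_zero, zero_mul]⟩
    · obtain ⟨k, q, hk, hq⟩ := h1 n hn
      exact ⟨Polynomial.monomial k q, by rw [ofT_monomial, hq, ← hk]⟩
  choose c hc using h2
  have h3 : ∃ N, ∀ n, N ≤ n → coeff p n = 0 := by
    clear hC hX h1 hc c
    induction p using induction with
    | add p q hp hq =>
      obtain ⟨N, hN⟩ := hp
      obtain ⟨M, hM⟩ := hq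
      exact ⟨max N M, fun n hn ↦ by
        rw [coeff_add, hN n ((le_max_left _ _).trans hn), hM n ((le_max_right _ _).trans hn),
          add_zero]⟩
    | mono a m => exact ⟨m + 1, fun n hn ↦ by rw [coeff_C_mul_X_pow, if_neg (by omega)]⟩
  obtain ⟨N, hN⟩ := h3
  refine ⟨∑ n ∈ Finset.range N, c n, ?_⟩
  have hsum (f : ℕ → TwistedPolynomial σ) (n : ℕ) :
      coeff (∑ j ∈ Finset.range N, f j) n = ∑ j ∈ Finset.range N, coeff (f j) n :=
    map_sum (⟨⟨fun p ↦ coeff p n, rfl⟩, fun _ _ ↦ coeff_add _ _ _⟩ : TwistedPolynomial σ →+ R) f _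
  rw [map_sum]
  simp only [← hc]
  refine ext fun n ↦ ?_
  rw [hsum]
  simp only [coeff_C_mul_X_pow, Finset.sum_ite_eq, Finset.mem_range]
  split_ifs with h4
  · rfl
  · exact hN n (not_lt.1 h4)

end TwistedPolynomial

namespace TwistedFunctionField

variable {R : Type*} [Ring R] [Nontrivial R] [NoZeroDivisors R] [Algebra ℚ R] {σ : RingAut R}
  {d : Rˣ} [OreLocalization.OreSet (nonZeroDivisors (TwistedPolynomial σ))]

theorem isCentral_ratFunc [Module.Finite ℚ R] (h : InducesCube σ d)
    (hZ : TwistedPolynomial.OnlyInnerPowers σ d) :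
    letI := algebraRatFunc h
    Algebra.IsCentral (RatFunc ℚ) (TwistedFunctionField σ) := by
  let _ := algebraRatFunc h
  refine ⟨fun q hq ↦ ?_⟩
  rw [Subalgebra.mem_center_iff] at hq
  obtain ⟨c, p, hc, hp⟩ := exists_ofT_mul_eq (Module.finBasis ℚ R) h q
  have hcomm (r : TwistedPolynomial σ) : p * r = r * p := by
    refine ofPolyHom_injective ?_
    rw [map_mul, map_mul, ← hp, mul_assoc, ← hq, ← mul_assoc, ← mul_assoc, ← map_mul,
      TwistedPolynomial.ofT_comm, map_mul]
  obtain ⟨e, rfl⟩ := TwistedPolynomial.exists_eq_ofT h hZ (fun a ↦ hcomm _) (hcomm _)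
  rw [Algebra.mem_bot]
  have hc0 : algebraMap ℚ[X] (RatFunc ℚ) c ≠ 0 :=
    (map_ne_zero_iff _ (IsFractionRing.injective ℚ[X] (RatFunc ℚ))).2 hc
  refine ⟨(algebraMap ℚ[X] (RatFunc ℚ) c)⁻¹ * algebraMap ℚ[X] (RatFunc ℚ) e, ?_⟩
  rw [map_mul, algebraMap_algebraMap h, ← hp, ← algebraMap_algebraMap h, ← mul_assoc, ← map_mul,
    inv_mul_cancel₀ hc0, map_one, one_mul]

end TwistedFunctionField

/-! ### The completion of the twisted function field -/

namespace TwistedLaurentSeries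

variable {R : Type*} [Ring R] {σ : RingAut R}

theorem exists_zpow_lt {δ : ℝ≥0} (h1 : δ < 1) {ε : ℝ≥0} (hε : 0 < ε) :
    ∃ N : ℕ, δ ^ (N : ℤ) < ε := by
  obtain ⟨N, hN⟩ := exists_pow_lt_of_lt_one hε h1
  exact ⟨N, by rwa [zpow_natCast]⟩

/-- For j at least −`ord g` the product xʲg has no negative exponents, and its truncation is a
twisted polynomial. -/
theorem exists_shift_poly (g : TwistedLaurentSeries σ) (N : ℕ) : ∃ (j : ℕ) (p : TwistedPolynomial σ),
    ∀ n < (j + N : ℤ), coeff (monomial σ j 1 * g - TwistedPolynomial.toLaurent σ p) n = 0 := by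
  refine ⟨(-ord g).toNat, ?_⟩
  set j := (-ord g).toNat
  refine ⟨∑ i ∈ Finset.range (j + N),
    TwistedPolynomial.C σ (coeff (monomial σ j 1 * g) i) * TwistedPolynomial.X σ ^ i, fun n hn ↦ ?_⟩
  rw [coeff_sub, map_sum, coeff_sum]
  simp only [TwistedPolynomial.toLaurent_C_mul_X_pow, coeff_monomial (σ := σ)]
  rcases lt_or_ge n 0 with h0 | h0
  · rw [Finset.sum_eq_zero fun i _ ↦ if_neg (by omega), sub_zero, coeff_monomial_mul,
      coeff_eq_zero_of_lt_ord (by omega), map_zero, mul_zero]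
  · obtain ⟨m, rfl⟩ := Int.eq_ofNat_of_zero_le h0
    rw [Finset.sum_eq_single m, if_pos rfl, sub_self]
    · intro i _ hi
      exact if_neg (by omega)
    · intro hm
      exact absurd (Finset.mem_range.2 (by omega)) hm

theorem isValuedCompletion [Nontrivial R] [NoZeroDivisors R]
    [OreLocalization.OreSet (nonZeroDivisors (TwistedPolynomial σ))]
    (hR : ∀ a : R, a ≠ 0 → IsUnit a) {δ : ℝ≥0} (h0 : 0 < δ) (h1 : δ < 1) :
    IsValuedCompletion ((xAdicValuation σ h0 h1).comap (TwistedFunctionField.toLaurent hR))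
      (xAdicValuation σ h0 h1) (TwistedFunctionField.toLaurent hR) where
  isometry _ := rfl
  dense g ε hε := by
    obtain ⟨N, hN⟩ := exists_zpow_lt h1 hε
    obtain ⟨j, p, hp⟩ := exists_shift_poly g N
    have hX : TwistedFunctionField.X σ ≠ 0 := by
      intro h
      have h2 := TwistedFunctionField.toLaurent_X (σ := σ) hR
      rw [h, map_zero] at h2
      have h3 := congrArg (fun f ↦ coeff f 1) h2
      simp [coeff_monomial, coeff_zero] at h3
    have hX' : IsUnit (TwistedFunctionField.X σ ^ j) := (isUnit_iff_ne_zero.2 hX).pow j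
    obtain ⟨U, hU⟩ := hX'
    refine ⟨(↑U⁻¹ : TwistedFunctionField σ) * TwistedFunctionField.ofPoly σ p, lt_of_le_of_lt ?_ hN⟩
    have hm : TwistedFunctionField.toLaurent hR (U : TwistedFunctionField σ) = monomial σ j 1 := by
      rw [hU, map_pow, TwistedFunctionField.toLaurent_X, monomial_pow]
    have hinv : monomial σ (-j) 1 * monomial σ j 1 = 1 := by
      rw [monomial_mul_monomial, neg_add_cancel, map_one, mul_one, monomial_zero_one]
    have hm' : TwistedFunctionField.toLaurent hR (↑U⁻¹ : TwistedFunctionField σ) =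
        monomial σ (-j) 1 := by
      have h2 : TwistedFunctionField.toLaurent hR (U : TwistedFunctionField σ) *
          TwistedFunctionField.toLaurent hR (↑U⁻¹ : TwistedFunctionField σ) = 1 := by
        rw [← map_mul, Units.mul_inv, map_one]
      rw [hm] at h2
      rw [← one_mul (TwistedFunctionField.toLaurent hR _), ← hinv, mul_assoc, h2, mul_one]
    rw [xAdicValuation_apply, xAdic_le_iff h0 h1]
    intro n hn
    have e : g - TwistedFunctionField.toLaurent hR ((↑U⁻¹ : TwistedFunctionField σ) *
        TwistedFunctionField.ofPoly σ p) =
        monomial σ (-j) 1 * (monomial σ j 1 * g - TwistedPolynomial.toLaurent σ p) := by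
      rw [map_mul, hm', TwistedFunctionField.toLaurent_ofPoly, mul_sub, ← mul_assoc, hinv, one_mul]
    rw [e, coeff_monomial_mul, hp _ (by omega), map_zero, mul_zero]
  separated b hb := by
    rw [xAdicValuation_apply] at hb
    by_contra h
    rw [xAdic_of_ne h] at hb
    exact (zpow_pos h0 _).ne' hb
  complete s hs := by
    -- In a Cauchy sequence the coefficients of index below k are eventually constant.
    have hs' (k : ℕ) : ∃ N, ∀ m ≥ N, ∀ n ≥ N, ∀ i < (k : ℤ), coeff (s m) i = coeff (s n) i := by
      obtain ⟨N, hN⟩ := hs (δ ^ (k : ℤ)) (zpow_pos h0 _)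
      refine ⟨N, fun m hm n hn i hi ↦ ?_⟩
      have h2 := (hN m hm n hn).le
      rw [xAdicValuation_apply, xAdic_le_iff h0 h1] at h2
      have h3 := h2 i hi
      rwa [coeff_sub, sub_eq_zero] at h3
    choose N hN using hs'
    have hc (k : ℕ) (i : ℤ) (hi : i < k) (n : ℕ) (hn : N k ≤ n) :
        coeff (s n) i = coeff (s (N (i.toNat + 1))) i := by
      rw [hN k n hn (max (N k) (N (i.toNat + 1))) (le_max_left _ _) i hi]
      exact hN (i.toNat + 1) _ (le_max_right _ _) _ le_rfl i (by omega)
    -- The limit has at index i the stable coefficient. For every i < 0 the index `i.toNat + 1` is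
    -- 1, so the single series `s (N 1)` bounds the exponents from below.
    let b := mk σ (fun i ↦ coeff (s (N (i.toNat + 1))) i) (min 0 (ord (s (N 1)))) fun i hi ↦ by
      have h2 : i.toNat = 0 := by omega
      rw [h2]
      exact coeff_eq_zero_of_lt_ord (lt_of_lt_of_le hi (min_le_right _ _))
    refine ⟨b, fun ε hε ↦ ?_⟩
    obtain ⟨k, hk⟩ := exists_zpow_lt h1 hε
    refine ⟨N k, fun n hn ↦ lt_of_le_of_lt ?_ hk⟩
    rw [xAdicValuation_apply, xAdic_le_iff h0 h1]
    intro i hi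
    rw [coeff_sub, coeff_mk, hc k i hi n hn, sub_self]

end TwistedLaurentSeries

theorem InducesCube.mul_pow_comm {R : Type*} [Ring R] {σ : RingAut R} {d : Rˣ}
    (h : InducesCube σ d) {k : ℕ} {a : R} (ha : ∀ b, a * (σ ^ (3 * k)) b = b * a) (b : R) :
    a * (d : R) ^ k * b = b * (a * (d : R) ^ k) := by
  have e := ha b
  rw [h.pow_three_mul] at e
  rw [← mul_assoc b, ← e]
  simp only [← Units.val_pow_eq_pow_val, inv_pow, mul_assoc, Units.inv_mul, mul_one]

/-! ### Powers of σ̃ that are inner -/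

namespace Example9

theorem mem_rat_of_sigmaK_eq {k : K} (h : sigmaK k = k) : ∃ q : ℚ, k = q := by
  obtain ⟨a, b, c, rfl⟩ := exists_coords k
  simp only [map_add, map_mul, map_pow, map_ratCast, sigmaK_alpha] at h
  have h1 : ((b + 2 * c : ℚ) : K) + ((-2 * b + c : ℚ) : K) * alpha + ((-b - c : ℚ) : K) * alpha ^ 2
      = 0 := by
    push_cast
    linear_combination h - c * (alpha + 1) * alpha_rel
  obtain ⟨h2, h3, h4⟩ := coords_eq_zero h1
  have hb : b = 0 := by linarith
  have hc : c = 0 := by linarith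
  exact ⟨a, by rw [hb, hc]; simp⟩

theorem sigmaK_alpha_ne : sigmaK alpha ≠ alpha := by
  rw [sigmaK_alpha]
  intro h
  have h1 : ((1 : ℚ) : K) + ((-2 : ℚ) : K) * alpha + ((-1 : ℚ) : K) * alpha ^ 2 = 0 := by
    push_cast
    linear_combination h
  exact one_ne_zero (coords_eq_zero h1).1

variable {τ : RingAut D}

theorem IsSigmaTilde.apply_kD (hτ : IsSigmaTilde τ) (k : K) : τ (kD k) = kD (sigmaK k) := by
  rw [(isSigmaTilde_iff τ).1 hτ, tauHom_kD]

theorem kD_injective : Function.Injective kD := RingHom.injective kD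

theorem IsSigmaTilde.pow_kD (hτ : IsSigmaTilde τ) (n : ℕ) (k : K) :
    (τ ^ n) (kD k) = kD (sigmaK^[n] k) := by
  induction n with
  | zero => rfl
  | succ n ih =>
    rw [pow_succ', RingAut.mul_apply, ih, hτ.apply_kD, Function.iterate_succ_apply']

theorem three_dvd_of_iterate {n : ℕ} (h : sigmaK^[n] alpha = alpha) : 3 ∣ n := by
  have hm : ∀ (m : ℕ) (k : K), sigmaK^[3 * m] k = k := by
    intro m k
    rw [Function.iterate_mul]
    exact Function.iterate_fixed (sigmaK_sigmaK_sigmaK k) m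
  have hr : n = n % 3 + 3 * (n / 3) := (Nat.mod_add_div n 3).symm
  rw [hr, Function.iterate_add_apply, hm] at h
  have h3 : n % 3 < 3 := Nat.mod_lt _ (by norm_num)
  rcases (show n % 3 = 0 ∨ n % 3 = 1 ∨ n % 3 = 2 by omega) with h0 | h0 | h0
  · exact Nat.dvd_of_mod_eq_zero h0
  · rw [h0] at h
    exact absurd h sigmaK_alpha_ne
  · rw [h0] at h
    have h1 : sigmaK (sigmaK alpha) = alpha := h
    have h2 := congrArg sigmaK h1
    rw [sigmaK_sigmaK_sigmaK] at h2
    exact absurd h2.symm sigmaK_alpha_ne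

/-- Since α is central, the relation for a forces σⁿ(α) = α, hence n = 3k because σ has order 3 on
K. Then a dᵏ is central in D, so lies in K, and is fixed by σ, so is rational. -/
theorem onlyInnerPowers (hτ : IsSigmaTilde τ) {d : Dˣ} (h : InducesCube τ d) :
    TwistedPolynomial.OnlyInnerPowers τ d := by
  intro n a ha hn hfix
  obtain ⟨k, rfl⟩ : 3 ∣ n := by
    refine three_dvd_of_iterate (kD_injective ?_)
    have h1 := hn (kD alpha)
    rw [hτ.pow_kD, kD_comm] at h1
    exact mul_left_cancel₀ ha h1
  have hc (b : D) : a * (d : D) ^ k * b = b * (a * (d : D) ^ k) := h.mul_pow_comm hn b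
  obtain ⟨κ, hκ⟩ := mem_K_of_commute (hc thetaD) (hc uD)
  have hfix' : τ (a * (d : D) ^ k) = a * (d : D) ^ k := by
    rw [map_mul, map_pow, hfix, h.fixed]
  rw [hκ, hτ.apply_kD] at hfix'
  obtain ⟨q, rfl⟩ := mem_rat_of_sigmaK_eq (kD_injective hfix')
  refine ⟨k, q, rfl, ?_⟩
  rw [Algebra.smul_def, algebraMap_D, ← hκ, mul_assoc, ← Units.val_pow_eq_pow_val,
    ← Units.val_pow_eq_pow_val, inv_pow, Units.mul_inv, mul_one]

end Example9

/-! ### Tame inertia -/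

namespace Valuation

variable {N Γ₀ G : Type*} [Field N] [LinearOrderedCommGroupWithZero Γ₀] {v : Valuation N Γ₀}

theorem map_mul_sub_mul_lt_one {a a' b b' : N} (ha : v a ≤ 1) (hb : v b' ≤ 1)
    (h1 : v (a - a') < 1) (h2 : v (b - b') < 1) : v (a * b - a' * b') < 1 := by
  have e : a * b - a' * b' = a * (b - b') + (a - a') * b' := by ring
  rw [e]
  refine v.map_add_lt ?_ ?_
  · rw [map_mul]; exact mul_lt_one_of_nonneg_of_lt_one_right ha zero_le h2
  · rw [map_mul]; exact mul_lt_one_of_nonneg_of_lt_one_left zero_le h1 hb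

theorem map_pow_sub_pow_lt_one {a b : N} (ha : v a ≤ 1) (hb : v b ≤ 1) (h : v (a - b) < 1)
    (n : ℕ) : v (a ^ n - b ^ n) < 1 := by
  induction n with
  | zero => simp
  | succ n ih =>
    rw [pow_succ, pow_succ]
    exact map_mul_sub_mul_lt_one (by rw [map_pow]; exact pow_le_one₀ zero_le ha) hb ih h

theorem map_sub_lt_trans {a b c : N} {γ : Γ₀} (h1 : v (a - b) < γ) (h2 : v (b - c) < γ) :
    v (a - c) < γ := by
  rw [← sub_add_sub_cancel a b c]; exact v.map_add_lt h1 h2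

theorem map_sub_lt_symm {a b : N} {γ : Γ₀} (h1 : v (a - b) < γ) : v (b - a) < γ := by
  rwa [v.map_sub_swap]

theorem le_one_of_sub_lt {a b : N} (h : v (a - b) < 1) (hb : v b ≤ 1) : v a ≤ 1 := by
  rw [← sub_add_cancel a b]; exact v.map_add_le h.le hb

variable [Group G] [Finite G] [MulSemiringAction G N]

/-- The average over the group is fixed, and is congruent to x because |G| is a unit: invariants of
the residue field lift to invariants. -/
theorem exists_fixed_sub_lt_one (hn : v (Nat.card G : N) = 1) {x : N}
    (hx : ∀ g : G, v (g • x - x) < 1) : ∃ a : N, (∀ g : G, g • a = a) ∧ v (a - x) < 1 := by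
  have := Fintype.ofFinite G
  have hn0 : (Nat.card G : N) ≠ 0 := v.ne_zero_iff.1 (by rw [hn]; exact one_ne_zero)
  refine ⟨(Nat.card G : N)⁻¹ * ∑ g : G, g • x, fun g ↦ ?_, ?_⟩
  · have h1 : g • (Nat.card G : N) = Nat.card G :=
      map_natCast (MulSemiringAction.toRingHom G N g) _
    have h2 : g • ∑ h : G, h • x = ∑ h : G, h • x := by
      simp only [Finset.smul_sum, smul_smul]
      exact Fintype.sum_equiv (Equiv.mulLeft g) (fun h ↦ (g * h) • x) (fun h ↦ h • x) fun _ ↦ rfl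
    rw [smul_mul', smul_inv'', h1, h2]
  · have e : (Nat.card G : N)⁻¹ * ∑ g : G, g • x - x =
        (Nat.card G : N)⁻¹ * ∑ g : G, (g • x - x) := by
      rw [Finset.sum_sub_distrib, mul_sub, Finset.sum_const, Finset.card_univ,
        ← Nat.card_eq_fintype_card, nsmul_eq_mul, inv_mul_cancel_left₀ hn0]
    rw [e, map_mul, map_inv₀, hn, inv_one, one_mul]
    exact v.map_sum_lt one_ne_zero fun g _ ↦ hx g

/-- For c = g(x)/x the product of gⁱ(c) over 0 ≤ i < |G| telescopes to 1. If v(c) < 1, the factor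
with i = 0 is less than 1 and the others are at most 1, a contradiction; if v(c) > 1, the same
applies to c⁻¹. -/
theorem map_smul_of_map_smul_le_one (h : ∀ (g : G) (x : N), v x ≤ 1 → v (g • x) ≤ 1) (g : G)
    (x : N) : v (g • x) = v x := by
  have hlt (g : G) (x : N) (hx : v x < 1) : v (g • x) < 1 := by
    refine lt_of_le_of_ne (h g x hx.le) fun h1 ↦ ?_
    have h2 : v (g • x)⁻¹ ≤ 1 := by rw [map_inv₀, h1, inv_one]
    have h3 := h g⁻¹ _ h2
    rw [smul_inv'', inv_smul_smul, map_inv₀] at h3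
    have hx0 : v x ≠ 0 := fun h0 ↦ by
      rw [v.zero_iff] at h0
      rw [h0, smul_zero, map_zero] at h1
      exact zero_ne_one h1
    exact absurd ((inv_le_one₀ (zero_lt_iff.2 hx0)).1 h3) (not_le.2 hx)
  by_cases hx : x = 0
  · rw [hx, smul_zero]
  have hgx (i : ℕ) : g ^ i • x ≠ 0 := (smul_ne_zero_iff_ne _).2 hx
  have hprod (y : N) (n : ℕ) (hy : v y < 1) : v (∏ i ∈ Finset.range (n + 1), g ^ i • y) < 1 := by
    induction n with
    | zero => simpa using hy
    | succ n ih =>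
      rw [Finset.prod_range_succ, map_mul]
      exact mul_lt_one_of_nonneg_of_lt_one_left zero_le ih (h _ _ hy.le)
  have htel (n : ℕ) : ∏ i ∈ Finset.range n, g ^ i • (g • x / x) = g ^ n • x / x := by
    induction n with
    | zero => simp [hx]
    | succ n ih =>
      rw [Finset.prod_range_succ, ih, div_eq_mul_inv (g • x), smul_mul', smul_inv'', smul_smul,
        ← pow_succ, ← div_eq_mul_inv, div_mul_div_comm, mul_comm (g ^ n • x), mul_div_mul_right _ _ (hgx n)]
  obtain ⟨n, hn⟩ : ∃ n, Nat.card G = n + 1 := ⟨Nat.card G - 1, by have := Nat.card_pos (α := G); omega⟩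
  have h1 : ∏ i ∈ Finset.range (n + 1), g ^ i • (g • x / x) = 1 := by
    rw [htel, ← hn, pow_card_eq_one', one_smul, div_self hx]
  have hvx : v x ≠ 0 := v.ne_zero_iff.2 hx
  rcases lt_trichotomy (v (g • x / x)) 1 with h2 | h2 | h2
  · have := hprod _ n h2
    rw [h1, map_one] at this
    exact absurd this (lt_irrefl _)
  · rwa [map_div₀, div_eq_one_iff_eq hvx] at h2
  · have h3 : v (g • x / x)⁻¹ < 1 := by rw [map_inv₀]; exact inv_lt_one_of_one_lt₀ h2
    have := hprod _ n h3
    simp only [smul_inv'', Finset.prod_inv_distrib, h1, inv_one, map_one] at this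
    exact absurd this (lt_irrefl _)

/-- If the residues of invariant elements that are `n`-th roots of unity, `n = |G|`, are `k`-th
roots of unity, then the `k`-th powers of elements of the inertia group are trivial. -/
theorem pow_eq_one_of_inertia [FaithfulSMul G N] (hcomm : ∀ g h : G, g * h = h * g)
    (hv : ∀ (g : G) (x : N), v (g • x) = v x) (hn : v (Nat.card G : N) = 1) {k : ℕ}
    (hk : ∀ a : N, (∀ g : G, g • a = a) → v (a ^ Nat.card G - 1) < 1 → v (a ^ k - 1) < 1)
    {g : G} (hg : ∀ x : N, v x ≤ 1 → v (g • x - x) < 1) : g ^ k = 1 := by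
  have hdiv (h : G) (x y : N) : h • (x / y) = h • x / h • y := by
    rw [div_eq_mul_inv, smul_mul', smul_inv'', div_eq_mul_inv]
  have key (x : N) (hx : x ≠ 0) : v (g ^ k • x - x) < v x := by
    have hvx : v x ≠ 0 := v.ne_zero_iff.2 hx
    have hsx (h : G) : h • x ≠ 0 := (smul_ne_zero_iff_ne _).2 hx
    have hunit (h : G) : v (h • x / x) = 1 := by rw [map_div₀, hv, div_self hvx]
    -- For c = g(x)/x one has h(c)/c = g(h(x)/x)/(h(x)/x), as g and h commute. This is congruent to
    -- 1 because g is inertial and h(x)/x is a unit; so the residue of c is invariant.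
    have hinv (h : G) : v (h • (g • x / x) - g • x / x) < 1 := by
      have e : h • (g • x / x) - g • x / x =
          (g • x / x) * ((h • x / x)⁻¹ * (g • (h • x / x) - h • x / x)) := by
        rw [hdiv, hdiv, smul_smul, smul_smul, hcomm h g]
        have := hsx h
        have := hsx g
        field_simp
      rw [e, map_mul, map_mul, hunit, map_inv₀, hunit, inv_one, one_mul, one_mul]
      exact hg _ (hunit h).le
    -- Modulo the maximal ideal, g acts on x through powers of c; with i = |G| the residue of c is a
    -- root of unity.
    have hpow (i : ℕ) : v (g ^ i • x / x - (g • x / x) ^ i) < 1 := by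
      induction i with
      | zero => simp [hx]
      | succ i ih =>
        have e : g ^ (i + 1) • x / x = g • (g ^ i • x / x) * (g • x / x) := by
          rw [hdiv, smul_smul, ← pow_succ']
          have := hsx g
          field_simp
        rw [e, pow_succ]
        refine map_mul_sub_mul_lt_one ?_ (hunit g).le ?_ (by simp)
        · rw [hv]; exact (hunit _).le
        · exact map_sub_lt_trans (hg _ (hunit _).le) ih
    obtain ⟨a, ha, hac⟩ := exists_fixed_sub_lt_one hn hinv
    have ha1 : v a ≤ 1 := le_one_of_sub_lt hac (hunit g).le
    have hcn : v ((g • x / x) ^ Nat.card G - 1) < 1 := by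
      have := map_sub_lt_symm (hpow (Nat.card G))
      rwa [pow_card_eq_one', one_smul, div_self hx] at this
    have hak := hk a ha (map_sub_lt_trans (map_pow_sub_pow_lt_one ha1 (hunit g).le hac _) hcn)
    have hck : v (g ^ k • x / x - 1) < 1 :=
      map_sub_lt_trans (hpow k) (map_sub_lt_trans
        (map_sub_lt_symm (map_pow_sub_pow_lt_one ha1 (hunit g).le hac k)) hak)
    have e : g ^ k • x - x = x * (g ^ k • x / x - 1) := by field_simp
    rw [e, map_mul]
    exact mul_lt_of_lt_one_right (zero_lt_iff.2 hvx) hck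
  -- Now v(τ(x) − x) < v(x) for all x ≠ 0, so τ is wild, and it remains to see that tameness forces
  -- τ = 1.
  set τ := g ^ k with hτ
  by_contra h1
  obtain ⟨y, hy⟩ : ∃ y : N, τ • y ≠ y := by
    by_contra! h2
    exact h1 (FaithfulSMul.eq_of_smul_eq_smul fun y : N ↦ by rw [h2, one_smul])
  have hx : τ • y - y ≠ 0 := sub_ne_zero.2 hy
  set x := τ • y - y with hxdef
  have hi (i : ℕ) : v (τ ^ i • x - x) < v x := by
    induction i with
    | zero => simpa [zero_lt_iff] using hx
    | succ i ih =>
      refine map_sub_lt_trans (b := τ • x) ?_ (key x hx)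
      rw [pow_succ', mul_smul, ← smul_sub, hv]
      exact ih
  have htel (m : ℕ) : ∑ i ∈ Finset.range m, τ ^ i • x = τ ^ m • y - y := by
    induction m with
    | zero => simp
    | succ m ih =>
      rw [Finset.sum_range_succ, ih, hxdef, smul_sub, smul_smul, ← pow_succ]
      ring
  -- For x = τ(y) − y the sum of all τⁱ(x) telescopes to 0. So −|G|x is a sum of terms smaller than
  -- x, although |G| is a unit.
  have hS : ∑ i ∈ Finset.range (Nat.card G), (τ ^ i • x - x) = -((Nat.card G : N) * x) := by
    rw [Finset.sum_sub_distrib, htel, pow_card_eq_one', one_smul, sub_self, zero_sub,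
      Finset.sum_const, Finset.card_range, nsmul_eq_mul]
  have h3 : v (∑ i ∈ Finset.range (Nat.card G), (τ ^ i • x - x)) < v x :=
    v.map_sum_lt (v.ne_zero_iff.2 hx) fun i _ ↦ hi i
  rw [hS, v.map_neg, map_mul, hn, one_mul] at h3
  exact lt_irrefl _ h3

end Valuation

/-! ### Residue fields with group actions -/

namespace Valuation

universe u

variable {N : Type u} {Γ₀ G : Type*} [Field N] [LinearOrderedCommGroupWithZero Γ₀]
  (v : Valuation N Γ₀) [Group G] [MulSemiringAction G N]

/-- A group that preserves a valuation acts on the valuation ring. -/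
@[reducible] def integerAction (hv : ∀ (g : G) (x : N), v (g • x) = v x) :
    MulSemiringAction G v.valuationSubring where
  smul g x := ⟨g • (x : N), (hv g x).trans_le x.2⟩
  one_smul x := Subtype.ext (one_smul G (x : N))
  mul_smul g h x := Subtype.ext (mul_smul g h (x : N))
  smul_zero g := Subtype.ext (smul_zero g)
  smul_add g x y := Subtype.ext (smul_add g (x : N) y)
  smul_one g := Subtype.ext (smul_one g)
  smul_mul g x y := Subtype.ext (smul_mul' g (x : N) y)

/-- The residue field appears only through these properties, as an abstract field with an action of
G. The last clause identifies the inertia group with the kernel of that action. -/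
theorem exists_residueField (hv : ∀ (g : G) (x : N), v (g • x) = v x) :
    ∃ (k : Type u) (_ : Field k) (_ : MulSemiringAction G k) (π : v.valuationSubring →+* k),
      Function.Surjective π ∧ (∀ x, π x = 0 ↔ v x < 1) ∧
      (∀ (g : G) (x y : v.valuationSubring), (y : N) = g • (x : N) → π y = g • π x) ∧
      ∀ g : G, (∀ y : k, g • y = y) ↔ ∀ x : N, v x ≤ 1 → v (g • x - x) < 1 := by
  let _ := integerAction v hv
  have h0 (x : v.valuationSubring) : IsLocalRing.residue v.valuationSubring x = 0 ↔ v x < 1 := by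
    rw [IsLocalRing.residue_eq_zero_iff, ValuationSubring.valuation_lt_one_iff,
      ← v.isEquiv_valuation_valuationSubring.lt_one_iff_lt_one]
  have hs (g : G) (x : v.valuationSubring) : IsLocalRing.residue v.valuationSubring (g • x) =
      g • IsLocalRing.residue v.valuationSubring x := IsLocalRing.ResidueField.residue_smul ..
  refine ⟨IsLocalRing.ResidueField v.valuationSubring, inferInstance, inferInstance,
    IsLocalRing.residue _, IsLocalRing.residue_surjective, h0, fun g x y h ↦ ?_,
    fun g ↦ ⟨fun h x hx ↦ ?_, fun h y ↦ ?_⟩⟩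
  · rw [← hs]
    exact congrArg _ (Subtype.ext h)
  · refine (h0 (g • (⟨x, hx⟩ : v.valuationSubring) - ⟨x, hx⟩)).1 ?_
    rw [_root_.map_sub, hs, h, sub_self]
  · obtain ⟨x, rfl⟩ := IsLocalRing.residue_surjective y
    rw [← sub_eq_zero, ← hs, ← _root_.map_sub, h0]
    exact h x x.2

theorem exists_lift_residue {A k B : Type*} [Ring A] [Ring k] [Ring B] {π : A →+* k}
    (hπ : Function.Surjective π) (r : A →+* B) (h : ∀ x, π x = 0 → r x = 0) :
    ∃ ρ : k →+* B, ∀ x, ρ (π x) = r x :=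
  ⟨RingHom.liftOfSurjective π hπ ⟨r, h⟩, fun _ ↦
    RingHom.liftOfRightInverse_comp_apply ..⟩

end Valuation

/-! ### Group actions on finite fields -/

section FiniteField

variable {p : ℕ} [Fact p.Prime] {k : Type*} [Field k] [CharP k p] {G : Type*} [Group G]
  [MulSemiringAction G k]

variable (p k G) in
/-- The action of a group on a finite field by Galois automorphisms. -/
def toGalZMod : letI := ZMod.algebra k p; G →* (k ≃ₐ[ZMod p] k) :=
  letI := ZMod.algebra k p
  haveI : SMulCommClass G (ZMod p) k := ⟨fun g c x ↦ by
    have h : g • algebraMap (ZMod p) k c = algebraMap (ZMod p) k c :=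
      DFunLike.congr_fun (RingHom.ext_zmod ((MulSemiringAction.toRingHom G k g).comp
        (algebraMap (ZMod p) k)) (algebraMap (ZMod p) k)) c
    rw [Algebra.smul_def, Algebra.smul_def, smul_mul', h]⟩
  MulSemiringAction.toAlgAut G (ZMod p) k

theorem toGalZMod_apply (g : G) (x : k) :
    letI := ZMod.algebra k p
    toGalZMod p k G g x = g • x := rfl

/-- The group embeds in the Galois group of the finite field over its prime field, which is cyclic.
-/
theorem isCyclic_of_faithful_finiteField (p : ℕ) [Fact p.Prime] {k : Type*} [Field k] [CharP k p]
    [Finite k] {G : Type*} [Group G] [MulSemiringAction G k] [FaithfulSMul G k] : IsCyclic G := by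
  let _ := ZMod.algebra k p
  refine isCyclic_of_injective (toGalZMod p k G) fun g h hgh ↦ ?_
  refine FaithfulSMul.eq_of_smul_eq_smul fun x : k ↦ ?_
  rw [← toGalZMod_apply (p := p), hgh, toGalZMod_apply]

/-- The Galois group of k over 𝔽ₚ has order [k : 𝔽ₚ], which divides [F : 𝔽ₚ] when k embeds in F. -/
theorem pow_smul_of_ringHom [Finite k] {F : Type*} [Field F] [Algebra (ZMod p) F]
    (ρ : k →+* F) (g : G) (x : k) : g ^ Module.finrank (ZMod p) F • x = x := by
  let _ := ZMod.algebra k p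
  let _ := ρ.toAlgebra
  have : IsScalarTower (ZMod p) k F := IsScalarTower.of_algebraMap_eq' (RingHom.ext_zmod _ _)
  have hd : Nat.card (k ≃ₐ[ZMod p] k) ∣ Module.finrank (ZMod p) F := by
    rw [IsGalois.card_aut_eq_finrank, ← Module.finrank_mul_finrank (ZMod p) k F]
    exact dvd_mul_right _ _
  rw [← toGalZMod_apply (p := p), map_pow]
  obtain ⟨m, hm⟩ := hd
  rw [hm, pow_mul, pow_card_eq_one', one_pow]
  rfl

end FiniteField

namespace Example9

/-! ### Valuations of subfields of `D` over `2` and `7` -/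

/-- `ZD.toD` as a linear map. -/
def ZD.toDLinear : ZD →ₗ[ℤ] D where
  toFun := ZD.toD
  map_add' := ZD.toD_add
  map_smul' n x := by
    rw [ZD.toD_smul, map_intCast, eq_intCast, Int.cast_id, zsmul_eq_mul]

/-- The elements with integral coordinates form a subring of D that is finitely generated over ℤ. -/
theorem ZD.isIntegral_toD (z : ZD) : IsIntegral ℤ z.toD := by
  let S : Subalgebra ℤ D :=
    { carrier := Set.range ZD.toD
      mul_mem' := by
        rintro _ _ ⟨x, rfl⟩ ⟨y, rfl⟩
        exact ⟨x.mul y, ZD.toD_mul x y⟩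
      add_mem' := by
        rintro _ _ ⟨x, rfl⟩ ⟨y, rfl⟩
        exact ⟨x + y, ZD.toD_add x y⟩
      algebraMap_mem' := fun n ↦ ⟨ZD.ofZK (n, 0, 0), by
        rw [ZD.toD_intCast, map_intCast, eq_intCast]⟩ }
  have hS : S.toSubmodule = LinearMap.range ZD.toDLinear := rfl
  refine IsIntegral.of_mem_of_fg S ?_ _ ⟨z, rfl⟩
  rw [hS, LinearMap.range_eq_map]
  exact Module.Finite.fg_top.map ZD.toDLinear

theorem _root_.Valuation.le_one_of_isIntegral_int {N Γ₀ : Type*} [Field N]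
    [LinearOrderedCommGroupWithZero Γ₀] (v : Valuation N Γ₀) {x : N} (hx : IsIntegral ℤ x) :
    v x ≤ 1 :=
  (Valuation.integer.integers v).mem_of_integral (hx.tower_top (A := v.integer))

namespace ResiduePlace

open scoped WithZero

variable {p : ℕ} [hp : Fact p.Prime] {F : Type*} [Field F] [CharP F p] (P : ResiduePlace p F)
  {N : Type*} [Field N] (j : N →+* D)

theorem exists_valuation_comap : ∃ v : Valuation N ℤᵐ⁰, (∀ x, v x ≤ 1 ↔ j x ∈ order p) ∧
    ∀ (x : N) (hx : j x ∈ order p), v x < 1 ↔ P.res ⟨j x, hx⟩ = 0 := by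
  obtain ⟨v, -, h1, h2⟩ := P.exists_valuation
  exact ⟨v.comap j, fun x ↦ h1 _, fun x hx ↦ h2 ⟨j x, hx⟩⟩

variable {P j}

theorem map_intCast_mem (n : ℤ) : j n ∈ order p := by
  rw [map_intCast]; exact intCast_mem _ n

variable {v : Valuation N ℤᵐ⁰} (hv : ∀ x, v x ≤ 1 ↔ j x ∈ order p)
  (hv' : ∀ (x : N) (hx : j x ∈ order p), v x < 1 ↔ P.res ⟨j x, hx⟩ = 0)

include hv hv'

theorem map_intCast_eq_one {m : ℤ} (hm : ¬ (p : ℤ) ∣ m) : v (m : N) = 1 := by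
  refine le_antisymm ((hv _).2 (map_intCast_mem m)) (not_lt.1 fun h ↦ ?_)
  rw [hv' _ (map_intCast_mem m)] at h
  have e : (⟨j m, map_intCast_mem m⟩ : order p) = (m : order p) :=
    Subtype.ext ((map_intCast j m).trans (Subring.coe_intCast _ m).symm)
  rw [e, map_intCast] at h
  exact cast_ne_zero hm h

/-- If v(x) ≤ 1, then some multiple mx with m prime to p has integral coordinates in D and so is
integral over ℤ. Integrality survives every endomorphism of N, and m has value 1. -/
theorem map_ringHom_le_one (g : N →+* N) {x : N} (hx : v x ≤ 1) : v (g x) ≤ 1 := by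
  obtain ⟨m, hm, z, hz⟩ := (hv x).1 hx
  have h1 : j (m * x) = z.toD := by rw [map_mul, map_intCast, ← hz, map_intCast]
  have h2 : IsIntegral ℤ ((m : N) * x) := by
    have h3 := ZD.isIntegral_toD z
    rw [← h1] at h3
    exact (isIntegral_algHom_iff j.toIntAlgHom j.injective).1 h3
  have h4 := v.le_one_of_isIntegral_int (h2.map g.toIntAlgHom)
  have h5 : g.toIntAlgHom ((m : N) * x) = m * g x := by
    change g ((m : N) * x) = _
    rw [map_mul, map_intCast]
  rwa [h5, map_mul, map_intCast_eq_one hv hv' hm, one_mul] at h4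

end ResiduePlace

namespace ResiduePlace

open scoped WithZero

variable {p : ℕ} [hp : Fact p.Prime] {F : Type*} [Field F] [CharP F p] (P : ResiduePlace p F)

/-- An integral multiple of an element of K has zero coordinates at θ and θ², so only its ℤ[α]-part
enters the residue. -/
theorem exists_res_kD {κ : K} (hx : kD κ ∈ order p) : ∃ (m : ℤ) (z : ZK), ¬ (p : ℤ) ∣ m ∧
    m * κ = z.toK ∧ (m : F) * P.res ⟨kD κ, hx⟩ = P.evK z := by
  obtain ⟨m, hm, z, hz⟩ := id hx
  have h := P.res_spec ⟨kD κ, hx⟩ hz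
  rw [← map_mul] at hz
  have h0 : ofK (m * κ) = z.1.toL := congrArg CubicCyclicAlgebra.c₀ hz
  have h1 : ofK (z.1.1.toK - m * κ) + ofK z.1.2.1.toK * theta + ofK z.1.2.2.toK * theta ^ 2 = 0 := by
    rw [map_sub, h0, ZL.toL]; ring
  obtain ⟨e0, e1, e2⟩ := coordsL_eq_zero h1
  refine ⟨m, z.1.1, hm, (sub_eq_zero.1 e0).symm, ?_⟩
  rw [h, ev, ZK.toK_eq_zero e1, ZK.toK_eq_zero e2]
  simp [evK]

theorem exists_intCast_of_mul_eq {m n : ℤ} (hm : ¬ (p : ℤ) ∣ m) {x : F} (h : (m : F) * x = n) :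
    ∃ l : ℤ, x = l := by
  obtain ⟨a, b, hab⟩ := ((Nat.prime_iff_prime_int.1 hp.out).coprime_iff_not_dvd.2 hm).symm
  refine ⟨a * n, ?_⟩
  have h1 := congrArg (Int.cast (R := F)) hab
  push_cast at h1 ⊢
  rw [CharP.cast_eq_zero F p, mul_zero, add_zero] at h1
  rw [← h, ← mul_assoc, h1, one_mul]

theorem exists_res_ratCast {q : ℚ} (hx : kD q ∈ order p) : ∃ n : ℤ, P.res ⟨kD q, hx⟩ = n := by
  obtain ⟨m, z, hm, hz, h⟩ := P.exists_res_kD hx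
  have h1 : ((z.1 - m * q : ℚ) : K) + ((z.2.1 : ℚ) : K) * alpha + ((z.2.2 : ℚ) : K) * alpha ^ 2
      = 0 := by
    push_cast
    rw [ZK.toK] at hz
    linear_combination -hz
  obtain ⟨-, e1, e2⟩ := coords_eq_zero h1
  rw [evK, Int.cast_eq_zero.1 e1, Int.cast_eq_zero.1 e2] at h
  simp only [Int.cast_zero, zero_mul, add_zero] at h
  exact exists_intCast_of_mul_eq hm h

end ResiduePlace

/-- At this place α has the residue 2, so the residue field of K is only 𝔽₇: the prime 7 is totally
ramified in K. -/
theorem exists_place7_res_kD {κ : K} (hx : kD κ ∈ order 7) :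
    ∃ n : ℤ, place7.res ⟨kD κ, hx⟩ = n := by
  obtain ⟨m, z, hm, -, h⟩ := place7.exists_res_kD hx
  refine ResiduePlace.exists_intCast_of_mul_eq hm (n := z.1 + 2 * z.2.1 + 4 * z.2.2) ?_
  rw [h]
  have : place7.a = 2 := rfl
  rw [ResiduePlace.evK, this]
  push_cast
  ring

end Example9

-- Inertia in subfields of `D` over 2 and 7

universe u

theorem faithfulSMul_of_forall_smul_eq {G α : Type*} [Group G] [MulAction G α]
    (h : ∀ g : G, (∀ x : α, g • x = x) → g = 1) : FaithfulSMul G α where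
  eq_of_smul_eq_smul {g₁ g₂} h1 := by
    have h2 := h (g₂⁻¹ * g₁) fun x ↦ by rw [mul_smul, h1, inv_smul_smul]
    rw [← mul_one g₂, ← h2, mul_inv_cancel_left]

namespace Example9

open scoped WithZero

namespace ResiduePlace

variable {p : ℕ} [hp : Fact p.Prime] {F : Type*} [Field F] [CharP F p] {P : ResiduePlace p F}
  {N : Type*} [Field N] {j : N →+* D} {v : Valuation N ℤᵐ⁰}

theorem map_intCast_lt_one (hv' : ∀ (x : N) (hx : j x ∈ order p), v x < 1 ↔ P.res ⟨j x, hx⟩ = 0)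
    {m : ℤ} (hm : (p : ℤ) ∣ m) : v (m : N) < 1 := by
  rw [hv' _ (map_intCast_mem m)]
  have e : (⟨j m, map_intCast_mem m⟩ : order p) = (m : order p) :=
    Subtype.ext ((map_intCast j m).trans (Subring.coe_intCast _ m).symm)
  rw [e, map_intCast]
  exact (CharP.intCast_eq_zero_iff F p m).2 hm

theorem map_sub_intCast_lt_one
    (hv' : ∀ (x : N) (hx : j x ∈ order p), v x < 1 ↔ P.res ⟨j x, hx⟩ = 0) {x : N} {y : D}
    (hxy : j x = y) (hy : y ∈ order p) {n : ℤ} (hn : P.res ⟨y, hy⟩ = n) : v (x - n) < 1 := by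
  subst hxy
  have e : j (x - n) = ((⟨j x, hy⟩ - (n : order p) : order p) : D) := by
    rw [map_sub, map_intCast, AddSubgroupClass.coe_sub, Subring.coe_intCast]
  have hm : j (x - n) ∈ order p := by rw [e]; exact Subtype.property _
  rw [hv' _ hm]
  have e' : (⟨j (x - n), hm⟩ : order p) = ⟨j x, hy⟩ - (n : order p) := Subtype.ext e
  rw [e', map_sub, hn, map_intCast, sub_self]

variable (P) in
/-- A finite group of automorphisms of a subfield of `D` preserves the valuation given by a place,
and acts on a subfield of the residue field. -/
theorem exists_valuation_residueField {N : Type u} [Field N] (j : N →+* D) (G : Type*) [Group G] [Finite G]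
    [MulSemiringAction G N] : ∃ v : Valuation N ℤᵐ⁰, (∀ x, v x ≤ 1 ↔ j x ∈ order p) ∧
    (∀ (x : N) (hx : j x ∈ order p), v x < 1 ↔ P.res ⟨j x, hx⟩ = 0) ∧
    (∀ (g : G) (x : N), v (g • x) = v x) ∧
    ∃ (k : Type u) (_ : Field k) (_ : MulSemiringAction G k) (_ : k →+* F),
      ∀ g : G, (∀ y : k, g • y = y) ↔ ∀ x : N, v x ≤ 1 → v (g • x - x) < 1 := by
  obtain ⟨v, hv, hv'⟩ := P.exists_valuation_comap j
  have hinv (g : G) (x : N) : v (g • x) = v x :=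
    v.map_smul_of_map_smul_le_one (fun g x hx ↦
      map_ringHom_le_one hv hv' (MulSemiringAction.toRingHom G N g) hx) g x
  obtain ⟨k, _, _, π, hπ, h0, -, hI⟩ := v.exists_residueField hinv
  let r : v.valuationSubring →+* F := P.res.comp
    ((j.comp v.valuationSubring.subtype).codRestrict (order p) fun x ↦ (hv x).1 x.2)
  obtain ⟨ρ, -⟩ := Valuation.exists_lift_residue hπ r fun x hx ↦ (hv' x _).1 ((h0 x).1 hx)
  exact ⟨v, hv, hv', hinv, k, _, _, ρ, hI⟩

/-- Fixed elements are rational and have residues in the prime field, so the condition on roots of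
unity becomes a condition on integers modulo p. -/
theorem pow_eq_one_of_inertia {G : Type*} [Group G] [Finite G] [MulSemiringAction G N]
    [FaithfulSMul G N] (hcomm : ∀ g h : G, g * h = h * g) (hG : ¬ (p : ℤ) ∣ Nat.card G)
    (hv : ∀ x, v x ≤ 1 ↔ j x ∈ order p)
    (hv' : ∀ (x : N) (hx : j x ∈ order p), v x < 1 ↔ P.res ⟨j x, hx⟩ = 0)
    (hinv : ∀ (g : G) (x : N), v (g • x) = v x)
    (hfix : ∀ x : N, (∀ g : G, g • x = x) → ∃ q : ℚ, j x = kD q) {k : ℕ}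
    (hk : ∀ n : ℤ, (p : ℤ) ∣ n ^ Nat.card G - 1 → (p : ℤ) ∣ n ^ k - 1) {g : G}
    (hg : ∀ x : N, v x ≤ 1 → v (g • x - x) < 1) : g ^ k = 1 := by
  have hn : v (Nat.card G : N) = 1 := by
    have h := map_intCast_eq_one hv hv' hG
    rwa [Int.cast_natCast] at h
  refine v.pow_eq_one_of_inertia hcomm hinv hn (fun a ha h1 ↦ ?_) hg
  obtain ⟨q, hq⟩ := hfix a ha
  have ha1 : v a ≤ 1 := by
    have h2 := Valuation.le_one_of_sub_lt h1 (map_one v).le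
    rw [map_pow] at h2
    exact (pow_le_one_iff_of_nonneg zero_le Nat.card_pos.ne').1 h2
  have hm := (hv a).1 ha1
  rw [hq] at hm
  obtain ⟨n, hn⟩ := P.exists_res_ratCast hm
  have h3 := map_sub_intCast_lt_one hv' hq hm hn
  have hn1 : v (n : N) ≤ 1 := (hv _).2 (map_intCast_mem n)
  have hpow (i : ℕ) : v (a ^ i - (n : N) ^ i) < 1 :=
    Valuation.map_pow_sub_pow_lt_one ha1 hn1 h3 i
  have h4 : (p : ℤ) ∣ n ^ Nat.card G - 1 := by
    by_contra h5
    have h6 := map_intCast_eq_one hv hv' h5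
    push_cast at h6
    exact absurd (Valuation.map_sub_lt_trans (Valuation.map_sub_lt_symm (hpow _)) h1)
      (by rw [h6]; exact lt_irrefl _)
  have h7 := map_intCast_lt_one hv' (hk n h4)
  push_cast at h7
  exact Valuation.map_sub_lt_trans (hpow k) h7

end ResiduePlace

section

variable {N : Type*} [Field N] {G : Type*} [Group G] [Finite G] [MulSemiringAction G N]
  [FaithfulSMul G N] {j : N →+* D}

/-- Over 2 the only nonzero residue of a rational number is 1, so tame inertia is trivial and G acts
faithfully on a subfield of 𝔽₅₁₂. -/
theorem isCyclic_of_fixed_rational (hG : Nat.card G = 9)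
    (hfix : ∀ x : N, (∀ g : G, g • x = x) → ∃ q : ℚ, j x = kD q) : IsCyclic G := by
  have hcomm : ∀ g h : G, g * h = h * g := by
    have := Fact.mk Nat.prime_three
    exact (IsPGroup.isMulCommutative_of_card_eq_prime_sq (p := 3) (by rw [hG]; norm_num)).is_comm.comm
  obtain ⟨v, hv, hv', hinv, k, _, _, ρ, hI⟩ := place2.exists_valuation_residueField j G
  have : FaithfulSMul G k := by
    refine faithfulSMul_of_forall_smul_eq fun g hg ↦ ?_
    rw [← pow_one g]
    refine ResiduePlace.pow_eq_one_of_inertia (N := N) (P := place2) (v := v) (j := j) hcomm ?_ hv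
      hv' hinv hfix ?_ ((hI g).1 hg)
    · rw [hG]; decide
    · intro n hn
      rw [hG] at hn
      rw [← ZMod.intCast_zmod_eq_zero_iff_dvd] at hn ⊢
      push_cast at hn ⊢
      generalize (n : ZMod 2) = x at hn ⊢
      revert x
      decide
  have : Finite k := Finite.of_injective ρ ρ.injective
  have : CharP k 2 := ρ.charP ρ.injective 2
  exact isCyclic_of_faithful_finiteField 2 (k := k)

end

end Example9

/-! ### Galois subfields of `D` -/

namespace Example9

open scoped WithZero

theorem uD_mul_thetaD_ne : uD * thetaD ≠ thetaD * uD := by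
  intro h
  rw [thetaD, uD, CubicCyclicAlgebra.u_mul_ofL, ← sub_eq_zero, ← sub_mul, ← map_sub] at h
  rcases mul_eq_zero.1 h with h1 | h1
  · rw [map_eq_zero_iff _ ofL_injective] at h1
    exact phi_theta_sub_ne h1
  · exact uUnit.ne_zero h1

theorem alpha_ne_ratCast (q : ℚ) : alpha ≠ q := fun h ↦
  sigmaK_alpha_ne (by rw [h, map_ratCast])

variable {N : Type*} [Field N] {j : N →+* D}

theorem map_ratCast_D [CharZero N] (q : ℚ) : j q = kD q :=
  RingHom.congr_fun (RingHom.ext_rat (j.comp (algebraMap ℚ N)) (kD.comp (algebraMap ℚ K))) q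

theorem sub_mul_sub_mul_sub_eq_zero {R : Type*} [CommRing R] {a b : R}
    (ha : a ^ 3 + a ^ 2 - 2 * a - 1 = 0) (hb : b ^ 3 + b ^ 2 - 2 * b - 1 = 0) :
    (b - a) * (b - (-a ^ 2 - a + 1)) * (b - (a ^ 2 - 2)) = 0 := by
  linear_combination (-a * b + a ^ 2 - 1) * ha + hb

/-- The polynomial has central coefficients and splits over K, so evaluation at b turns it into a
product of three factors in the domain D. Its roots in D are therefore only the conjugates of α. -/
theorem exists_root_eq_kD {b : D} (hb : b ^ 3 + b ^ 2 - 2 * b - 1 = 0) :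
    b = kD alpha ∨ b = kD (-alpha ^ 2 - alpha + 1) ∨ b = kD (alpha ^ 2 - 2) := by
  let E : K[X] →+* D := Polynomial.eval₂RingHom' kD b fun k ↦ kD_comm k b
  have hX : E Polynomial.X = b := Polynomial.eval₂_X ..
  have hC (k : K) : E (Polynomial.C k) = kD k := Polynomial.eval₂_C ..
  have h1 : E (Polynomial.X ^ 3 + Polynomial.X ^ 2 - 2 * Polynomial.X - 1) = 0 := by
    rw [map_sub, map_sub, map_add, map_mul, map_pow, map_pow, hX, map_one, map_ofNat, hb]
  have h2 : (Polynomial.C alpha : K[X]) ^ 3 + Polynomial.C alpha ^ 2 - 2 * Polynomial.C alpha - 1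
      = 0 := by
    have := congrArg Polynomial.C alpha_rel
    simpa only [map_sub, map_add, map_mul, map_pow, map_one, map_ofNat, map_zero] using this
  have h3 : (Polynomial.X - Polynomial.C alpha) *
      (Polynomial.X - Polynomial.C (-alpha ^ 2 - alpha + 1)) *
      (Polynomial.X - Polynomial.C (alpha ^ 2 - 2)) =
      Polynomial.X ^ 3 + Polynomial.X ^ 2 - 2 * Polynomial.X - 1 := by
    simp only [map_sub, map_add, map_neg, map_pow, map_one, map_ofNat]
    linear_combination (-Polynomial.C alpha * Polynomial.X + Polynomial.C alpha ^ 2 - 1) * h2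
  rw [← h3, map_mul, map_mul, map_sub, map_sub, map_sub, hX, hC, hC, hC, mul_eq_zero,
    mul_eq_zero, sub_eq_zero, sub_eq_zero, sub_eq_zero, or_assoc] at h1
  exact h1

/-- If the minimal polynomial of α had no root in N, then N[X]/(minimal polynomial) would be a field
of dimension 27 over ℚ. Sending X to the central element α embeds it in D, hence onto D, which is
not commutative. If there is a root, α itself is obtained from it by b² − 2 or −b² − b + 1. -/
theorem exists_map_eq_kD_alpha [CharZero N] (h : Module.finrank ℚ N = 9) (j : N →+* D) :
    ∃ a : N, j a = kD alpha := by
  by_cases hroot : ∃ b : N, b ^ 3 + b ^ 2 - 2 * b - 1 = 0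
  · obtain ⟨b, hb⟩ := hroot
    have h0 : j b ^ 3 + j b ^ 2 - 2 * j b - 1 = 0 := by
      have := congrArg j hb
      simpa only [map_sub, map_add, map_mul, map_pow, map_one, map_ofNat, map_zero] using this
    rcases exists_root_eq_kD h0 with h1 | h1 | h1
    · exact ⟨b, h1⟩
    · refine ⟨b ^ 2 - 2, ?_⟩
      rw [map_sub, map_pow, h1, map_ofNat, ← map_pow, ← map_ofNat kD 2, ← map_sub]
      congr 1
      linear_combination (alpha + 1) * alpha_rel
    · refine ⟨-b ^ 2 - b + 1, ?_⟩
      rw [map_add, map_sub, map_neg, map_pow, h1, map_one, ← map_pow, ← map_neg, ← map_sub,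
        ← map_one kD, ← map_add]
      congr 1
      linear_combination (-alpha + 1) * alpha_rel
  · exfalso
    have hirr : Irreducible (alphaPoly N) := by
      rw [(alphaPoly_monic _).irreducible_iff_roots_eq_zero_of_degree_le_three
        (by rw [alphaPoly_natDegree]; norm_num) (by rw [alphaPoly_natDegree]),
        Multiset.eq_zero_iff_forall_notMem]
      intro x hx
      rw [Polynomial.mem_roots (alphaPoly_monic _).ne_zero, Polynomial.IsRoot, Polynomial.eval,
        alphaPoly_eval₂] at hx
      exact hroot ⟨x, hx⟩
    have := Fact.mk hirr
    let E : N[X] →+* D := Polynomial.eval₂RingHom' j (kD alpha) fun k ↦ (kD_comm alpha (j k)).symm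
    have hX : E Polynomial.X = kD alpha := Polynomial.eval₂_X ..
    have hE : E (alphaPoly N) = 0 := by
      rw [alphaPoly, map_sub, map_sub, map_add, map_mul, map_pow, map_pow, hX, map_one, map_ofNat]
      have := congrArg kD alpha_rel
      simpa only [map_sub, map_add, map_mul, map_pow, map_one, map_ofNat, map_zero] using this
    let T : AdjoinRoot (alphaPoly N) →+* D := Ideal.Quotient.lift _ E fun a ha ↦ by
      obtain ⟨c, rfl⟩ := Ideal.mem_span_singleton.1 ha
      rw [map_mul, hE, zero_mul]
    have hfr : Module.finrank N (AdjoinRoot (alphaPoly N)) = 3 := by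
      rw [(AdjoinRoot.powerBasis hirr.ne_zero).finrank, AdjoinRoot.powerBasis_dim,
        alphaPoly_natDegree]
    have hfr' : Module.finrank ℚ (AdjoinRoot (alphaPoly N)) = Module.finrank ℚ D := by
      rw [← Module.finrank_mul_finrank ℚ N, h, hfr, finrank_D]
    have : Module.Finite ℚ (AdjoinRoot (alphaPoly N)) :=
      Module.finite_of_finrank_pos (by rw [hfr', finrank_D]; norm_num)
    have hs : Function.Surjective T :=
      (LinearMap.injective_iff_surjective_of_finrank_eq_finrank
        (f := T.toRatAlgHom.toLinearMap) hfr').1 T.injective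
    obtain ⟨x, hx⟩ := hs uD
    obtain ⟨y, hy⟩ := hs thetaD
    refine uD_mul_thetaD_ne ?_
    rw [← hx, ← hy, ← map_mul, mul_comm x y, map_mul]

section

variable {G : Type*} [Group G] [Finite G] [MulSemiringAction G N] [FaithfulSMul G N]

/-- Artin's theorem on the fixed field of a finite group; here the fixed field is ℚ. -/
theorem finrank_rat_eq_card [CharZero N]
    (hfix : ∀ x : N, (∀ g : G, g • x = x) → ∃ q : ℚ, j x = kD q) :
    Module.finrank ℚ N = Nat.card G := by
  have := Fintype.ofFinite G
  have hb : Function.Bijective (algebraMap ℚ (FixedPoints.subfield G N)) := by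
    refine ⟨RingHom.injective _, fun x ↦ ?_⟩
    obtain ⟨q, hq⟩ := hfix x x.2
    refine ⟨q, Subtype.ext (j.injective ?_)⟩
    rw [hq]
    exact map_ratCast_D q
  rw [Nat.card_eq_fintype_card, ← FixedPoints.finrank_eq_card G N]
  exact Algebra.finrank_eq_of_equiv_equiv (RingEquiv.ofBijective _ hb) (RingEquiv.refl N)
    (RingHom.ext fun q ↦ (map_ratCast _ _).symm)

end

theorem smul_eq_of_smul_generator_eq {G α : Type*} [Group G] [MulAction G α] {g : G}
    (hg : ∀ h : G, h ∈ Subgroup.zpowers g) {x : α} (h : g • x = x) (h' : G) : h' • x = x :=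
  (Subgroup.zpowers_le (H := MulAction.stabilizer G x)).2 h (hg h')

theorem charZero_of_ringHom_D {N : Type*} [Field N] (j : N →+* D) : CharZero N :=
  have : CharZero D := algebraRat.charZero D
  j.charZero

section

variable {G : Type*} [Group G] [MulSemiringAction G N]

/-- With b and c the conjugates of a under g, the traces of y, ya, ya² over the orbit of g are fixed
by G, hence rational. They recover y by (a − b)(a − c)y = Tr(ya²) − (b + c)Tr(ya) + bc Tr(y), so y
lies in K. -/
theorem exists_map_eq_kD_of_smul_pow_three (hfix : ∀ x : N, (∀ g : G, g • x = x) → ∃ q : ℚ, j x = kD q)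
    {g : G} (hg : ∀ h : G, h ∈ Subgroup.zpowers g) {a : N} (ha : j a = kD alpha) {y : N}
    (hy : g ^ 3 • y = y) : ∃ κ : K, j y = kD κ := by
  have hrel : a ^ 3 + a ^ 2 - 2 * a - 1 = 0 := by
    refine j.injective ?_
    have := congrArg kD alpha_rel
    simpa only [map_sub, map_add, map_mul, map_pow, map_one, map_ofNat, map_zero, ha] using this
  have hone : g • (1 : N) = 1 := smul_one g
  have htwo : g • (2 : N) = 2 := map_ofNat (MulSemiringAction.toRingHom G N g) 2
  have hrelg : (g • a) ^ 3 + (g • a) ^ 2 - 2 * (g • a) - 1 = 0 := by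
    have := congrArg (g • ·) hrel
    simpa only [smul_sub, smul_add, smul_mul', smul_pow', hone, htwo, smul_zero] using this
  have hne : g • a ≠ a := fun h ↦ by
    obtain ⟨q, hq⟩ := hfix a (smul_eq_of_smul_generator_eq hg h)
    rw [ha] at hq
    exact alpha_ne_ratCast q (kD_injective hq)
  -- The element g(a) ≠ a is one of the two other roots −a² − a + 1 and a² − 2; in both cases g
  -- permutes the three roots cyclically.
  obtain ⟨b, c, κ₁, κ₂, hb, hc, h3, h1, h2⟩ : ∃ (b c : N) (κ₁ κ₂ : K), g • a = b ∧ g • b = c ∧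
      g • c = a ∧ j b = kD κ₁ ∧ j c = kD κ₂ := by
    have hs (κ : K) (b : N) (h : j b = kD κ) : j (-b ^ 2 - b + 1) = kD (-κ ^ 2 - κ + 1) := by
      simp only [map_sub, map_add, map_neg, map_pow, map_one, h]
    have ht (κ : K) (b : N) (h : j b = kD κ) : j (b ^ 2 - 2) = kD (κ ^ 2 - 2) := by
      simp only [map_sub, map_pow, map_ofNat, h]
    rcases mul_eq_zero.1 (sub_mul_sub_mul_sub_eq_zero hrel hrelg) with h | h
    · rcases mul_eq_zero.1 h with h | h
      · exact absurd (sub_eq_zero.1 h) hne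
      · have h := sub_eq_zero.1 h
        refine ⟨-a ^ 2 - a + 1, a ^ 2 - 2, _, _, h, ?_, ?_, hs _ _ ha, ht _ _ ha⟩
        · simp only [smul_sub, smul_add, smul_neg, smul_pow', hone, h]
          linear_combination (-a - 1) * hrel
        · simp only [smul_sub, smul_pow', htwo, h]
          linear_combination (a + 1) * hrel
    · have h := sub_eq_zero.1 h
      refine ⟨a ^ 2 - 2, -a ^ 2 - a + 1, _, _, h, ?_, ?_, ht _ _ ha, hs _ _ ha⟩
      · simp only [smul_sub, smul_pow', htwo, h]
        linear_combination (a - 1) * hrel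
      · simp only [smul_sub, smul_add, smul_neg, smul_pow', hone, h]
        linear_combination (-a + 1) * hrel
  have hac : c ≠ a := fun h ↦ hne (by rw [← h, h3, h])
  have htr (z : N) (hz : g ^ 3 • z = z) : ∃ q : ℚ, j (z + g • z + g • g • z) = kD q := by
    refine hfix _ (smul_eq_of_smul_generator_eq hg ?_)
    have e : g • g • g • z = z := by rw [← mul_smul, ← mul_smul, ← hz, ← pow_three', hz, hz]
    rw [smul_add, smul_add, e]
    ring
  have ha3 : g ^ 3 • a = a := by rw [pow_three', mul_smul, mul_smul, hb, hc, h3]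
  obtain ⟨q0, hq0⟩ := htr y hy
  obtain ⟨q1, hq1⟩ := htr (y * a) (by rw [smul_mul', hy, ha3])
  obtain ⟨q2, hq2⟩ := htr (y * a ^ 2) (by rw [smul_mul', smul_pow', hy, ha3])
  simp only [smul_mul', smul_pow', hb, hc] at hq1 hq2
  have e : y * ((a - b) * (a - c)) = (y * a ^ 2 + g • y * b ^ 2 + g • g • y * c ^ 2) -
      (b + c) * (y * a + g • y * b + g • g • y * c) + b * c * (y + g • y + g • g • y) := by ring
  have e2 : j ((a - b) * (a - c)) = kD ((alpha - κ₁) * (alpha - κ₂)) := by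
    simp only [map_mul, map_sub, ha, h1, h2]
  have e1 : j y * kD ((alpha - κ₁) * (alpha - κ₂)) = kD (q2 - (κ₁ + κ₂) * q1 + κ₁ * κ₂ * q0) := by
    rw [← e2, ← map_mul, e, map_add, map_sub, hq2, map_mul, hq1, map_mul, hq0, map_add, map_mul, h1,
      h2]
    simp only [map_add, map_sub, map_mul]
  have hne' : (alpha - κ₁) * (alpha - κ₂) ≠ 0 := by
    intro h
    rw [h, map_zero, map_eq_zero_iff j j.injective] at e2
    rcases mul_eq_zero.1 e2 with h | h
    · exact hne (hb.trans (sub_eq_zero.1 h).symm)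
    · exact hac (sub_eq_zero.1 h).symm
  refine ⟨(q2 - (κ₁ + κ₂) * q1 + κ₁ * κ₂ * q0) / ((alpha - κ₁) * (alpha - κ₂)), kD_cancel hne' ?_⟩
  rw [kD_comm, e1, ← map_mul, mul_div_cancel₀ _ hne']

end

/-- No subfield of `D` is a Galois extension of `ℚ` of degree `9`. -/
theorem false_of_card_eq_nine {G : Type*} [Group G] [Finite G] [MulSemiringAction G N]
    [FaithfulSMul G N] (hG : Nat.card G = 9)
    (hfix : ∀ x : N, (∀ g : G, g • x = x) → ∃ q : ℚ, j x = kD q) : False := by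
  have := charZero_of_ringHom_D j
  obtain ⟨a, ha⟩ := exists_map_eq_kD_alpha ((finrank_rat_eq_card hfix).trans hG) j
  have := isCyclic_of_fixed_rational hG hfix
  obtain ⟨g, hg⟩ := IsCyclic.exists_generator (α := G)
  have hord : orderOf g = 9 := (orderOf_eq_card_of_forall_mem_zpowers hg).trans hG
  have hcomm : ∀ g h : G, g * h = h * g := IsMulCommutative.is_comm.comm
  obtain ⟨v, hv, hv', hinv, k, _, _, ρ, hI⟩ := place7.exists_valuation_residueField j G
  have : Finite k := Finite.of_injective ρ ρ.injective
  have : CharP k 7 := ρ.charP ρ.injective 7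
  -- The residue field embeds in 𝔽₃₄₃, of degree 3 over 𝔽₇.
  have hk3 (y : k) : g ^ 3 • y = y := by
    have h := pow_smul_of_ringHom (p := 7) ρ g y
    rwa [finrank_F343] at h
  have hin1 := (hI (g ^ 3)).1 hk3
  have hin2 := (hI (g ^ 3 * g ^ 3)).1 fun y ↦ by rw [mul_smul, hk3, hk3]
  have h3 : v (3 : N) = 1 := by
    have := ResiduePlace.map_intCast_eq_one (P := place7) hv hv' (m := 3) (by decide)
    exact_mod_cast this
  have h30 : (3 : N) ≠ 0 := v.ne_zero_iff.1 (by rw [h3]; exact one_ne_zero)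
  have hin (x : N) (hx : v x ≤ 1) : v (g • x - x) < 1 := by
    -- The average of x over {1, g³, g⁶}: it is congruent to x because g³ and g⁶ act trivially on
    -- residues, and it is fixed by g³.
    let y : N := (x + g ^ 3 • x + (g ^ 3 * g ^ 3) • x) / 3
    have hyx : v (y - x) < 1 := by
      have e : 3 * (y - x) = (g ^ 3 • x - x) + ((g ^ 3 * g ^ 3) • x - x) := by
        rw [mul_sub, mul_div_cancel₀ _ h30]; ring
      have h1 := v.map_add_lt (hin1 x hx) (hin2 x hx)
      rwa [← e, map_mul, h3, one_mul] at h1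
    have hy3 : g ^ 3 • y = y := by
      have h9 : g ^ 3 * (g ^ 3 * g ^ 3) = 1 := by rw [← pow_add, ← pow_add, show 3 + (3 + 3) = orderOf g from hord.symm,
        pow_orderOf_eq_one]
      have e3 : g ^ 3 • (3 : N) = 3 := map_ofNat (MulSemiringAction.toRingHom G N (g ^ 3)) 3
      change g ^ 3 • (_ / 3) = _ / 3
      rw [div_eq_mul_inv, smul_mul', smul_inv'', e3, smul_add, smul_add, ← mul_smul, ← mul_smul, h9,
        one_smul]
      ring
    -- Thus y lies in K, whose residues at 7 are integers; an integer is fixed by g, so g too acts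
    -- trivially on the residue of x.
    obtain ⟨κ, hκ⟩ := exists_map_eq_kD_of_smul_pow_three hfix hg ha hy3
    have hym := (hv y).1 (Valuation.le_one_of_sub_lt hyx hx)
    rw [hκ] at hym
    obtain ⟨n, hn⟩ := exists_place7_res_kD hym
    have h5 := ResiduePlace.map_sub_intCast_lt_one (P := place7) hv' hκ hym hn
    have h6 := Valuation.map_sub_lt_trans (Valuation.map_sub_lt_symm hyx) h5
    have h7 : v (g • x - n) < 1 := by
      rw [← hinv g, smul_sub] at h6
      rwa [show g • (n : N) = n from map_intCast (MulSemiringAction.toRingHom G N g) n] at h6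
    exact Valuation.map_sub_lt_trans h7 (Valuation.map_sub_lt_symm h6)
  -- Nonzero n modulo 7 satisfy n⁶ = 1, so n⁹ = 1 implies n³ = 1. Tame inertia then has exponent 3,
  -- against the order 9 of g.
  have h3 : g ^ 3 = 1 := by
    refine ResiduePlace.pow_eq_one_of_inertia (N := N) (P := place7) (v := v) (j := j) hcomm ?_ hv
      hv' hinv hfix ?_ hin
    · rw [hG]; decide
    · intro n hn
      rw [hG] at hn
      rw [← ZMod.intCast_zmod_eq_zero_iff_dvd] at hn ⊢
      push_cast at hn ⊢
      generalize (n : ZMod 7) = x at hn ⊢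
      revert x
      decide
  have := orderOf_dvd_of_pow_eq_one h3
  rw [hord] at this
  exact absurd this (by decide)

end Example9

/-! ### Self-centralizing Galois subfields of division algebras -/

/-- The Lagrange basis polynomials sum to 1, and X − vᵢ times the i-th one is a multiple of the
nodal polynomial, which annihilates f. Their values at f are therefore the projections to the
eigenspaces. -/
theorem Module.End.exists_sum_eigenvectors {K V ι : Type*} [Field K] [AddCommGroup V] [Module K V]
    [Nonempty ι] [Fintype ι] (f : Module.End K V) {v : ι → K} (hv : Function.Injective v)
    (h : Polynomial.aeval f (Lagrange.nodal Finset.univ v) = 0) (x : V) :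
    ∃ y : ι → V, (∀ i, f (y i) = v i • y i) ∧ x = ∑ i, y i := by
  classical
  refine ⟨fun i ↦ Polynomial.aeval f (Lagrange.basis Finset.univ v i) x, fun i ↦ ?_, ?_⟩
  · have e : (Polynomial.X - Polynomial.C (v i)) * Lagrange.basis Finset.univ v i =
        Polynomial.C (Lagrange.nodalWeight Finset.univ v i) * Lagrange.nodal Finset.univ v := by
      rw [Lagrange.basis_eq_prod_sub_inv_mul_nodal_div (Finset.mem_univ i),
        ← Lagrange.nodal_erase_eq_nodal_div (Finset.mem_univ i),
        Lagrange.nodal_eq_mul_nodal_erase (Finset.mem_univ i)]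
      ring
    have h1 := congrArg (fun p ↦ Polynomial.aeval f p x) e
    simp only [map_mul, h, mul_zero, LinearMap.zero_apply, map_sub, Polynomial.aeval_X,
      Polynomial.aeval_C, Module.End.mul_apply, LinearMap.sub_apply,
      Module.algebraMap_end_apply] at h1
    exact sub_eq_zero.1 h1
  · rw [← LinearMap.sum_apply, ← map_sum, Lagrange.sum_basis hv.injOn Finset.univ_nonempty, map_one,
      Module.End.one_apply]

section SkolemNoether

variable {F E Q : Type*} [Field F] [Field E] [Ring Q] [Algebra F E] [Algebra F Q]
  (j : E →ₐ[F] Q)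

/-- `d` induces the automorphism `g` on the image of `j`. -/
def IsTwistedBy (g : E ≃ₐ[F] E) (d : Q) : Prop := ∀ e, d * j e = j (g e) * d

variable {j}

theorem IsTwistedBy.mul {g h : E ≃ₐ[F] E} {a b : Q} (ha : IsTwistedBy j g a)
    (hb : IsTwistedBy j h b) : IsTwistedBy j (g * h) (a * b) := fun e ↦ by
  rw [mul_assoc, hb, ← mul_assoc, ha, mul_assoc]; rfl

theorem IsTwistedBy.inv {g : E ≃ₐ[F] E} {a : Qˣ} (ha : IsTwistedBy j g a) :
    IsTwistedBy j g⁻¹ ↑a⁻¹ := fun e ↦ by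
  rw [Units.inv_mul_eq_iff_eq_mul, ← mul_assoc, ha, mul_assoc, Units.mul_inv, mul_one]
  congr 1
  exact (g.apply_symm_apply e).symm

variable [FiniteDimensional F E]

theorem algebraAdjoin_eq_top {θ : E} (hθ : IntermediateField.adjoin F {θ} = ⊤) :
    Algebra.adjoin F {θ} = ⊤ := by
  rw [← IntermediateField.adjoin_simple_toSubalgebra_of_isAlgebraic
    (IsIntegral.of_finite F θ).isAlgebraic, hθ, IntermediateField.top_toSubalgebra]

theorem galois_apply_injective {θ : E} (hθ : IntermediateField.adjoin F {θ} = ⊤) :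
    Function.Injective fun g : E ≃ₐ[F] E ↦ g θ := fun g h hgh ↦ by
  have h1 : (g : E →ₐ[F] E) = h := AlgHom.ext_of_adjoin_eq_top (algebraAdjoin_eq_top hθ) <| by
    rintro x rfl
    exact hgh
  exact AlgEquiv.ext fun x ↦ DFunLike.congr_fun h1 x

/-- The conjugates of a primitive element are distinct roots, and their number equals the degree. -/
theorem minpoly_map_eq_nodal [IsGalois F E] {θ : E} (hθ : IntermediateField.adjoin F {θ} = ⊤) :
    (minpoly F θ).map (algebraMap F E) = Lagrange.nodal Finset.univ fun g : E ≃ₐ[F] E ↦ g θ := by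
  have hint : IsIntegral F θ := IsIntegral.of_finite F θ
  refine Polynomial.eq_of_monic_of_dvd_of_natDegree_le (Lagrange.nodal_monic (R := E))
    ((minpoly.monic hint).map _) ?_ ?_
  · rw [Lagrange.nodal_eq]
    refine Finset.prod_dvd_of_coprime (fun g _ h _ hgh ↦ ?_) fun g _ ↦ ?_
    · exact Polynomial.pairwise_coprime_X_sub_C (galois_apply_injective hθ) hgh
    · rw [Polynomial.dvd_iff_isRoot, Polynomial.IsRoot, Polynomial.eval_map_algebraMap,
        ← AlgEquiv.coe_toAlgHom g, Polynomial.aeval_algHom_apply, minpoly.aeval, map_zero]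
  · rw [Polynomial.natDegree_map, Lagrange.natDegree_nodal, Finset.card_univ,
      ← Nat.card_eq_fintype_card, IsGalois.card_aut_eq_finrank,
      (Field.primitive_element_iff_minpoly_natDegree_eq F θ).1 hθ]

theorem IsTwistedBy.of_primitive {θ : E} (hθ : IntermediateField.adjoin F {θ} = ⊤) {g : E ≃ₐ[F] E}
    {d : Q} (h : d * j θ = j (g θ) * d) : IsTwistedBy j g d := by
  intro e
  have he : e ∈ Algebra.adjoin F {θ} := by rw [algebraAdjoin_eq_top hθ]; trivial
  induction he using Algebra.adjoin_induction with
  | mem x hx => rw [Set.mem_singleton_iff.1 hx, h]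
  | algebraMap r => rw [AlgEquiv.commutes, AlgHom.commutes, Algebra.commutes]
  | add x y _ _ hx hy => rw [map_add, map_add, map_add, mul_add, add_mul, hx, hy]
  | mul x y _ _ hx hy => rw [map_mul, map_mul, map_mul, ← mul_assoc, hx, mul_assoc, hy, mul_assoc]

variable [IsGalois F E]

variable (j) in
/-- `Q` as a left vector space over the subfield `j(E)`. -/
@[reducible] def leftModule : Module E Q := Module.compHom Q j.toRingHom

/-- Right multiplication by a primitive element θ is linear for the left E-structure of Q and is
annihilated by the minimal polynomial of θ, which splits in E with distinct roots. The eigenvectors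
for g(θ) are the elements that induce g. -/
theorem exists_sum_twisted (x : Q) : ∃ y : (E ≃ₐ[F] E) → Q, (∀ g, IsTwistedBy j g (y g)) ∧
    x = ∑ g, y g := by
  let _ := leftModule j
  have hs (e : E) (q : Q) : e • q = j e * q := rfl
  have : IsScalarTower F E Q := ⟨fun a b c ↦ by
    rw [hs, hs, map_smul, smul_mul_assoc]⟩
  have : SMulCommClass F E Q := ⟨fun a b c ↦ by rw [hs, hs, mul_smul_comm]⟩
  have : SMulCommClass E F Q := SMulCommClass.symm _ _ _
  let R : E →ₐ[F] Module.End E Q :=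
    { toFun e :=
        { toFun q := q * j e
          map_add' := fun a b ↦ add_mul ..
          map_smul' := fun a b ↦ mul_assoc _ _ _ }
      map_one' := by ext q; exact (congrArg (q * ·) (map_one j)).trans (mul_one q)
      -- Right multiplication reverses products, which does no harm as E is commutative.
      map_mul' := fun a b ↦ by
        ext q
        change q * j (a * b) = q * j b * j a
        rw [mul_comm, map_mul, mul_assoc]
      map_zero' := by ext q; exact (congrArg (q * ·) (map_zero j)).trans (mul_zero q)
      map_add' := fun a b ↦ by ext q; exact (congrArg (q * ·) (map_add j a b)).trans (mul_add ..)
      commutes' := fun r ↦ by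
        ext q
        change q * j (algebraMap F E r) = r • q
        rw [AlgHom.commutes, ← Algebra.commutes, Algebra.smul_def] }
  obtain ⟨θ, hθ⟩ := Field.exists_primitive_element F E
  have h0 : Polynomial.aeval (R θ) (Lagrange.nodal Finset.univ fun g : E ≃ₐ[F] E ↦ g θ) = 0 := by
    rw [← minpoly_map_eq_nodal hθ, Polynomial.aeval_map_algebraMap, Polynomial.aeval_algHom_apply,
      minpoly.aeval, map_zero]
  obtain ⟨y, hy, hx⟩ := Module.End.exists_sum_eigenvectors (R θ) (galois_apply_injective hθ) h0 x
  exact ⟨y, fun g ↦ IsTwistedBy.of_primitive hθ (hy g), hx⟩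

variable [IsDomain Q]

variable (j) in
/-- The automorphisms of `E` induced by elements of `Q`. -/
def twistGroup [FiniteDimensional F Q] : Subgroup (E ≃ₐ[F] E) where
  carrier := {g | ∃ d ≠ 0, IsTwistedBy j g d}
  one_mem' := ⟨1, one_ne_zero, fun e ↦ by rw [one_mul, mul_one]; rfl⟩
  mul_mem' := by
    rintro g h ⟨a, ha, ha'⟩ ⟨b, hb, hb'⟩
    exact ⟨a * b, mul_ne_zero ha hb, ha'.mul hb'⟩
  inv_mem' := by
    rintro g ⟨a, ha, ha'⟩
    lift a to Qˣ using isUnit_of_finite_of_ne_zero F ha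
    exact ⟨_, a⁻¹.ne_zero, ha'.inv⟩

variable [FiniteDimensional F Q]

/-- An element of E fixed by all induced automorphisms commutes with every nonzero twisted element,
hence with all of Q, and lies in F. The Galois correspondence concludes. -/
theorem twistGroup_eq_top [Algebra.IsCentral F Q] : twistGroup j = ⊤ := by
  have h : IntermediateField.fixedField (twistGroup j) = ⊥ := by
    refine eq_bot_iff.2 fun e he ↦ ?_
    rw [IntermediateField.mem_fixedField_iff] at he
    have hc : j e ∈ Subalgebra.center F Q := by
      rw [Subalgebra.mem_center_iff]
      intro q
      obtain ⟨y, hy, rfl⟩ := exists_sum_twisted (j := j) q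
      rw [Finset.sum_mul, Finset.mul_sum]
      refine Finset.sum_congr rfl fun g _ ↦ ?_
      by_cases h0 : y g = 0
      · rw [h0, zero_mul, mul_zero]
      · rw [hy, he g ⟨_, h0, hy g⟩]
    rw [Algebra.IsCentral.center_eq_bot, Algebra.mem_bot] at hc
    obtain ⟨c, hc⟩ := hc
    rw [IntermediateField.mem_bot]
    exact ⟨c, j.toRingHom.injective ((j.commutes c).trans hc)⟩
  rw [← IntermediateField.fixingSubgroup_fixedField (twistGroup j), h,
    IntermediateField.fixingSubgroup_bot]

/-- The Skolem–Noether theorem for a self-centralizing Galois subfield. -/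
theorem exists_isTwistedBy [Algebra.IsCentral F Q] (g : E ≃ₐ[F] E) : ∃ d ≠ 0, IsTwistedBy j g d := by
  have h : g ∈ twistGroup j := by rw [twistGroup_eq_top]; trivial
  exact h

/-- Nonzero elements d_g that induce the g are eigenvectors for distinct eigenvalues, hence
independent over E. They span: if y also induces g, then y d_g⁻¹ centralizes E, so lies in E. -/
theorem finrank_eq_sq [Algebra.IsCentral F Q] (hj : ∀ q : Q, (∀ e, q * j e = j e * q) → ∃ e, q = j e) :
    Module.finrank F Q = Module.finrank F E ^ 2 := by
  choose d hd0 hd using exists_isTwistedBy (j := j)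
  let _ := leftModule j
  have hs (e : E) (q : Q) : e • q = j e * q := rfl
  have : IsScalarTower F E Q := ⟨fun a b c ↦ by
    rw [hs, hs, map_smul, smul_mul_assoc]⟩
  obtain ⟨θ, hθ⟩ := Field.exists_primitive_element F E
  let f : Module.End E Q :=
    { toFun q := q * j θ
      map_add' := fun a b ↦ add_mul ..
      map_smul' := fun a b ↦ mul_assoc _ _ _ }
  have hli : LinearIndependent E d := by
    refine f.eigenvectors_linearIndependent' _ (galois_apply_injective hθ) d fun g ↦ ?_
    exact ⟨Module.End.mem_eigenspace_iff.2 (hd g θ), hd0 g⟩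
  have hsp : ⊤ ≤ Submodule.span E (Set.range d) := by
    intro x _
    obtain ⟨y, hy, rfl⟩ := exists_sum_twisted (j := j) x
    refine Submodule.sum_mem _ fun g _ ↦ ?_
    obtain ⟨u, hu⟩ := isUnit_of_finite_of_ne_zero F (hd0 g)
    have hug : IsTwistedBy j g (u : Q) := by rw [hu]; exact hd g
    obtain ⟨e, he⟩ := hj (y g * ↑u⁻¹) fun e ↦ by
      have := (hy g).mul hug.inv e
      rwa [mul_inv_cancel] at this
    have e1 : y g = e • d g := by rw [hs, ← he, ← hu, Units.inv_mul_cancel_right]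
    rw [e1]
    exact Submodule.smul_mem _ _ (Submodule.subset_span ⟨g, rfl⟩)
  rw [← Module.finrank_mul_finrank F E Q, Module.finrank_eq_card_basis (Module.Basis.mk hli hsp),
    ← Nat.card_eq_fintype_card, IsGalois.card_aut_eq_finrank, sq]

end SkolemNoether

/-! ### Galois subfields of the twisted function field -/

/-- Adjoining q to M gives a commutative finite-dimensional domain, hence a subfield, and M is
maximal. -/
theorem Subalgebra.mem_of_maximal_isField {F Q : Type*} [Field F] [Ring Q] [Algebra F Q] [IsDomain Q]
    [FiniteDimensional F Q] {M : Subalgebra F Q}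
    (hM : Maximal (fun S : Subalgebra F Q ↦ IsField S) M) {q : Q} (hq : ∀ m ∈ M, q * m = m * q) :
    q ∈ M := by
  let s : Set Q := insert q M
  have hcomm : ∀ a ∈ s, ∀ b ∈ s, a * b = b * a := by
    rintro a (rfl | ha) b (rfl | hb)
    · rfl
    · exact hq b hb
    · exact (hq a ha).symm
    · exact congrArg Subtype.val (hM.prop.mul_comm ⟨a, ha⟩ ⟨b, hb⟩)
  have hS : IsField (Algebra.adjoin F s) :=
    { exists_pair_ne := ⟨0, 1, zero_ne_one⟩
      mul_comm := (Algebra.isMulCommutative_adjoin F hcomm).is_comm.comm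
      mul_inv_cancel := fun ha ↦ by
        obtain ⟨u, rfl⟩ := isUnit_of_finite_of_ne_zero F ha
        exact ⟨_, u.mul_inv⟩ }
  exact hM.le_of_ge hS (fun m hm ↦ Algebra.subset_adjoin (Set.mem_insert_of_mem q hm))
    (Algebra.subset_adjoin (Set.mem_insert q _))

/-! ### Residues of the `x`-adic valuation -/

namespace TwistedLaurentSeries

variable {R : Type*} [Ring R] {σ : RingAut R}

theorem xAdic_le_one_iff {δ : ℝ≥0} (h0 : 0 < δ) (h1 : δ < 1) (f : TwistedLaurentSeries σ) :
    xAdic δ f ≤ 1 ↔ ∀ n < 0, coeff f n = 0 := by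
  rw [← xAdic_le_iff h0 h1, zpow_zero]

theorem xAdic_lt_one_iff {δ : ℝ≥0} (h0 : 0 < δ) (h1 : δ < 1) (f : TwistedLaurentSeries σ) :
    xAdic δ f < 1 ↔ ∀ n < 1, coeff f n = 0 := by
  rw [← xAdic_le_iff h0 h1, zpow_one]
  refine ⟨fun h ↦ ?_, fun h ↦ h.trans_lt h1⟩
  by_cases hf : f = 0
  · rw [hf, xAdic_zero]; exact zero_le
  · rw [xAdic_of_ne hf] at h ⊢
    have h2 : 0 < ord f := by
      rwa [← zpow_zero δ, zpow_lt_zpow_iff_right_of_lt_one₀ h0 h1] at h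
    rw [← zpow_one δ, ← zpow_mul, one_mul]
    exact (zpow_le_zpow_iff_right_of_lt_one₀ h0 h1).2 h2

theorem xAdic_lt_one_iff_coeff_zero {δ : ℝ≥0} (h0 : 0 < δ) (h1 : δ < 1) {f : TwistedLaurentSeries σ}
    (hf : xAdic δ f ≤ 1) : xAdic δ f < 1 ↔ coeff f 0 = 0 := by
  rw [xAdic_lt_one_iff h0 h1]
  rw [xAdic_le_one_iff h0 h1] at hf
  refine ⟨fun h ↦ h 0 zero_lt_one, fun h n hn ↦ ?_⟩
  rcases (Int.lt_add_one_iff.1 (hn.trans_eq (zero_add 1).symm)).lt_or_eq with h2 | rfl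
  · exact hf n h2
  · exact h

/-- The constant coefficient, as a ring homomorphism on the power series that come from a ring `A`.
-/
def constantCoeff {A : Type*} [Ring A] (φ : A →+* TwistedLaurentSeries σ)
    (h : ∀ a, ∀ n < 0, coeff (φ a) n = 0) : A →+* R where
  toFun a := coeff (φ a) 0
  map_one' := by rw [map_one, coeff_one, if_pos rfl]
  map_zero' := by rw [map_zero, coeff_zero]
  map_add' a b := by rw [map_add, coeff_add]
  map_mul' a b := by
    rw [map_mul, ← add_zero (0 : ℤ), coeff_mul_add (h a) (h b), zpow_zero]
    rfl

theorem coeff_zero_commute {f : TwistedLaurentSeries σ} {a : R}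
    (h : monomial σ 0 a * f = f * monomial σ 0 a) : a * coeff f 0 = coeff f 0 * a := by
  have h1 := congrArg (coeff · 0) h
  simp only [coeff_monomial_mul, coeff_mul_monomial, sub_zero, zpow_zero] at h1
  exact h1

theorem apply_coeff_zero {f : TwistedLaurentSeries σ}
    (h : monomial σ 1 1 * f = f * monomial σ 1 1) : σ (coeff f 0) = coeff f 0 := by
  have h1 := congrArg (coeff · 1) h
  simpa only [coeff_monomial_mul, coeff_mul_monomial, sub_self, zpow_one, zpow_zero, one_mul,
    map_one, mul_one] using h1

end TwistedLaurentSeries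

namespace Example9

variable {τ : RingAut D}

theorem IsSigmaTilde.exists_rat_of_commute (hτ : IsSigmaTilde τ) {x : D} (hx : ∀ y, y * x = x * y)
    (hx' : τ x = x) : ∃ q : ℚ, x = kD q := by
  obtain ⟨κ, rfl⟩ := mem_K_of_commute (hx thetaD).symm (hx uD).symm
  rw [hτ.apply_kD] at hx'
  obtain ⟨q, rfl⟩ := mem_rat_of_sigmaK_eq (kD_injective hx')
  exact ⟨q, rfl⟩

open TwistedLaurentSeries in
theorem IsSigmaTilde.false_of_card_eq_nine (hτ : IsSigmaTilde τ) {E : Type*} [Field E] {G : Type*}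
    [Group G] [Finite G] [MulSemiringAction G E] [FaithfulSMul G E]
    (φ : E →+* TwistedLaurentSeries τ) (hG : Nat.card G = 9)
    (hconj : ∀ g : G, ∃ d ≠ 0, ∀ e, d * φ e = φ (g • e) * d)
    (hfix : ∀ a : E, (∀ g : G, g • a = a) → (∀ b, monomial τ 0 b * φ a = φ a * monomial τ 0 b) ∧
      monomial τ 1 1 * φ a = φ a * monomial τ 1 1) : False := by
  have h0 : (0 : ℝ≥0) < 1 / 2 := by norm_num
  have h1 : (1 / 2 : ℝ≥0) < 1 := by norm_num
  let w := xAdicValuation τ h0 h1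
  let v : Valuation E ℝ≥0 := w.comap φ
  have hle (x : E) : v x ≤ 1 ↔ ∀ n < 0, coeff (φ x) n = 0 := xAdic_le_one_iff h0 h1 _
  have hlt {x : E} (hx : v x ≤ 1) : v x < 1 ↔ coeff (φ x) 0 = 0 :=
    xAdic_lt_one_iff_coeff_zero h0 h1 hx
  -- The action is induced by conjugation by a nonzero d, and the values commute, so the value of d
  -- cancels.
  have hinv (g : G) (x : E) : v (g • x) = v x := by
    obtain ⟨d, hd, h⟩ := hconj g
    have h2 := congrArg w (h x)
    rw [map_mul, map_mul, mul_comm] at h2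
    exact (mul_right_cancel₀ (fun h3 ↦ hd (by
      by_contra hd'
      rw [xAdicValuation_apply, xAdic_of_ne hd'] at h3
      exact zpow_ne_zero _ h0.ne' h3)) h2).symm
  have hrat (a : E) (ha : ∀ g : G, g • a = a) : ∃ q : ℚ, coeff (φ a) 0 = kD q :=
    hτ.exists_rat_of_commute (fun y ↦ coeff_zero_commute ((hfix a ha).1 y))
      (apply_coeff_zero (hfix a ha).2)
  obtain ⟨k, _, _, π, hπ, hπ0, hπG, hI⟩ := v.exists_residueField hinv
  let r : v.valuationSubring →+* D := constantCoeff (φ.comp v.valuationSubring.subtype)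
    fun x ↦ (hle x).1 x.2
  obtain ⟨ρ, hρ⟩ := Valuation.exists_lift_residue hπ r fun x hx ↦ (hlt x.2).1 ((hπ0 x).1 hx)
  have hr (x : v.valuationSubring) : r x = 0 ↔ v (x : E) < 1 := (hlt x.2).symm
  have h9 : v (Nat.card G : E) = 1 := by
    refine le_antisymm (Nat.card G : v.valuationSubring).2 (not_lt.1 fun h ↦ ?_)
    have : CharZero D := algebraRat.charZero D
    have h2 := (hr (Nat.card G : v.valuationSubring)).2 h
    rw [map_natCast, Nat.cast_eq_zero] at h2
    exact Nat.card_pos.ne' h2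
  have hcomm : ∀ g h : G, g * h = h * g := by
    have := Fact.mk Nat.prime_three
    exact (IsPGroup.isMulCommutative_of_card_eq_prime_sq (p := 3) (by rw [hG]; norm_num)).is_comm.comm
  -- Inertia is trivial: it is tame in residue characteristic 0, and a rational q with q⁹ = 1 is 1
  -- because 9 is odd.
  have : FaithfulSMul G k := by
    refine faithfulSMul_of_forall_smul_eq fun g hg ↦ ?_
    rw [← pow_one g]
    refine v.pow_eq_one_of_inertia hcomm hinv h9 (fun a ha h ↦ ?_) ((hI g).1 hg)
    have ha1 : v a ≤ 1 := by
      have h2 := Valuation.le_one_of_sub_lt h (map_one v).le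
      rw [map_pow] at h2
      exact (pow_le_one_iff_of_nonneg zero_le Nat.card_pos.ne').1 h2
    obtain ⟨q, hq⟩ := hrat a ha
    have hra : r ⟨a, ha1⟩ = kD q := hq
    have h3 := (hr (⟨a, ha1⟩ ^ Nat.card G - 1)).2 h
    rw [map_sub, map_pow, hra, map_one, hG, sub_eq_zero, ← map_pow, ← map_one kD] at h3
    have h4 : q ^ 9 = 1 := by exact_mod_cast kD_injective h3
    have h5 : q = 1 :=
      (show Odd 9 by decide).strictMono_pow.injective (h4.trans (one_pow 9).symm)
    rw [pow_one]
    refine (hr (⟨a, ha1⟩ - 1)).1 ?_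
    rw [map_sub, hra, h5, Rat.cast_one, map_one, map_one, sub_self]
  refine Example9.false_of_card_eq_nine (j := ρ) hG fun y hy ↦ ?_
  obtain ⟨x, rfl⟩ := hπ y
  -- A fixed residue lifts to a fixed element by averaging, and fixed elements have rational
  -- constant coefficients.
  obtain ⟨a, ha, hax⟩ := Valuation.exists_fixed_sub_lt_one h9 (x := (x : E)) fun g ↦ by
    have hgx : v (g • (x : E)) ≤ 1 := (hinv g x).trans_le x.2
    have h2 := hπG g x ⟨_, hgx⟩ rfl
    rw [hy g, ← sub_eq_zero, ← map_sub, hπ0] at h2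
    exact h2
  have ha1 : v a ≤ 1 := Valuation.le_one_of_sub_lt hax x.2
  obtain ⟨q, hq⟩ := hrat a ha
  have e : π x = π ⟨a, ha1⟩ := by
    rw [eq_comm, ← sub_eq_zero, ← map_sub, hπ0]
    exact hax
  rw [e, hρ]
  exact ⟨q, hq⟩

end Example9

/-! ### Conclusion -/

namespace Example9

variable {τ : RingAut D}

theorem exists_inducesCube (hτ : IsSigmaTilde τ) : ∃ d : Dˣ, InducesCube τ d := by
  obtain ⟨d, h1, h2⟩ := exists_d
  have h := (isSigmaTilde_iff τ).1 hτ
  exact ⟨d, fun a ↦ by rw [h, h, h, h1], by rw [h, h2]⟩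

theorem isDivisionAlgebraOfDegree (hτ : IsSigmaTilde τ) {d : Dˣ} (h : InducesCube τ d)
    [OreLocalization.OreSet (nonZeroDivisors (TwistedPolynomial τ))] :
    letI := TwistedFunctionField.algebraRatFunc h
    IsDivisionAlgebraOfDegree (RatFunc ℚ) (TwistedFunctionField τ) 9 := by
  let _ := TwistedFunctionField.algebraRatFunc h
  refine ⟨inferInstance, fun a ha ↦ isUnit_iff_ne_zero.2 ha,
    TwistedFunctionField.isCentral_ratFunc h (onlyInnerPowers hτ h),
    TwistedFunctionField.finite_ratFunc (Module.finBasis ℚ D) h, ?_⟩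
  refine (TwistedFunctionField.finrank_ratFunc (Module.finBasis ℚ D) h).trans ?_
  rw [Fintype.card_fin, finrank_D]; norm_num

/-- A Galois maximal subfield is self-centralizing, so its degree is 9 because 81 = 9². Its
automorphisms are induced by elements of D(x, σ̃), and this persists in the Laurent series ring; its
fixed elements are central, hence commute with the constants and with x. -/
theorem not_isCrossedProduct (hτ : IsSigmaTilde τ) {d : Dˣ} (h : InducesCube τ d)
    [OreLocalization.OreSet (nonZeroDivisors (TwistedPolynomial τ))] :
    letI := TwistedFunctionField.algebraRatFunc h
    ¬ IsCrossedProduct (RatFunc ℚ) (A := TwistedFunctionField τ) := by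
  let _ := TwistedFunctionField.algebraRatFunc h
  obtain ⟨-, -, hcentral, hfinite, hrank⟩ := isDivisionAlgebraOfDegree hτ h
  rintro ⟨M, hM, E, _, _, _, ⟨e⟩⟩
  let j : E →ₐ[RatFunc ℚ] TwistedFunctionField τ := M.val.comp e.toAlgHom
  have hj (x : E) : j x = e x := rfl
  have : FiniteDimensional (RatFunc ℚ) E := Module.Finite.of_injective j.toLinearMap j.injective
  have hself (q : TwistedFunctionField τ) (hq : ∀ x, q * j x = j x * q) : ∃ x, q = j x := by
    have hqM : q ∈ M := Subalgebra.mem_of_maximal_isField hM fun m hm ↦ by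
      have h1 := hq (e.symm ⟨m, hm⟩)
      rwa [hj, AlgEquiv.apply_symm_apply] at h1
    exact ⟨e.symm ⟨q, hqM⟩, by rw [hj, AlgEquiv.apply_symm_apply]⟩
  have hsq := finrank_eq_sq hself
  rw [hrank] at hsq
  have h9 : Nat.card (E ≃ₐ[RatFunc ℚ] E) = 9 := by
    rw [IsGalois.card_aut_eq_finrank]
    exact (Nat.pow_left_injective two_ne_zero hsq).symm
  let ι := TwistedFunctionField.toLaurent (σ := τ) fun _ ↦ isUnit_D
  refine hτ.false_of_card_eq_nine (ι.comp j.toRingHom) h9 (fun g ↦ ?_) fun a ha ↦ ?_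
  · obtain ⟨d, hd0, hd⟩ := exists_isTwistedBy (j := j) g
    refine ⟨ι d, (map_ne_zero_iff ι ι.injective).2 hd0, fun x ↦ ?_⟩
    exact (map_mul ι d (j x)).symm.trans ((congrArg ι (hd x)).trans (map_mul ι _ _))
  · obtain ⟨c, rfl⟩ := (IsGalois.mem_range_algebraMap_iff_fixed a).2 ha
    have hc : ι.comp j.toRingHom (algebraMap _ _ c) = ι (algebraMap _ _ c) :=
      congrArg ι (j.commutes c)
    rw [hc]
    refine ⟨fun b ↦ ?_, ?_⟩
    · rw [← TwistedFunctionField.toLaurent_C (fun _ ↦ isUnit_D), ← map_mul, ← map_mul,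
        Algebra.commutes]
    · rw [← TwistedFunctionField.toLaurent_X (fun _ ↦ isUnit_D), ← map_mul, ← map_mul,
        Algebra.commutes]

end Example9

end

theorem mainTheorem2 :
    (∃! τ : RingAut Example9.D, Example9.IsSigmaTilde τ) ∧
    ∀ τ : RingAut Example9.D, Example9.IsSigmaTilde τ →
      ∃ _ : OreLocalization.OreSet (nonZeroDivisors (TwistedPolynomial τ)),
        (∃ d : Example9.Dˣ, (∀ a, τ (τ (τ a)) = d * a * ↑d⁻¹) ∧ τ d = d) ∧
        (∀ d : Example9.Dˣ, (∀ a, τ (τ (τ a)) = d * a * ↑d⁻¹) → τ d = d →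
          ∃ _ : Algebra (RatFunc ℚ) (TwistedFunctionField τ),
            algebraMap (RatFunc ℚ) (TwistedFunctionField τ) RatFunc.X =
              TwistedFunctionField.C τ ↑d⁻¹ * TwistedFunctionField.X τ ^ 3 ∧
            IsDivisionAlgebraOfDegree (RatFunc ℚ) (TwistedFunctionField τ) 9 ∧
            ¬ IsCrossedProduct (RatFunc ℚ) (A := TwistedFunctionField τ)) ∧
        (∀ δ : ℝ≥0, 0 < δ → δ < 1 →
          ∃ (v : Valuation (TwistedFunctionField τ) ℝ≥0)
            (w : Valuation (TwistedLaurentSeries τ) ℝ≥0)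
            (ι : TwistedFunctionField τ →+* TwistedLaurentSeries τ),
            (∀ p : TwistedPolynomial τ, p ≠ 0 →
              v (TwistedFunctionField.ofPoly τ p) = δ ^ sInf {n : ℕ | p.coeff n ≠ 0}) ∧
            (∀ g : TwistedLaurentSeries τ, w g = TwistedLaurentSeries.xAdic δ g) ∧
            (∀ a : Example9.D, ι (TwistedFunctionField.C τ a) =
              TwistedLaurentSeries.monomial τ 0 a) ∧
            ι (TwistedFunctionField.X τ) = TwistedLaurentSeries.monomial τ 1 1 ∧
            IsValuedCompletion v w ι) := by
  refine ⟨Example9.existsUnique_isSigmaTilde, fun τ hτ ↦ ?_⟩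
  obtain ⟨d, hd⟩ := Example9.exists_inducesCube hτ
  -- One particular d suffices for the Ore condition; the remaining assertions are then proved for
  -- every admissible d.
  obtain ⟨hore⟩ := TwistedPolynomial.nonempty_oreSet (Module.finBasis ℚ Example9.D) hd
  refine ⟨hore, ⟨d, hd.cube, hd.fixed⟩, fun d h1 h2 ↦ ?_, fun δ h0 h1 ↦ ?_⟩
  · have h : InducesCube τ d := ⟨h1, h2⟩
    exact ⟨TwistedFunctionField.algebraRatFunc h, TwistedFunctionField.algebraMap_X h,
      Example9.isDivisionAlgebraOfDegree hτ h, Example9.not_isCrossedProduct hτ h⟩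
  · refine ⟨(TwistedLaurentSeries.xAdicValuation τ h0 h1).comap
      (TwistedFunctionField.toLaurent fun _ ↦ Example9.isUnit_D),
      TwistedLaurentSeries.xAdicValuation τ h0 h1,
      TwistedFunctionField.toLaurent fun _ ↦ Example9.isUnit_D, fun p hp ↦ ?_, fun g ↦ rfl,
      TwistedFunctionField.toLaurent_C _, TwistedFunctionField.toLaurent_X _,
      TwistedLaurentSeries.isValuedCompletion _ h0 h1⟩
    rw [Valuation.comap_apply, TwistedFunctionField.toLaurent_ofPoly,
      TwistedLaurentSeries.xAdicValuation_apply, TwistedPolynomial.xAdic_toLaurent δ hp]
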